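/- Let $N\ge 1$ be an integer and let $\theta>0$, $\gamma>1$, $\gamma\le q\le p<\infty$, $-\theta/\gamma<s<0$ and $s\ge N/p-\theta/(\gamma-1)$. Notation. For measurable $f:\mathbf R^N\to\mathbf C$ put $\|f|M^p_q\|=\sup_{x\in\mathbf R^N,\,0<\rho\le 1}\rho^{N/p-N/q}\|f\|_{L^q(B(x,\rho))}$, and let $M^p_q$ be the set of those $f$ for which this is finite. Fix a smooth $\zeta:[0,\infty)\to[0,1]$ with $\zeta=1$ on $[0,3/2]$ and $\operatorname{supp}\zeta\subset[0,5/3)$, and put $\varphi_{(0)}(\xi)=\zeta(|\xi|)$ and $\varphi_j(\xi)=\zeta(2^{-j}|\xi|)-\zeta(2^{1-j}|\xi|)$. Let $\mathcal F$ be the Fourier transform with kernel $e^{-i x\cdot\xi}$. The space $N^s_{p,q,\infty}$ consists of the tempered distributions $\varphi$ on $\mathbf R^N$ such that $\mathcal F^{-1}\varphi_{(0)}\mathcal F\varphi\in M^p_q$, $\mathcal F^{-1}\varphi_j\mathcal F\varphi\in M^p_q$ for all $j\ge1$, and $\|\mathcal F^{-1}\varphi_{(0)}\mathcal F\varphi|M^p_q\|+\sup_{j\ge1}2^{sj}\|\mathcal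 F^{-1}\varphi_j\mathcal F\varphi|M^p_q\|<\infty$. For $t>0$ let $S(t)=\mathcal F^{-1}e^{-t|\xi|^\theta}\mathcal F$; on bounded functions it is convolution with the integrable kernel $\mathcal F^{-1}e^{-t|\xi|^\theta}$, and for $\varphi\in N^s_{p,q,\infty}$, $S(t)\varphi$ is the sum of the convolution of this kernel with the function $\mathcal F^{-1}\varphi_{(0)}\mathcal F\varphi$ and of $\mathcal F^{-1}(1-\varphi_{(0)})e^{-t|\xi|^\theta}\mathcal F\varphi$, whose symbol is a Schwartz function. For $T>0$, a solution on $\mathbf R^N\times[0,T)$ of $$\partial_t u+(-\Delta)^{\theta/2}u=|u|^{\gamma-1}u,\qquad u(\cdot,0)=\varphi,$$ is a function $u$ that is bounded and continuous on $\mathbf R^N\times(\tau,T)$ for every $\tau\in(0,T)$ and satisfies $$u(x,t)=[S(t)\varphi](x)+\int_0^t\big[S(t-\tau)|u(\cdot,\tau)|^{\gamma-1}u(\cdot,\tau)\big](x)\,d\tau$$ (with an absolutely convergent integral) for all $(x,t)\in\mathbf R^N\times(0,T)$. Distributions and functions may be complex-valued. Theorem. There exist $\delta>0$ and $M>0$ such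 that for every $\varphi\in N^s_{p,q,\infty}$ with $$\limsup_{j\to\infty}2^{sj}\|\mathcal F^{-1}\varphi_j\mathcal F\varphi|M^p_q\|<\delta$$ there is $T>0$ for which the problem has a solution $u$ on $\mathbf R^N\times[0,T)$ with $\sup_{0<t\le T}t^{-s/\theta}\|u(\cdot,t)|M^p_q\|\le M$, and any two solutions on $\mathbf R^N\times[0,T)$ satisfying this bound coincide on $\mathbf R^N\times(0,T)$. -/

import Mathlib

open scoped SchwartzMap ContDiff FourierTransform ENNReal

noncomputable section

namespace BesovMorrey

/-- `ℝ^N` with its Euclidean norm. -/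
abbrev Sp (N : ℕ) : Type := EuclideanSpace ℝ (Fin N)

/-! ### Cutoff functions and dyadic symbols -/

/-- A smooth function `ζ` on `[0, ∞)` with `0 ≤ ζ ≤ 1`, `ζ = 1` on `[0, 3/2]` and
`supp ζ ⊂ [0, 5/3)`. (The values at negative arguments play no role.) -/
structure Cutoff where
  toFun : ℝ → ℝ
  smooth : ContDiffOn ℝ ∞ toFun (Set.Ici 0)
  nonneg : ∀ r, 0 ≤ r → 0 ≤ toFun r
  le_one : ∀ r, 0 ≤ r → toFun r ≤ 1
  eq_one : ∀ r, 0 ≤ r → r ≤ 3 / 2 → toFun r = 1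
  supp : closure {r : ℝ | 0 ≤ r ∧ toFun r ≠ 0} ⊆ Set.Ico 0 (5 / 3)

instance : CoeFun Cutoff (fun _ => ℝ → ℝ) := ⟨Cutoff.toFun⟩

theorem Cutoff.eq_zero (ζ : Cutoff) {r : ℝ} (hr : 5 / 3 ≤ r) : ζ r = 0 := by
  by_contra h
  have := (ζ.supp (subset_closure ⟨by linarith, h⟩)).2
  linarith

theorem Cutoff.contDiff_sqrt (ζ : Cutoff) : ContDiff ℝ ∞ (fun r : ℝ => ζ (√r)) := by
  rw [contDiff_iff_contDiffAt]
  intro r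
  rcases lt_or_ge r 2 with h | h
  · have : (fun r : ℝ => ζ (√r)) =ᶠ[nhds r] fun _ => 1 := by
      filter_upwards [Iio_mem_nhds h] with x hx
      refine ζ.eq_one _ (Real.sqrt_nonneg _) ?_
      rw [Real.sqrt_le_left (by norm_num)]
      have : x < 2 := hx
      linarith
    exact contDiffAt_const.congr_of_eventuallyEq this
  · have hr : 0 < r := by linarith
    have h1 : ContDiffAt ℝ ∞ ζ.toFun (√r) :=
      ζ.smooth.contDiffAt (Ici_mem_nhds (Real.sqrt_pos.2 hr))
    exact h1.comp r (Real.contDiffAt_sqrt hr.ne')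

/-- In this file `𝓕` is the Fourier transform with kernel `e^{-2πi⟨x,ξ⟩}`. A function `m` of the
angular frequency (kernel `e^{-i⟨x,ξ⟩}`, for which `(-Δ)^{θ/2}` has the symbol `|ξ|^θ`) becomes the
function `ξ ↦ m(2πξ)`. This is the length `|2πξ|` of the angular frequency. -/
def freq {N : ℕ} (ξ : Sp N) : ℝ := ‖(2 * Real.pi) • ξ‖

theorem freq_nonneg {N : ℕ} (ξ : Sp N) : 0 ≤ freq ξ := norm_nonneg _

theorem freq_eq {N : ℕ} (ξ : Sp N) : freq ξ = 2 * Real.pi * ‖ξ‖ := by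
  rw [freq, norm_smul, Real.norm_of_nonneg (by positivity)]

theorem hasTemperateGrowth_freq_sq {N : ℕ} :
    Function.HasTemperateGrowth (fun ξ : Sp N => freq ξ ^ 2) := by
  have : (fun ξ : Sp N => freq ξ ^ 2) = fun ξ => (2 * Real.pi) ^ 2 * ‖ξ‖ ^ 2 := by
    funext ξ; rw [freq_eq]; ring
  rw [this]
  exact (Function.HasTemperateGrowth.const _).mul (Function.hasTemperateGrowth_norm_sq (Sp N))

theorem contDiff_dilate {N : ℕ} (ζ : Cutoff) (k : ℤ) :
    ContDiff ℝ ∞ (fun ξ : Sp N => ((ζ ((2 : ℝ) ^ (-k) * freq ξ) : ℝ) : ℂ)) := by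
  have : (fun ξ : Sp N => ((ζ ((2 : ℝ) ^ (-k) * freq ξ) : ℝ) : ℂ)) =
      fun ξ => Complex.ofRealCLM (ζ (√(((2 : ℝ) ^ (-k)) ^ 2 * freq ξ ^ 2))) := by
    funext ξ
    rw [← mul_pow, Real.sqrt_sq (mul_nonneg (by positivity) (freq_nonneg ξ))]
    rfl
  rw [this]
  exact Complex.ofRealCLM.contDiff.comp
    (ζ.contDiff_sqrt.comp (contDiff_const.mul hasTemperateGrowth_freq_sq.1))

theorem hasCompactSupport_dilate {N : ℕ} (ζ : Cutoff) (k : ℤ) :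
    HasCompactSupport (fun ξ : Sp N => ((ζ ((2 : ℝ) ^ (-k) * freq ξ) : ℝ) : ℂ)) := by
  refine HasCompactSupport.intro (isCompact_closedBall (0 : Sp N) (2 * (2 : ℝ) ^ k)) ?_
  intro ξ hξ
  have h1 : 2 * (2 : ℝ) ^ k < ‖ξ‖ := by simpa using hξ
  have h2 : (0 : ℝ) < 2 ^ (-k) := by positivity
  have h3 : (2 : ℝ) ^ (-k) * 2 ^ k = 1 := by
    rw [← zpow_add₀ (by norm_num)]; simp
  have h4 : ‖ξ‖ ≤ freq ξ := by
    rw [freq_eq]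
    nlinarith [norm_nonneg ξ, Real.pi_gt_three]
  have h5 : 2 ≤ (2 : ℝ) ^ (-k) * freq ξ := by
    calc (2 : ℝ) = 2 ^ (-k) * (2 * 2 ^ k) := by rw [mul_left_comm, h3, mul_one]
      _ ≤ 2 ^ (-k) * freq ξ := by gcongr; linarith
  rw [ζ.eq_zero (by linarith)]
  simp

/-- The symbol `ζ(2^{-k}|ξ|)`. -/
def dilate (N : ℕ) (ζ : Cutoff) (k : ℤ) : 𝓢(Sp N, ℂ) :=
  (hasCompactSupport_dilate ζ k).toSchwartzMap (contDiff_dilate ζ k)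

/-- The symbol `φ_(0)(ξ) = ζ(|ξ|)`. -/
def lowSymbol (N : ℕ) (ζ : Cutoff) : 𝓢(Sp N, ℂ) := dilate N ζ 0

/-- The symbol `φ_j(ξ) = ζ(2^{-j}|ξ|) - ζ(2^{1-j}|ξ|)`. -/
def dyadicSymbol (N : ℕ) (ζ : Cutoff) (j : ℤ) : 𝓢(Sp N, ℂ) := dilate N ζ j - dilate N ζ (j - 1)

theorem lowSymbol_apply {N : ℕ} (ζ : Cutoff) (ξ : Sp N) :
    lowSymbol N ζ ξ = (ζ (freq ξ) : ℝ) := by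
  simp [lowSymbol, dilate]

theorem dyadicSymbol_apply {N : ℕ} (ζ : Cutoff) (j : ℤ) (ξ : Sp N) :
    dyadicSymbol N ζ j ξ =
      ((ζ ((2 : ℝ) ^ (-j) * freq ξ) - ζ ((2 : ℝ) ^ (1 - j) * freq ξ) : ℝ) : ℂ) := by
  simp [dyadicSymbol, dilate]

/-- For a Schwartz symbol `m` and a tempered distribution `u`, the distribution `𝓕⁻(m 𝓕 u)` is
the convolution of `u` with the Schwartz function `𝓕⁻ m`, that is, the smooth function
`x ↦ ⟨u, (𝓕⁻ m)(x - ·)⟩`; here `(𝓕⁻ m)(x - y) = (𝓕 m)(y - x)`. -/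
def multiplier {N : ℕ} (m : 𝓢(Sp N, ℂ)) (u : 𝓢'(Sp N, ℂ)) (x : Sp N) : ℂ :=
  u ((𝓕 m).compSubConstCLM ℂ x)

/-! ### Local Morrey spaces and Besov-Morrey spaces -/

/-- `‖f | M^p_q‖ = sup_{x, 0 < ρ ≤ 1} ρ^{N/p - N/q} ‖f‖_{L^q(B(x,ρ))}`. -/
def morreyNorm {N : ℕ} (p q : ℝ) (f : Sp N → ℂ) : ℝ≥0∞ :=
  ⨆ (x : Sp N) (ρ : ℝ) (_ : 0 < ρ ∧ ρ ≤ 1),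
    ENNReal.ofReal (ρ ^ (N / p - N / q)) *
      MeasureTheory.eLpNorm f (ENNReal.ofReal q)
        (MeasureTheory.volume.restrict (Metric.ball x ρ))

/-- `f ∈ M^p_q`. -/
def MemMorrey {N : ℕ} (p q : ℝ) (f : Sp N → ℂ) : Prop :=
  MeasureTheory.AEStronglyMeasurable f MeasureTheory.volume ∧ morreyNorm p q f < ⊤

/-- `2^{sj} ‖𝓕⁻ φ_j 𝓕 u | M^p_q‖`. -/
def dyadicSize {N : ℕ} (ζ : Cutoff) (s p q : ℝ) (u : 𝓢'(Sp N, ℂ)) (j : ℕ) : ℝ≥0∞ :=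
  ENNReal.ofReal ((2 : ℝ) ^ (s * j)) * morreyNorm p q (multiplier (dyadicSymbol N ζ j) u)

/-- `‖u | N^s_{p,q,∞}‖`. -/
def besovMorreyNorm {N : ℕ} (ζ : Cutoff) (s p q : ℝ) (u : 𝓢'(Sp N, ℂ)) : ℝ≥0∞ :=
  morreyNorm p q (multiplier (lowSymbol N ζ) u) +
    ⨆ (j : ℕ) (_ : 1 ≤ j), dyadicSize ζ s p q u j

/-- `u ∈ N^s_{p,q,∞}`. -/
def MemBesovMorrey {N : ℕ} (ζ : Cutoff) (s p q : ℝ) (u : 𝓢'(Sp N, ℂ)) : Prop :=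
  MemMorrey p q (multiplier (lowSymbol N ζ) u) ∧
    (∀ j : ℕ, 1 ≤ j → MemMorrey p q (multiplier (dyadicSymbol N ζ j) u)) ∧
    besovMorreyNorm ζ s p q u < ⊤

/-! ### The symbol `(1 - φ_(0)(ξ)) exp(-t|ξ|^θ)` is a Schwartz function -/

/-- Smooth functions on the line that vanish on `(-∞, 2)` and are constant on `(3, ∞)`. -/
structure IsStep (g : ℝ → ℝ) : Prop where
  smooth : ContDiff ℝ ∞ g
  left : ∀ r < 2, g r = 0
  right : ∃ c, ∀ r, 3 < r → g r = c

theorem IsStep.deriv {g : ℝ → ℝ} (hg : IsStep g) : IsStep (deriv g) := by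
  refine ⟨(contDiff_infty_iff_deriv.1 hg.smooth).2, fun r hr => ?_, 0, fun r hr => ?_⟩
  · have : g =ᶠ[nhds r] fun _ => 0 := by
      filter_upwards [Iio_mem_nhds hr] with x hx using hg.left x hx
    rw [this.deriv_eq]; simp
  · obtain ⟨c, hc⟩ := hg.right
    have : g =ᶠ[nhds r] fun _ => c := by
      filter_upwards [Ioi_mem_nhds hr] with x hx using hc x hx
    rw [this.deriv_eq]; simp

theorem IsStep.bounded {g : ℝ → ℝ} (hg : IsStep g) : ∃ C, ∀ r, |g r| ≤ C := by
  obtain ⟨c, hc⟩ := hg.right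
  obtain ⟨C, hC⟩ := (isCompact_Icc (a := (2 : ℝ)) (b := 3)).exists_bound_of_continuousOn
    hg.smooth.continuous.continuousOn
  refine ⟨max C |c|, fun r => ?_⟩
  rcases lt_or_ge r 2 with h | h
  · rw [hg.left r h, abs_zero]; exact le_max_of_le_right (abs_nonneg c)
  · rcases lt_or_ge 3 r with h' | h'
    · rw [hc r h']; exact le_max_right _ _
    · exact le_max_of_le_left (hC r ⟨h, h'⟩)

/-- `g(r) r^b exp(-t r^a)`. -/
def stepExp (t a : ℝ) (g : ℝ → ℝ) (b r : ℝ) : ℝ := g r * (r ^ b * Real.exp (-t * r ^ a))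

theorem stepExp_contDiff {t a : ℝ} {g : ℝ → ℝ} (hg : IsStep g) (b : ℝ) :
    ContDiff ℝ ∞ (stepExp t a g b) := by
  rw [contDiff_iff_contDiffAt]
  intro r
  rcases lt_or_ge r 2 with h | h
  · have : stepExp t a g b =ᶠ[nhds r] fun _ => 0 := by
      filter_upwards [Iio_mem_nhds h] with x hx
      simp [stepExp, hg.left x hx]
    exact contDiffAt_const.congr_of_eventuallyEq this
  · have hr : r ≠ 0 := by linarith
    have h1 : ∀ c : ℝ, ContDiffAt ℝ ∞ (fun x : ℝ => x ^ c) r := fun c =>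
      Real.contDiffAt_rpow_const_of_ne hr
    exact hg.smooth.contDiffAt.mul ((h1 b).mul ((contDiffAt_const.mul (h1 a)).exp))

theorem stepExp_deriv {t a : ℝ} {g : ℝ → ℝ} (hg : IsStep g) (b : ℝ) :
    deriv (stepExp t a g b) = stepExp t a (deriv g) b +
      (b • stepExp t a g (b - 1) + (-t * a) • stepExp t a g (b + a - 1)) := by
  funext r
  rcases lt_or_ge r 2 with h | h
  · have : stepExp t a g b =ᶠ[nhds r] fun _ => 0 := by
      filter_upwards [Iio_mem_nhds h] with x hx
      simp [stepExp, hg.left x hx]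
    rw [this.deriv_eq]
    simp [stepExp, hg.left r h, hg.deriv.left r h]
  · have hr : 0 < r := by linarith
    have h1 : ∀ c : ℝ, HasDerivAt (fun x : ℝ => x ^ c) (c * r ^ (c - 1)) r := fun c =>
      Real.hasDerivAt_rpow_const (Or.inl hr.ne')
    have h2 : HasDerivAt g (deriv g r) r :=
      (hg.smooth.differentiable (by simp) r).hasDerivAt
    have h3 := h2.mul ((h1 b).mul ((h1 a).const_mul (-t)).exp)
    have h4 : r ^ (b + a - 1) = r ^ b * r ^ (a - 1) := by
      rw [← Real.rpow_add hr]; ring_nf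
    have h5 : deriv (stepExp t a g b) r = _ := h3.deriv
    rw [h5]
    simp only [stepExp, Pi.add_apply, Pi.smul_apply, smul_eq_mul, h4, Pi.mul_apply]
    ring

theorem stepExp_decay_zero {t a : ℝ} (ht : 0 < t) (ha : 0 < a) {g : ℝ → ℝ} (hg : IsStep g)
    (b : ℝ) (k : ℕ) : ∃ C, ∀ r : ℝ, |r| ^ k * |stepExp t a g b r| ≤ C := by
  obtain ⟨c, hc⟩ := hg.right
  have hlim : Filter.Tendsto (fun r : ℝ => r ^ k * |stepExp t a g b r|) Filter.atTop
      (nhds (|c| * 0)) := by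
    have h1 : Filter.Tendsto (fun r : ℝ => r ^ (k + b) * Real.exp (-t * r ^ a)) Filter.atTop
        (nhds 0) := by
      have h2 := (tendsto_rpow_mul_exp_neg_mul_atTop_nhds_zero ((k + b) / a) t ht).comp
        (tendsto_rpow_atTop ha)
      refine h2.congr' ?_
      filter_upwards [Filter.eventually_gt_atTop 0] with r hr
      simp only [Function.comp]
      rw [← Real.rpow_mul hr.le, mul_div_cancel₀ _ ha.ne']
    refine (h1.const_mul |c|).congr' ?_
    filter_upwards [Filter.eventually_gt_atTop 3] with r hr
    have hr0 : 0 < r := by linarith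
    rw [stepExp, hc r hr, abs_mul, abs_of_pos (a := r ^ b * _) (by positivity),
      Real.rpow_add hr0, Real.rpow_natCast]
    ring
  have hev := hlim.eventually (gt_mem_nhds (lt_add_one _))
  obtain ⟨R, hR⟩ := Filter.eventually_atTop.1 hev
  have hcont : Continuous (fun r : ℝ => |r| ^ k * |stepExp t a g b r|) :=
    (continuous_abs.pow k).mul (stepExp_contDiff hg b).continuous.abs
  obtain ⟨C, hC⟩ := (isCompact_Icc (a := (0 : ℝ)) (b := max R 0)).exists_bound_of_continuousOn
    hcont.continuousOn
  have hC0 : 0 ≤ C := (norm_nonneg _).trans (hC 0 ⟨le_rfl, le_max_right _ _⟩)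
  refine ⟨max C (|c| * 0 + 1), fun r => ?_⟩
  rcases lt_or_ge r 0 with h | h
  · rw [stepExp, hg.left r (by linarith)]
    simp [hC0]
  · rcases le_or_gt r (max R 0) with h' | h'
    · refine le_max_of_le_left ((le_abs_self _).trans (hC r ⟨h, h'⟩))
    · refine le_max_of_le_right ?_
      rw [abs_of_nonneg h]
      exact (hR r ((le_max_left _ _).trans h'.le)).le

theorem stepExp_decay {t a : ℝ} (ht : 0 < t) (ha : 0 < a) (n : ℕ) :
    ∀ {g : ℝ → ℝ} (_ : IsStep g) (b : ℝ) (k : ℕ),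
      ∃ C, ∀ r : ℝ, |r| ^ k * |iteratedDeriv n (stepExp t a g b) r| ≤ C := by
  induction n with
  | zero =>
    intro g hg b k
    simpa using stepExp_decay_zero ht ha hg b k
  | succ n ih =>
    intro g hg b k
    obtain ⟨C₁, h₁⟩ := ih hg.deriv b k
    obtain ⟨C₂, h₂⟩ := ih hg (b - 1) k
    obtain ⟨C₃, h₃⟩ := ih hg (b + a - 1) k
    refine ⟨C₁ + (|b| * C₂ + |-t * a| * C₃), fun r => ?_⟩
    have d₁ : ContDiffAt ℝ n (stepExp t a (deriv g) b) r :=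
      ((stepExp_contDiff hg.deriv b).of_le (mod_cast le_top)).contDiffAt
    have d₂ : ContDiffAt ℝ n (stepExp t a g (b - 1)) r :=
      ((stepExp_contDiff hg _).of_le (mod_cast le_top)).contDiffAt
    have d₃ : ContDiffAt ℝ n (stepExp t a g (b + a - 1)) r :=
      ((stepExp_contDiff hg _).of_le (mod_cast le_top)).contDiffAt
    have d₄ : ContDiffAt ℝ n (b • stepExp t a g (b - 1)) r := contDiffAt_const.smul d₂
    have d₅ : ContDiffAt ℝ n ((-t * a) • stepExp t a g (b + a - 1)) r := contDiffAt_const.smul d₃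
    have d₆ : ContDiffAt ℝ n
        (b • stepExp t a g (b - 1) + (-t * a) • stepExp t a g (b + a - 1)) r := d₄.add d₅
    rw [iteratedDeriv_succ', stepExp_deriv hg,
      iteratedDeriv_add d₁ d₆, iteratedDeriv_add d₄ d₅,
      iteratedDeriv_const_smul d₂, iteratedDeriv_const_smul d₃]
    simp only [smul_eq_mul]
    have e₁ := h₁ r
    have e₂ := mul_le_mul_of_nonneg_left (h₂ r) (abs_nonneg b)
    have e₃ := mul_le_mul_of_nonneg_left (h₃ r) (abs_nonneg (-t * a))
    have hk : 0 ≤ |r| ^ k := by positivity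
    have key : ∀ x y z : ℝ, |x + (b * y + -t * a * z)| ≤
        |x| + (|b| * |y| + |-t * a| * |z|) := by
      intro x y z
      rw [← abs_mul, ← abs_mul]
      exact (abs_add_le _ _).trans (add_le_add le_rfl (abs_add_le _ _))
    refine (mul_le_mul_of_nonneg_left (key _ _ _) hk).trans ?_
    nlinarith

theorem isStep_cutoff (ζ : Cutoff) : IsStep (fun r : ℝ => 1 - ζ (√r)) := by
  refine ⟨contDiff_const.sub ζ.contDiff_sqrt, fun r hr => ?_, 1, fun r hr => ?_⟩
  · rw [ζ.eq_one _ (Real.sqrt_nonneg _), sub_self]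
    rw [Real.sqrt_le_left (by norm_num)]
    linarith
  · rw [ζ.eq_zero (Real.le_sqrt_of_sq_le (by norm_num; linarith)), sub_zero]

theorem exists_heatHigh (N : ℕ) (ζ : Cutoff) {θ t : ℝ} (hθ : 0 < θ) (ht : 0 < t) :
    ∃ Ψ : 𝓢(Sp N, ℂ), ∀ ξ, Ψ ξ =
      (((1 - ζ (freq ξ)) * Real.exp (-t * freq ξ ^ θ) : ℝ) : ℂ) := by
  have ha : 0 < θ / 2 := by linarith
  have hS := isStep_cutoff ζ
  let H : 𝓢(ℝ, ℝ) :=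
    { toFun := stepExp t (θ / 2) (fun r : ℝ => 1 - ζ (√r)) 0
      smooth' := stepExp_contDiff hS 0
      decay' := fun k n => by
        obtain ⟨C, hC⟩ := stepExp_decay ht ha n hS 0 k
        refine ⟨C, fun r => ?_⟩
        rw [norm_iteratedFDeriv_eq_norm_iteratedDeriv]
        exact hC r }
  have hup : ∃ (k : ℕ) (C : ℝ), ∀ x : Sp N, ‖x‖ ≤ C * (1 + ‖freq x ^ 2‖) ^ k := by
    refine ⟨1, 1, fun x => ?_⟩
    have h4 : ‖x‖ ≤ freq x := by
      rw [freq_eq]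
      nlinarith [norm_nonneg x, Real.pi_gt_three]
    rw [pow_one, one_mul, Real.norm_of_nonneg (by positivity)]
    nlinarith [sq_nonneg (freq x - 1), freq_nonneg x]
  let G : 𝓢(Sp N, ℝ) := SchwartzMap.compCLM ℝ hasTemperateGrowth_freq_sq hup H
  have hG : ∀ ξ, G ξ = (1 - ζ (freq ξ)) * Real.exp (-t * freq ξ ^ θ) := by
    intro ξ
    change (1 - ζ (√(freq ξ ^ 2))) *
      ((freq ξ ^ 2) ^ (0 : ℝ) * Real.exp (-t * (freq ξ ^ 2) ^ (θ / 2))) = _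
    rw [Real.sqrt_sq (freq_nonneg ξ), Real.rpow_zero, one_mul, ← Real.rpow_natCast,
      ← Real.rpow_mul (freq_nonneg ξ)]
    congr 4
    push_cast
    ring_nf
  refine ⟨{ toFun := fun ξ => ((G ξ : ℝ) : ℂ)
            smooth' := Complex.ofRealCLM.contDiff.comp (G.smooth ⊤)
            decay' := fun k n => ?_ }, fun ξ => ?_⟩
  · obtain ⟨C, hC⟩ := G.decay' k n
    refine ⟨C, fun x => ?_⟩
    have : ‖iteratedFDeriv ℝ n (fun ξ => ((G ξ : ℝ) : ℂ)) x‖ = ‖iteratedFDeriv ℝ n G x‖ :=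
      Complex.ofRealLI.norm_iteratedFDeriv_comp_left
        ((G.smooth n).contDiffAt) le_rfl
    rw [this]
    exact hC x
  · change ((G ξ : ℝ) : ℂ) = _
    rw [hG]

/-- The symbol `(1 - φ_(0)(ξ)) exp(-t|ξ|^θ)`, for `t > 0`. -/
def heatHighSymbol (N : ℕ) (ζ : Cutoff) {θ t : ℝ} (hθ : 0 < θ) (ht : 0 < t) : 𝓢(Sp N, ℂ) where
  toFun ξ := (((1 - ζ (freq ξ)) * Real.exp (-t * freq ξ ^ θ) : ℝ) : ℂ)
  smooth' := by
    obtain ⟨Ψ, hΨ⟩ := exists_heatHigh N ζ hθ ht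
    rw [← funext hΨ]
    exact Ψ.smooth ⊤
  decay' := by
    obtain ⟨Ψ, hΨ⟩ := exists_heatHigh N ζ hθ ht
    rw [← funext hΨ]
    exact Ψ.decay'

/-! ### The semigroup `S(t)` and solutions -/

/-- The kernel `𝓕⁻ exp(-t|ξ|^θ)` of `S(t)`, an integrable function for `t > 0`. -/
def heatKernel (N : ℕ) (θ t : ℝ) : Sp N → ℂ :=
  𝓕⁻ (fun ξ : Sp N => ((Real.exp (-t * freq ξ ^ θ) : ℝ) : ℂ))

/-- `S(t)` on functions: convolution with the kernel. -/
def semigroupFun {N : ℕ} (θ t : ℝ) (g : Sp N → ℂ) (x : Sp N) : ℂ :=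
  ∫ y, heatKernel N θ t (x - y) * g y

/-- `S(t)u = 𝓕⁻ exp(-t|ξ|^θ) 𝓕 u` for `t > 0` and a tempered distribution `u` whose low frequency
part `𝓕⁻ φ_(0) 𝓕 u` is a function in a local Morrey space. As `exp(-t|ξ|^θ)` need not be smooth at
the origin, the multiplication by it is carried out separately on the two parts of
`𝓕 u = φ_(0) 𝓕 u + (1 - φ_(0)) 𝓕 u`: the low frequency part of `u`, a function, is convolved with
the integrable kernel, and on the other part the symbol is a Schwartz function. -/
def semigroup {N : ℕ} (ζ : Cutoff) {θ t : ℝ} (hθ : 0 < θ) (ht : 0 < t) (u : 𝓢'(Sp N, ℂ))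
    (x : Sp N) : ℂ :=
  semigroupFun θ t (multiplier (lowSymbol N ζ) u) x + multiplier (heatHighSymbol N ζ hθ ht) u x

/-- The nonlinearity `|z|^{γ-1} z`. -/
def nonlinearity (γ : ℝ) (z : ℂ) : ℂ := ((‖z‖ ^ (γ - 1) : ℝ) : ℂ) * z

/-- `u` is a solution on `ℝ^N × [0,T)` of `∂_t u + (-Δ)^{θ/2} u = |u|^{γ-1} u`, `u(0) = φ`: it is
bounded and continuous on `ℝ^N × (τ,T)` for each `τ ∈ (0,T)`, and
`u(x,t) = [S(t)φ](x) + ∫_0^t [S(t-τ)|u(τ)|^{γ-1}u(τ)](x) dτ` on `ℝ^N × (0,T)`, where the integral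
converges absolutely. -/
structure IsSolution {N : ℕ} (ζ : Cutoff) {θ : ℝ} (hθ : 0 < θ) (γ : ℝ) (φ : 𝓢'(Sp N, ℂ)) (T : ℝ)
    (u : Sp N → ℝ → ℂ) : Prop where
  continuousOn : ∀ τ ∈ Set.Ioo 0 T,
    ContinuousOn (fun z : Sp N × ℝ => u z.1 z.2) (Set.univ ×ˢ Set.Ioo τ T)
  bounded : ∀ τ ∈ Set.Ioo 0 T, ∃ C : ℝ, ∀ x, ∀ t ∈ Set.Ioo τ T, ‖u x t‖ ≤ C
  integrable : ∀ x, ∀ t ∈ Set.Ioo 0 T,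
    IntervalIntegrable (fun τ => semigroupFun θ (t - τ) (fun y => nonlinearity γ (u y τ)) x)
      MeasureTheory.volume 0 t
  eq : ∀ (x : Sp N) (t : ℝ) (ht : 0 < t), t < T →
    u x t = semigroup ζ hθ ht φ x +
      ∫ τ in (0 : ℝ)..t, semigroupFun θ (t - τ) (fun y => nonlinearity γ (u y τ)) x

/-- `sup_{0 < t ≤ T} t^{-s/θ} ‖u(·,t) | M^p_q‖`. -/
def timeWeightedNorm {N : ℕ} (θ s p q T : ℝ) (u : Sp N → ℝ → ℂ) : ℝ≥0∞ :=
  ⨆ (t : ℝ) (_ : 0 < t ∧ t ≤ T), ENNReal.ofReal (t ^ (-s / θ)) * morreyNorm p q (fun x => u x t)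

end BesovMorrey

end

/-! Put `a = -s/θ` and `b = N/(pθ) + a`. The solution is the fixed point of `u ↦ S(t)φ + D(u)`,
where `D` is the Duhamel term, among the functions on `(0,T)`, `T ≤ 1`, whose Morrey norm is at most
`M t^{-a}` and whose sup norm is at most `M t^{-b}`.

Linear part. Outside low frequencies, `S(t)φ` is cut into dyadic blocks. With `λ = t 2^{jθ}`, the
kernel of the block of frequency `2^j` is `O(min(1, λ^{-k}))` times an `L¹`-normalized profile of
width `2^{-j}`. Hence `t^a` times the Morrey norm of the block, and `t^b` times its sup norm, are
bounded by `min(λ^c, λ^{-c})` (with `c = a`, resp. `c = b`) times the dyadic size of `φ`. These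
weights are summable in `j` uniformly in `t`, and each of them tends to zero as `t → 0`; so for
small `t` only the limsup of the dyadic sizes counts (`exists_tsum_dyadicWeight_mul_le`). The low
frequency part is harmless because of the factors `t^a` and `t^b`. This is `exists_linearFlow_le`.

Heat kernel. The symbol `exp(-|ξ|^θ)` may be singular at the origin, but a dyadic decomposition
towards the origin still gives the decay `(1+|x|)^{-(N+θ/2)}` (`exists_lowHeat_kernel_bound`). All
operators are thus dominated by positive convolutions `posOp`. They preserve local Morrey bounds
and, at scale `r ≤ 1`, send Morrey bounds to sup bounds with the loss `r^{-N/p}`.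

Nonlinear part. The difference of two nonlinearities is at most `C(|u|+|v|)^{γ-1}|u-v|`. Hölder's
inequality inside the convolution, possible because `γ ≤ q`, leaves time integrals of `(t-τ)^{-α}
τ^{-aγ}` with `α = N(γ-1)/(pθ)`. They converge at `0` because `s > -θ/γ` and at `t` because `α < 1`;
the condition `s ≥ N/p - θ/(γ-1)` says that the resulting power of `t ≤ 1` is no worse than `t^{-a}`
(`Exponents.exists_posDuhamel_le`). The Lipschitz constant is `Λ M^{γ-1}`, which a suitable `M`
makes equal to `1/2`. Picard iteration gives existence (`exists_fixedPoint`). The Morrey half of the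
contraction estimate does not involve the sup norm, so it applies to every solution obeying the
bound and gives uniqueness (`fixedPoint_unique`). -/

noncomputable section

namespace BesovMorrey

/-! ### Translations and convolutions in the Schwartz space -/

section Schwartz

variable {E F : Type*} [NormedAddCommGroup E] [NormedSpace ℝ E] [NormedAddCommGroup F]
  [NormedSpace ℂ F]

theorem iteratedFDeriv_compSubConst (g : 𝓢(E, F)) (n : ℕ) (z x : E) :
    iteratedFDeriv ℝ n (g.compSubConstCLM ℂ z) x = iteratedFDeriv ℝ n g (x - z) :=
  congrFun (iteratedFDeriv_comp_sub' n z) x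

theorem one_add_norm_mul_iteratedFDeriv_le (g : 𝓢(E, F)) (k n : ℕ) :
    ∃ C, 0 ≤ C ∧ ∀ x, (1 + ‖x‖) ^ k * ‖iteratedFDeriv ℝ n g x‖ ≤ C :=
  ⟨_, by positivity, fun x => SchwartzMap.one_add_le_sup_seminorm_apply (𝕜 := ℝ) (m := (k, n))
    le_rfl le_rfl g x⟩

theorem seminorm_compSubConst_le (g : 𝓢(E, F)) (k n : ℕ) :
    ∃ C, 0 ≤ C ∧ ∀ z : E, SchwartzMap.seminorm ℂ k n (g.compSubConstCLM ℂ z) ≤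
      C * (1 + ‖z‖) ^ k := by
  obtain ⟨C, hC, h⟩ := one_add_norm_mul_iteratedFDeriv_le g k n
  refine ⟨C, hC, fun z => SchwartzMap.seminorm_le_bound _ _ _ _ (by positivity) fun x => ?_⟩
  rw [iteratedFDeriv_compSubConst]
  have h1 : ‖x‖ ≤ (1 + ‖x - z‖) * (1 + ‖z‖) := by
    have := norm_add_le (x - z) z
    rw [sub_add_cancel] at this
    nlinarith [norm_nonneg (x - z), norm_nonneg z]
  calc ‖x‖ ^ k * ‖iteratedFDeriv ℝ n g (x - z)‖
      ≤ ((1 + ‖x - z‖) * (1 + ‖z‖)) ^ k * ‖iteratedFDeriv ℝ n g (x - z)‖ := by gcongr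
    _ = ((1 + ‖x - z‖) ^ k * ‖iteratedFDeriv ℝ n g (x - z)‖) * (1 + ‖z‖) ^ k := by
        rw [mul_pow]; ring
    _ ≤ C * (1 + ‖z‖) ^ k := by gcongr; exact h _

/-- Mean value inequality for the `n`-th derivative: on the unit ball about `x` the weight `1 + ‖x‖`
changes by a factor of at most two. -/
theorem seminorm_compSubConst_sub_le (g : 𝓢(E, F)) (k n : ℕ) :
    ∃ C, 0 ≤ C ∧ ∀ z : E, ‖z‖ ≤ 1 → SchwartzMap.seminorm ℂ k n (g.compSubConstCLM ℂ z - g) ≤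
      C * ‖z‖ := by
  obtain ⟨C, hC, h⟩ := one_add_norm_mul_iteratedFDeriv_le g k (n + 1)
  refine ⟨2 ^ k * C, by positivity, fun z hz =>
    SchwartzMap.seminorm_le_bound _ _ _ _ (by positivity) fun x => ?_⟩
  have h0 : iteratedFDeriv ℝ n (g.compSubConstCLM ℂ z - g) x =
      iteratedFDeriv ℝ n g (x - z) - iteratedFDeriv ℝ n g x := by
    rw [← iteratedFDeriv_compSubConst g n z x]
    exact iteratedFDeriv_sub_apply ((g.compSubConstCLM ℂ z).smooth n).contDiffAt
      (g.smooth n).contDiffAt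
  rw [h0]
  have hk : (0 : ℝ) < (1 + ‖x‖) ^ k := by positivity
  have hd : ∀ y ∈ Metric.closedBall x 1,
      ‖fderiv ℝ (iteratedFDeriv ℝ n g) y‖ ≤ 2 ^ k * C / (1 + ‖x‖) ^ k := by
    intro y hy
    rw [le_div_iff₀ hk, norm_fderiv_iteratedFDeriv]
    have hxy : 1 + ‖x‖ ≤ 2 * (1 + ‖y‖) := by
      have h1 : ‖x - y‖ ≤ 1 := by rw [← dist_eq_norm, dist_comm]; exact hy
      have := norm_add_le (x - y) y
      rw [sub_add_cancel] at this
      linarith [norm_nonneg y]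
    calc ‖iteratedFDeriv ℝ (n + 1) g y‖ * (1 + ‖x‖) ^ k
        ≤ ‖iteratedFDeriv ℝ (n + 1) g y‖ * (2 * (1 + ‖y‖)) ^ k := by gcongr
      _ = 2 ^ k * ((1 + ‖y‖) ^ k * ‖iteratedFDeriv ℝ (n + 1) g y‖) := by rw [mul_pow]; ring
      _ ≤ 2 ^ k * C := by gcongr; exact h y
  have hmv := (convex_closedBall x 1).norm_image_sub_le_of_norm_fderiv_le
    (f := iteratedFDeriv ℝ n g) (x := x) (y := x - z)
    (fun y _ => ((g.smooth ⊤).differentiable_iteratedFDeriv (by exact_mod_cast ENat.natCast_lt_top n) y))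
    hd (Metric.mem_closedBall_self zero_le_one) (by simpa [dist_eq_norm] using hz)
  calc ‖x‖ ^ k * ‖iteratedFDeriv ℝ n g (x - z) - iteratedFDeriv ℝ n g x‖
      ≤ (1 + ‖x‖) ^ k * (2 ^ k * C / (1 + ‖x‖) ^ k * ‖x - z - x‖) := by
        gcongr; linarith
    _ = 2 ^ k * C * ‖z‖ := by
        rw [show x - z - x = -z by abel, norm_neg]; field_simp

theorem continuous_compSubConst (g : 𝓢(E, F)) :
    Continuous fun z : E => g.compSubConstCLM ℂ z := by
  have h0 : ∀ g : 𝓢(E, F), Filter.Tendsto (fun z : E => g.compSubConstCLM ℂ z) (nhds 0) (nhds g) := by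
    intro g
    rw [(schwartz_withSeminorms ℂ E F).tendsto_nhds _ _]
    rintro ⟨k, n⟩ ε hε
    obtain ⟨C, hC, h⟩ := seminorm_compSubConst_sub_le g k n
    have : Filter.Tendsto (fun z : E => C * ‖z‖) (nhds 0) (nhds 0) := by
      simpa using (tendsto_norm_zero (E := E)).const_mul C
    filter_upwards [Metric.closedBall_mem_nhds (0 : E) one_pos, this.eventually (gt_mem_nhds hε)]
      with z hz hz'
    exact (h z (by simpa using hz)).trans_lt hz'
  rw [continuous_iff_continuousAt]
  intro z
  have h1 : (fun w : E => g.compSubConstCLM ℂ w) =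
      fun w => (g.compSubConstCLM ℂ z).compSubConstCLM ℂ (w - z) := by
    funext w; rw [SchwartzMap.compSubConstCLM_comp]; simp
  rw [ContinuousAt, h1]
  have h2 := (h0 (g.compSubConstCLM ℂ z)).comp
    (by simpa using (continuous_sub_right z).tendsto z : Filter.Tendsto (fun w => w - z) (nhds z) (nhds 0))
  exact h2

/-! ### Factorization of tempered distributions through Banach spaces -/

/-- Bounded continuous functions with values in the `n`-linear maps from `E` to `F`. -/
def DerivSpace (E F : Type*) [NormedAddCommGroup E] [NormedSpace ℝ E] [NormedAddCommGroup F]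
    [NormedSpace ℂ F] (n : ℕ) : Type _ :=
  BoundedContinuousFunction E (E [×n]→L[ℝ] F)

instance (n : ℕ) : NormedAddCommGroup (DerivSpace E F n) :=
  BoundedContinuousFunction.instNormedAddCommGroup

instance (n : ℕ) : NormedSpace ℂ (DerivSpace E F n) :=
  BoundedContinuousFunction.instNormedSpace

instance [CompleteSpace F] (n : ℕ) : CompleteSpace (DerivSpace E F n) :=
  BoundedContinuousFunction.instCompleteSpace

/-- The value of a member of `DerivSpace` at a point. -/
def DerivSpace.eval {n : ℕ} (f : DerivSpace E F n) (x : E) : E [×n]→L[ℝ] F :=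
  DFunLike.coe (F := BoundedContinuousFunction E (E [×n]→L[ℝ] F)) f x

theorem DerivSpace.norm_eval_le {n : ℕ} (f : DerivSpace E F n) (x : E) : ‖f.eval x‖ ≤ ‖f‖ :=
  BoundedContinuousFunction.norm_coe_le_norm _ x

theorem DerivSpace.ext {n : ℕ} {f g : DerivSpace E F n} (h : ∀ x m, f.eval x m = g.eval x m) :
    f = g :=
  BoundedContinuousFunction.ext fun x => ContinuousMultilinearMap.ext (h x)

/-- Evaluation at a point and at `n` vectors. -/
def DerivSpace.evalCLM {n : ℕ} (x : E) (m : Fin n → E) : DerivSpace E F n →L[ℂ] F :=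
  LinearMap.mkContinuous
    { toFun := fun f => f.eval x m
      map_add' := fun _ _ => rfl
      map_smul' := fun _ _ => rfl } (∏ i, ‖m i‖) fun f => by
    rw [mul_comm]
    exact ((f.eval x).le_opNorm m).trans (by gcongr; exact f.norm_eval_le x)

/-- `x ↦ ‖x‖ ^ k D^n f(x)` as a bounded continuous function. -/
def weightedDeriv (k n : ℕ) : 𝓢(E, F) →ₗ[ℂ] DerivSpace E F n where
  toFun f := BoundedContinuousFunction.ofNormedAddCommGroup
    (fun x => (‖x‖ ^ k) • iteratedFDeriv ℝ n f x)
    ((continuous_norm.pow k).smul ((f.smooth ⊤).continuous_iteratedFDeriv (by exact_mod_cast le_top)))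
    (SchwartzMap.seminorm ℂ k n f) (fun x => by
      rw [norm_smul, norm_pow, norm_norm]; exact SchwartzMap.le_seminorm ℂ k n f x)
  map_add' f g := BoundedContinuousFunction.ext fun x => by
    change (‖x‖ ^ k) • iteratedFDeriv ℝ n (f + g) x = (‖x‖ ^ k) • iteratedFDeriv ℝ n f x +
      (‖x‖ ^ k) • iteratedFDeriv ℝ n g x
    rw [← smul_add]
    congr 1
    exact iteratedFDeriv_add_apply (f.smooth n).contDiffAt (g.smooth n).contDiffAt
  map_smul' c f := BoundedContinuousFunction.ext fun x => by
    change (‖x‖ ^ k) • iteratedFDeriv ℝ n (c • f) x = c • (‖x‖ ^ k) • iteratedFDeriv ℝ n f x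
    rw [smul_comm c]
    congr 1
    exact iteratedFDeriv_const_smul_apply (f.smooth n).contDiffAt

theorem weightedDeriv_eval (k n : ℕ) (f : 𝓢(E, F)) (x : E) :
    (weightedDeriv k n f).eval x = (‖x‖ ^ k) • iteratedFDeriv ℝ n f x := rfl

theorem norm_weightedDeriv_le (k n : ℕ) (f : 𝓢(E, F)) :
    ‖weightedDeriv k n f‖ ≤ SchwartzMap.seminorm ℂ k n f :=
  BoundedContinuousFunction.norm_ofNormedAddCommGroup_le _ (apply_nonneg _ _)
    (fun x => by rw [norm_smul, norm_pow, norm_norm]; exact SchwartzMap.le_seminorm ℂ k n f x)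

theorem seminorm_le_norm_weightedDeriv (k n : ℕ) (f : 𝓢(E, F)) :
    SchwartzMap.seminorm ℂ k n f ≤ ‖weightedDeriv k n f‖ := by
  refine SchwartzMap.seminorm_le_bound _ _ _ _ (norm_nonneg _) fun x => ?_
  have := (weightedDeriv k n f).norm_eval_le x
  rwa [weightedDeriv_eval, norm_smul, norm_pow, norm_norm] at this

theorem continuous_weightedDeriv (k n : ℕ) : Continuous (weightedDeriv (E := E) (F := F) k n) := by
  refine continuous_of_tendsto_nhds_zero (weightedDeriv k n).toAddMonoidHom ?_
  rw [tendsto_zero_iff_norm_tendsto_zero]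
  have h := ((schwartz_withSeminorms ℂ E F).continuous_seminorm (k, n)).tendsto 0
  rw [map_zero] at h
  exact squeeze_zero (fun _ => norm_nonneg _) (fun f => norm_weightedDeriv_le k n f) h

/-- A continuous linear functional on the Schwartz space factors through finitely many
weighted derivatives. -/
theorem exists_factor (u : 𝓢(E, F) →L[ℂ] ℂ) :
    ∃ (s : Finset (ℕ × ℕ)) (v : ((i : s) → DerivSpace E F i.1.2) →L[ℂ] ℂ),
      ∀ f, u f = v (fun i => weightedDeriv i.1.1 i.1.2 f) := by
  have hq : Continuous ((normSeminorm ℂ ℂ).comp u.toLinearMap) := continuous_norm.comp u.continuous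
  obtain ⟨s, C, -, hC⟩ := Seminorm.bound_of_continuous (schwartz_withSeminorms ℂ E F) _ hq
  -- The index `(0, 0)` records the function itself and makes `J` injective.
  let t := insert (0, 0) s
  let J : 𝓢(E, F) →ₗ[ℂ] ((i : t) → DerivSpace E F i.1.2) :=
    LinearMap.pi fun i => weightedDeriv i.1.1 i.1.2
  have hJ : Function.Injective J := by
    rw [injective_iff_map_eq_zero]
    intro f hf
    have h1 : weightedDeriv 0 0 f = 0 :=
      congrFun hf (⟨(0, 0), Finset.mem_insert_self _ _⟩ : t)
    ext x
    have h2 := (SchwartzMap.norm_le_seminorm ℂ f x).trans (seminorm_le_norm_weightedDeriv 0 0 f)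
    rw [h1, norm_zero] at h2
    simpa using h2
  have hbound : ∀ f, ‖u f‖ ≤ C * ‖J f‖ := by
    intro f
    refine (hC f).trans ?_
    rw [smul_apply, NNReal.smul_def, smul_eq_mul]
    gcongr
    refine Seminorm.finset_sup_apply_le (norm_nonneg _) fun i hi => ?_
    refine (seminorm_le_norm_weightedDeriv i.1 i.2 f).trans ?_
    exact norm_le_pi_norm (J f) (⟨i, Finset.mem_insert_of_mem hi⟩ : t)
  let e := LinearEquiv.ofInjective J hJ
  let w : StrongDual ℂ (LinearMap.range J) :=
    (u.toLinearMap ∘ₗ e.symm.toLinearMap).mkContinuous C fun y => by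
      have := hbound (e.symm y)
      have h2 : J (e.symm y) = y := congrArg Subtype.val (e.apply_symm_apply y)
      rw [h2] at this
      exact this
  -- Hahn-Banach. The extension `v` lives on a Banach space, where continuous functionals commute
  -- with Bochner integrals; the Schwartz space has no norm for this.
  obtain ⟨v, hv, -⟩ := exists_extension_norm_eq (LinearMap.range J) w
  refine ⟨t, v, fun f => ?_⟩
  have h3 := hv (e f)
  have h4 : w (e f) = u f := by
    change u (e.symm (e f)) = u f
    rw [e.symm_apply_apply]
  rw [← h4, ← h3]
  rfl

end Schwartz

end BesovMorrey
end

noncomputable section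

namespace BesovMorrey

open LineDeriv MeasureTheory

/-! ### Convolution of Schwartz functions and its pairing with distributions -/

section Convolution

variable {V : Type*} [NormedAddCommGroup V] [InnerProductSpace ℝ V] [FiniteDimensional ℝ V]
  [MeasurableSpace V] [BorelSpace V]

/-- The convolution of two Schwartz functions. -/
def conv (h g : 𝓢(V, ℂ)) : 𝓢(V, ℂ) := SchwartzMap.convolution (ContinuousLinearMap.mul ℂ ℂ) h g

theorem conv_apply (h g : 𝓢(V, ℂ)) (x : V) : conv h g x = ∫ z, h z * g (x - z) := by
  rw [conv, SchwartzMap.convolution_apply, convolution_def]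
  rfl

/-- On the Fourier side both operations are multiplications. The derivative is put on `g`, since the
integral is later read as a superposition of translates of `g`. -/
theorem lineDerivOp_conv (h g : 𝓢(V, ℂ)) (m : V) : ∂_{m} (conv h g) = conv h (∂_{m} g) := by
  have hm : Function.HasTemperateGrowth (fun x : V => ((inner ℝ x m : ℝ))) := by fun_prop
  simp only [conv, SchwartzMap.convolution, LinearMap.coe_mk, AddHom.coe_mk,
    ContinuousLinearMap.comp_apply, FourierTransform.fourierCLM_apply,
    FourierTransform.fourierInvCLM_apply, SchwartzMap.lineDerivOp_fourierInv_eq,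
    SchwartzMap.fourier_lineDerivOp_eq]
  congr 1
  ext ξ
  simp [SchwartzMap.smulLeftCLM_apply_apply hm]
  ring

theorem iteratedLineDerivOp_conv (h g : 𝓢(V, ℂ)) {n : ℕ} (m : Fin n → V) :
    ∂^{m} (conv h g) = conv h (∂^{m} g) := by
  induction n with
  | zero => simp
  | succ n ih => rw [iteratedLineDerivOp_succ_left, ih, lineDerivOp_conv,
      ← iteratedLineDerivOp_succ_left]

theorem iteratedFDeriv_conv (h g : 𝓢(V, ℂ)) {n : ℕ} (m : Fin n → V) (x : V) :
    iteratedFDeriv ℝ n (conv h g) x m = ∫ z, h z * iteratedFDeriv ℝ n g (x - z) m := by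
  rw [← SchwartzMap.iteratedLineDerivOp_eq_iteratedFDeriv, iteratedLineDerivOp_conv, conv_apply]
  simp only [SchwartzMap.iteratedLineDerivOp_eq_iteratedFDeriv]

/-- Translating `g` by `z` costs a factor `(1 + ‖z‖)^k` in the seminorm, which the rapid decay of
`h` absorbs. -/
theorem integrable_smul_weightedDeriv (h g : 𝓢(V, ℂ)) (k n : ℕ) :
    Integrable (fun z => h z • weightedDeriv k n (g.compSubConstCLM ℂ z)) := by
  obtain ⟨C, hC, hb⟩ := seminorm_compSubConst_le g k n
  have hcont : Continuous (fun z => h z • weightedDeriv k n (g.compSubConstCLM ℂ z)) :=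
    h.continuous.smul ((continuous_weightedDeriv k n).comp (continuous_compSubConst g))
  have hint : Integrable (fun z => C * (2 ^ k * (‖h z‖ + ‖z‖ ^ k * ‖h z‖))) :=
    ((h.integrable.norm.add (h.integrable_pow_mul volume k)).const_mul _).const_mul _
  refine hint.mono' hcont.aestronglyMeasurable (Filter.Eventually.of_forall fun z => ?_)
  rw [norm_smul]
  have h1 : (1 + ‖z‖) ^ k ≤ 2 ^ k * (1 + ‖z‖ ^ k) := by
    rcases le_total ‖z‖ 1 with hz | hz
    · calc (1 + ‖z‖) ^ k ≤ (1 + 1) ^ k := by gcongr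
        _ = 2 ^ k * 1 := by norm_num
        _ ≤ 2 ^ k * (1 + ‖z‖ ^ k) := by gcongr; linarith [pow_nonneg (norm_nonneg z) k]
    · calc (1 + ‖z‖) ^ k ≤ (2 * ‖z‖) ^ k := by gcongr; linarith
        _ = 2 ^ k * ‖z‖ ^ k := mul_pow _ _ _
        _ ≤ 2 ^ k * (1 + ‖z‖ ^ k) := by gcongr; linarith
  calc ‖h z‖ * ‖weightedDeriv k n (g.compSubConstCLM ℂ z)‖
      ≤ ‖h z‖ * (C * (2 ^ k * (1 + ‖z‖ ^ k))) := by
        gcongr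
        exact (norm_weightedDeriv_le k n _).trans ((hb z).trans (by gcongr))
    _ = _ := by ring

/-- A tempered distribution commutes with the integral defining a convolution. -/
theorem apply_conv (u : 𝓢(V, ℂ) →L[ℂ] ℂ) (h g : 𝓢(V, ℂ)) :
    u (conv h g) = ∫ z, h z * u (g.compSubConstCLM ℂ z) := by
  obtain ⟨s, v, hv⟩ := exists_factor u
  let J : 𝓢(V, ℂ) → ((i : s) → DerivSpace V ℂ i.1.2) := fun f i => weightedDeriv i.1.1 i.1.2 f
  have hint : Integrable (fun z => h z • J (g.compSubConstCLM ℂ z)) :=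
    Integrable.of_eval fun i => integrable_smul_weightedDeriv h g i.1.1 i.1.2
  -- The Bochner integral is identified coordinate by coordinate: evaluation at a point and at `n`
  -- vectors is continuous, which reduces the claim to the formula for the derivatives of a
  -- convolution.
  have hJ : ∫ z, h z • J (g.compSubConstCLM ℂ z) = J (conv h g) := by
    funext i
    rw [eval_integral (fun i => integrable_smul_weightedDeriv h g i.1.1 i.1.2)]
    refine DerivSpace.ext fun x m => ?_
    have h1 := (DerivSpace.evalCLM (F := ℂ) x m).integral_comp_comm
      (integrable_smul_weightedDeriv h g i.1.1 i.1.2)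
    refine h1.symm.trans ?_
    change ∫ z, h z • ((‖x‖ ^ i.1.1) • iteratedFDeriv ℝ i.1.2 (g.compSubConstCLM ℂ z) x m) =
      (‖x‖ ^ i.1.1) • iteratedFDeriv ℝ i.1.2 (conv h g) x m
    rw [iteratedFDeriv_conv, ← integral_smul]
    refine integral_congr_ae (Filter.Eventually.of_forall fun z => ?_)
    simp only [iteratedFDeriv_compSubConst, smul_eq_mul, Complex.real_smul]
    ring
  rw [hv, ← v.integral_comp_comm hint |>.trans (congrArg v hJ)]
  refine integral_congr_ae (Filter.Eventually.of_forall fun z => ?_)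
  simp only [map_smul, smul_eq_mul, hv]
  rfl

theorem fourier_eq_fourierInv_neg (f : 𝓢(V, ℂ)) (x : V) : 𝓕 f x = 𝓕⁻ f (-x) := by
  rw [SchwartzMap.fourier_coe, SchwartzMap.fourierInv_coe, Real.fourierInv_eq_fourier_neg, neg_neg]

theorem fourier_eq_conv {m m₁ m₂ : 𝓢(V, ℂ)} (hm : ∀ ξ, m ξ = m₂ ξ * m₁ ξ) :
    𝓕 m = conv (𝓕 m₂) (𝓕 m₁) := by
  have h1 : 𝓕⁻ m = conv (𝓕⁻ m₂) (𝓕⁻ m₁) := by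
    have h2 : 𝓕 (conv (𝓕⁻ m₂) (𝓕⁻ m₁)) = m := by
      rw [conv, SchwartzMap.fourier_convolution]
      ext ξ
      simp [hm]
    rw [← h2, FourierTransform.fourierInv_fourier_eq]
  ext x
  rw [fourier_eq_fourierInv_neg, h1, conv_apply, conv_apply, ← integral_neg_eq_self]
  refine integral_congr_ae (Filter.Eventually.of_forall fun z => ?_)
  simp only [fourier_eq_fourierInv_neg]
  congr 2
  abel

theorem compSubConst_conv (h g : 𝓢(V, ℂ)) (x : V) :
    (conv h g).compSubConstCLM ℂ x = conv h (g.compSubConstCLM ℂ x) := by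
  ext y
  rw [SchwartzMap.compSubConstCLM_apply, conv_apply, conv_apply]
  simp only [SchwartzMap.compSubConstCLM_apply]
  refine integral_congr_ae (Filter.Eventually.of_forall fun z => ?_)
  simp only [sub_right_comm]

end Convolution

/-! ### Fourier multipliers acting on tempered distributions -/

section Multiplier

variable {N : ℕ}

theorem multiplier_continuous (m : 𝓢(Sp N, ℂ)) (u : 𝓢'(Sp N, ℂ)) :
    Continuous (multiplier m u) :=
  u.continuous.comp (continuous_compSubConst _)

/-- The passage from distributions to functions: once `u` is localized by `m₁`, a further multiplier
is an ordinary convolution integral and can be estimated by the size of its kernel. -/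
theorem multiplier_mul {m m₁ m₂ : 𝓢(Sp N, ℂ)} (hm : ∀ ξ, m ξ = m₂ ξ * m₁ ξ) (u : 𝓢'(Sp N, ℂ))
    (x : Sp N) : multiplier m u x = ∫ y, 𝓕⁻ m₂ (x - y) * multiplier m₁ u y := by
  have h1 := apply_conv (V := Sp N) ⟨u.toLinearMap, u.continuous⟩ (𝓕 m₂) ((𝓕 m₁).compSubConstCLM ℂ x)
  have h2 : multiplier m u x = ∫ z, 𝓕 m₂ z * multiplier m₁ u (x + z) := by
    rw [multiplier, fourier_eq_conv hm, compSubConst_conv]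
    refine h1.trans (integral_congr_ae (Filter.Eventually.of_forall fun z => ?_))
    simp only [SchwartzMap.compSubConstCLM_comp]
    rfl
  rw [h2, ← integral_sub_right_eq_self _ x]
  refine integral_congr_ae (Filter.Eventually.of_forall fun z => ?_)
  simp only [fourier_eq_fourierInv_neg, neg_sub, add_sub_cancel]

theorem multiplier_add (m₁ m₂ : 𝓢(Sp N, ℂ)) (u : 𝓢'(Sp N, ℂ)) (x : Sp N) :
    multiplier (m₁ + m₂) u x = multiplier m₁ u x + multiplier m₂ u x := by
  simp only [multiplier, FourierTransform.fourier_add, map_add]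

theorem multiplier_sum {ι : Type*} (s : Finset ι) (m : ι → 𝓢(Sp N, ℂ)) (u : 𝓢'(Sp N, ℂ))
    (x : Sp N) : multiplier (∑ i ∈ s, m i) u x = ∑ i ∈ s, multiplier (m i) u x := by
  classical
  induction s using Finset.induction_on with
  | empty =>
    have : 𝓕 (0 : 𝓢(Sp N, ℂ)) = 0 := (FourierTransform.fourierCLM ℂ 𝓢(Sp N, ℂ)).map_zero
    simp [multiplier, this]
  | insert i s hi ih => rw [Finset.sum_insert hi, Finset.sum_insert hi, multiplier_add, ih]

theorem tendsto_multiplier {ι : Type*} {l : Filter ι} {m : ι → 𝓢(Sp N, ℂ)} {m₀ : 𝓢(Sp N, ℂ)}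
    (hm : Filter.Tendsto m l (nhds m₀)) (u : 𝓢'(Sp N, ℂ)) (x : Sp N) :
    Filter.Tendsto (fun i => multiplier (m i) u x) l (nhds (multiplier m₀ u x)) := by
  have hc : Continuous fun m : 𝓢(Sp N, ℂ) => multiplier m u x :=
    u.continuous.comp ((SchwartzMap.compSubConstCLM ℂ x).continuous.comp
      (FourierTransform.fourierCLM ℂ 𝓢(Sp N, ℂ)).continuous)
  exact (hc.tendsto m₀).comp hm

theorem dilate_apply (ζ : Cutoff) (k : ℤ) (ξ : Sp N) :
    dilate N ζ k ξ = ((ζ ((2 : ℝ) ^ (-k) * freq ξ) : ℝ) : ℂ) := rfl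

theorem freq_smul (c : ℝ) (hc : 0 ≤ c) (ξ : Sp N) : freq (c • ξ) = c * freq ξ := by
  rw [freq_eq, freq_eq, norm_smul, Real.norm_of_nonneg hc]; ring

/-- The error is `-b(2^{-J}ξ) Ψ(ξ)` with `b = 1 - ζ(|·|)`. The derivatives of the dilated `b` are
bounded uniformly in `J`, and the error vanishes near every point of frequency below `2^J`, so one
additional power of `‖ξ‖` in the seminorm of `Ψ` yields a factor `2^{-J}`. Index `J = 0` is excluded
because the telescoped dyadic sum has this form only from `J = 1` on. -/
theorem tendsto_of_eq_dilate_mul (ζ : Cutoff) (Ψ : 𝓢(Sp N, ℂ)) {m : ℕ → 𝓢(Sp N, ℂ)}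
    (hm : ∀ J : ℕ, 0 < J → ∀ ξ, m J ξ = dilate N ζ J ξ * Ψ ξ) :
    Filter.Tendsto m Filter.atTop (nhds Ψ) := by
  let b : Sp N → ℂ := fun ξ => 1 - dilate N ζ 0 ξ
  have hb : ContDiff ℝ ∞ b := contDiff_const.sub ((dilate N ζ 0).smooth ⊤)
  have hbound : ∀ i : ℕ, ∃ C, 0 ≤ C ∧ ∀ ξ, ‖iteratedFDeriv ℝ i b ξ‖ ≤ C := by
    intro i
    refine ⟨1 + SchwartzMap.seminorm ℂ 0 i (dilate N ζ 0), by positivity, fun ξ => ?_⟩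
    have h1 : iteratedFDeriv ℝ i b ξ = iteratedFDeriv ℝ i (fun _ => (1 : ℂ)) ξ -
        iteratedFDeriv ℝ i (dilate N ζ 0) ξ :=
      iteratedFDeriv_sub_apply contDiff_const.contDiffAt ((dilate N ζ 0).smooth i).contDiffAt
    rw [h1]
    refine (norm_sub_le _ _).trans (add_le_add ?_ (SchwartzMap.norm_iteratedFDeriv_le_seminorm ℂ _ _ _))
    rcases Nat.eq_zero_or_pos i with rfl | hi
    · simp
    · rw [iteratedFDeriv_const_of_ne hi.ne']; simp
  choose C hC0 hC using hbound
  have hcs : ∀ (J i : ℕ) (ξ : Sp N), iteratedFDeriv ℝ i (fun z : Sp N => b (((2 : ℝ) ^ (-(J : ℤ))) • z)) ξ =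
      ((2 : ℝ) ^ (-(J : ℤ))) ^ i • iteratedFDeriv ℝ i b (((2 : ℝ) ^ (-(J : ℤ))) • ξ) := fun J i ξ =>
    congrFun (iteratedFDeriv_comp_const_smul _ (hb.of_le (mod_cast le_top))) ξ
  have hle1 : ∀ J : ℕ, (2 : ℝ) ^ (-(J : ℤ)) ≤ 1 := fun J => by
    rw [zpow_neg, zpow_natCast]
    exact inv_le_one_of_one_le₀ (one_le_pow₀ (by norm_num))
  have hCJ : ∀ (J i : ℕ) (ξ : Sp N),
      ‖iteratedFDeriv ℝ i (fun z : Sp N => b (((2 : ℝ) ^ (-(J : ℤ))) • z)) ξ‖ ≤ C i := by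
    intro J i ξ
    rw [hcs, norm_smul, norm_pow, Real.norm_of_nonneg (by positivity)]
    calc _ ≤ 1 * C i := by
          gcongr
          · exact pow_le_one₀ (by positivity) (hle1 J)
          · exact hC i _
      _ = C i := one_mul _
  have hzero : ∀ (J : ℕ) (ξ : Sp N), freq ξ < 2 ^ J →
      (fun z : Sp N => b (((2 : ℝ) ^ (-(J : ℤ))) • z) * Ψ z) =ᶠ[nhds ξ] fun _ => 0 := by
    intro J ξ hξ
    have hcf : Continuous (freq : Sp N → ℝ) := by
      have : (freq : Sp N → ℝ) = fun ξ => 2 * Real.pi * ‖ξ‖ := funext freq_eq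
      rw [this]; fun_prop
    filter_upwards [hcf.continuousAt.eventually (gt_mem_nhds hξ)] with z hz
    have : ζ ((2 : ℝ) ^ (-(J : ℤ)) * freq z) = 1 := by
      refine ζ.eq_one _ (mul_nonneg (by positivity) (freq_nonneg z)) ?_
      rw [zpow_neg, zpow_natCast, inv_mul_le_iff₀ (by positivity)]
      linarith [freq_nonneg z]
    simp only [b, dilate_apply, freq_smul _ (by positivity : (0 : ℝ) ≤ 2 ^ (-(J : ℤ))), neg_zero,
      zpow_zero, one_mul, this, Complex.ofReal_one, sub_self, zero_mul]
  rw [(schwartz_withSeminorms ℂ (Sp N) ℂ).tendsto_nhds _ _]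
  rintro ⟨k, n⟩ ε hε
  let D : ℝ := ∑ i ∈ Finset.range (n + 1), (n.choose i : ℝ) * C i *
    SchwartzMap.seminorm ℂ (k + 1) (n - i) Ψ
  have hD : 0 ≤ D := Finset.sum_nonneg fun i _ => by
    have := hC0 i; positivity
  have hest : ∀ J : ℕ, 0 < J → SchwartzMap.seminorm ℂ k n (m J - Ψ) ≤ 2 * Real.pi * D * (1 / 2) ^ J := by
    intro J hJ
    refine SchwartzMap.seminorm_le_bound _ _ _ _ (by positivity) fun ξ => ?_
    have h1 : (⇑(m J - Ψ) : Sp N → ℂ) = -(fun z : Sp N => b (((2 : ℝ) ^ (-(J : ℤ))) • z) * Ψ z) := by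
      funext z
      simp only [Pi.neg_apply, sub_apply, hm J hJ, b, dilate_apply,
        freq_smul _ (by positivity : (0 : ℝ) ≤ 2 ^ (-(J : ℤ))), neg_zero, zpow_zero, one_mul]
      ring
    rw [h1, iteratedFDeriv_neg_apply, norm_neg]
    rcases lt_or_ge (freq ξ) (2 ^ J) with h | h
    · rw [Filter.EventuallyEq.eq_of_nhds (Filter.EventuallyEq.iteratedFDeriv ℝ (hzero J ξ h) n)]
      have : iteratedFDeriv ℝ n (fun _ : Sp N => (0 : ℂ)) = 0 := iteratedFDeriv_fun_zero
      rw [this]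
      simp only [Pi.zero_apply, norm_zero, mul_zero]
      positivity
    · have hξ : 0 < ‖ξ‖ := by
        rw [freq_eq] at h
        have : (0 : ℝ) < 2 ^ J := by positivity
        by_contra hcon
        have h0 : ‖ξ‖ = 0 := le_antisymm (not_lt.1 hcon) (norm_nonneg _)
        rw [h0, mul_zero] at h
        linarith
      have h2 := norm_iteratedFDeriv_mul_le (n := n) (N := ∞)
        (hb.comp (contDiff_const_smul ((2 : ℝ) ^ (-(J : ℤ))))) (Ψ.smooth ⊤) ξ (by exact_mod_cast le_top)
      -- The spare factor `‖ξ‖` is paid for by the seminorm of order `k + 1`; on the present region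
      -- `‖ξ‖` is at least `2^J / (2π)`.
      have h3 : ‖ξ‖ * (‖ξ‖ ^ k * ‖iteratedFDeriv ℝ n
          (fun z : Sp N => b (((2 : ℝ) ^ (-(J : ℤ))) • z) * Ψ z) ξ‖) ≤ D := by
        calc _ ≤ ‖ξ‖ ^ (k + 1) * ∑ i ∈ Finset.range (n + 1), (n.choose i : ℝ) * C i *
              ‖iteratedFDeriv ℝ (n - i) Ψ ξ‖ := by
              rw [pow_succ', mul_assoc]
              gcongr
              refine h2.trans (Finset.sum_le_sum fun i _ => ?_)
              gcongr
              exact hCJ J i ξ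
          _ ≤ D := by
              rw [Finset.mul_sum]
              refine Finset.sum_le_sum fun i _ => ?_
              have := SchwartzMap.le_seminorm ℂ (k + 1) (n - i) Ψ ξ
              calc _ = (n.choose i : ℝ) * C i * (‖ξ‖ ^ (k + 1) * ‖iteratedFDeriv ℝ (n - i) Ψ ξ‖) := by ring
                _ ≤ _ := by
                  have := hC0 i
                  gcongr
      have h4 : 1 ≤ 2 * Real.pi * (1 / 2) ^ J * ‖ξ‖ := by
        rw [freq_eq] at h
        rw [one_div, inv_pow]
        field_simp
        linarith
      have h5 : 0 ≤ ‖ξ‖ ^ k * ‖iteratedFDeriv ℝ n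
          (fun z : Sp N => b (((2 : ℝ) ^ (-(J : ℤ))) • z) * Ψ z) ξ‖ := by positivity
      have h6 : (0 : ℝ) ≤ 2 * Real.pi * (1 / 2) ^ J := by positivity
      nlinarith [mul_le_mul_of_nonneg_left h3 h6, mul_le_mul_of_nonneg_right h4 h5]
  have hlim : Filter.Tendsto (fun J : ℕ => 2 * Real.pi * D * (1 / 2 : ℝ) ^ J) Filter.atTop (nhds 0) := by
    simpa using (tendsto_pow_atTop_nhds_zero_of_lt_one (by norm_num : (0 : ℝ) ≤ 1 / 2)
      (by norm_num)).const_mul (2 * Real.pi * D)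
  filter_upwards [hlim.eventually (gt_mem_nhds hε), Filter.eventually_gt_atTop 0] with J hJ hJ0
  exact (hest J hJ0).trans_lt hJ

end Multiplier

end BesovMorrey
end

noncomputable section

namespace BesovMorrey

open MeasureTheory

/-! ### Kernels of radial symbols supported in an annulus -/

/-- Smooth functions with compact support in `(0, ∞)`. -/
structure IsBump (g : ℝ → ℝ) : Prop where
  smooth : ContDiff ℝ ∞ g
  left : ∃ c, 0 < c ∧ ∀ r < c, g r = 0
  right : ∃ R, ∀ r, R < r → g r = 0

theorem IsBump.deriv {g : ℝ → ℝ} (hg : IsBump g) : IsBump (deriv g) := by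
  obtain ⟨c, hc, hl⟩ := hg.left
  obtain ⟨R, hR⟩ := hg.right
  refine ⟨(contDiff_infty_iff_deriv.1 hg.smooth).2, ⟨c, hc, fun r hr => ?_⟩, R, fun r hr => ?_⟩
  · have : g =ᶠ[nhds r] fun _ => 0 := by
      filter_upwards [Iio_mem_nhds hr] with x hx using hl x hx
    rw [this.deriv_eq]; simp
  · have : g =ᶠ[nhds r] fun _ => 0 := by
      filter_upwards [Ioi_mem_nhds hr] with x hx using hR x hx
    rw [this.deriv_eq]; simp

theorem IsBump.bounded {g : ℝ → ℝ} (hg : IsBump g) : ∃ C, 0 ≤ C ∧ ∀ r, |g r| ≤ C := by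
  obtain ⟨c, hc, hl⟩ := hg.left
  obtain ⟨R, hR⟩ := hg.right
  obtain ⟨C, hC⟩ := (isCompact_Icc (a := c) (b := R)).exists_bound_of_continuousOn
    hg.smooth.continuous.continuousOn
  refine ⟨max C 0, le_max_right _ _, fun r => ?_⟩
  rcases lt_or_ge r c with h | h
  · rw [hl r h, abs_zero]; exact le_max_right _ _
  · rcases lt_or_ge R r with h' | h'
    · rw [hR r h', abs_zero]; exact le_max_right _ _
    · exact le_max_of_le_left (hC r ⟨h, h'⟩)

theorem IsBump.mul_rpow {g : ℝ → ℝ} (hg : IsBump g) (b : ℝ) : IsBump (fun r => g r * r ^ b) := by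
  obtain ⟨c, hc, hl⟩ := hg.left
  obtain ⟨R, hR⟩ := hg.right
  refine ⟨?_, ⟨c, hc, fun r hr => by simp [hl r hr]⟩, R, fun r hr => by simp [hR r hr]⟩
  rw [contDiff_iff_contDiffAt]
  intro r
  rcases lt_or_ge r c with h | h
  · have : (fun r => g r * r ^ b) =ᶠ[nhds r] fun _ => 0 := by
      filter_upwards [Iio_mem_nhds h] with x hx
      simp [hl x hx]
    exact contDiffAt_const.congr_of_eventuallyEq this
  · exact hg.smooth.contDiffAt.mul (Real.contDiffAt_rpow_const_of_ne (by linarith))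

theorem stepExp_eq_zero {t a b : ℝ} {g : ℝ → ℝ} {r : ℝ} (h : g r = 0) : stepExp t a g b r = 0 := by
  simp [stepExp, h]

theorem IsBump.stepExp {g : ℝ → ℝ} (hg : IsBump g) (t a b : ℝ) : IsBump (stepExp t a g b) := by
  obtain ⟨c, hc, hl⟩ := hg.left
  obtain ⟨R, hR⟩ := hg.right
  refine ⟨?_, ⟨c, hc, fun r hr => stepExp_eq_zero (hl r hr)⟩, R,
    fun r hr => stepExp_eq_zero (hR r hr)⟩
  rw [contDiff_iff_contDiffAt]
  intro r
  rcases lt_or_ge r c with h | h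
  · have : BesovMorrey.stepExp t a g b =ᶠ[nhds r] fun _ => 0 := by
      filter_upwards [Iio_mem_nhds h] with x hx
      exact stepExp_eq_zero (hl x hx)
    exact contDiffAt_const.congr_of_eventuallyEq this
  · have hr : r ≠ 0 := by linarith
    have h1 : ∀ c : ℝ, ContDiffAt ℝ ∞ (fun x : ℝ => x ^ c) r := fun c =>
      Real.contDiffAt_rpow_const_of_ne hr
    exact hg.smooth.contDiffAt.mul ((h1 b).mul ((contDiffAt_const.mul (h1 a)).exp))

theorem IsBump.deriv_stepExp {g : ℝ → ℝ} (hg : IsBump g) (t a b : ℝ) :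
    _root_.deriv (BesovMorrey.stepExp t a g b) = BesovMorrey.stepExp t a (_root_.deriv g) b +
      (b • BesovMorrey.stepExp t a g (b - 1) + (-t * a) • BesovMorrey.stepExp t a g (b + a - 1)) := by
  funext r
  obtain ⟨c, hc, hl⟩ := hg.left
  rcases lt_or_ge r c with h | h
  · have h0 : ∀ {g : ℝ → ℝ} {b : ℝ}, (∀ r < c, g r = 0) → BesovMorrey.stepExp t a g b =ᶠ[nhds r] fun _ => 0 := by
      intro g b hl
      filter_upwards [Iio_mem_nhds h] with x hx
      exact stepExp_eq_zero (hl x hx)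
    have h1 : _root_.deriv g r = 0 := by
      have : g =ᶠ[nhds r] fun _ => 0 := by
        filter_upwards [Iio_mem_nhds h] with x hx using hl x hx
      rw [this.deriv_eq]; simp
    rw [(h0 hl).deriv_eq]
    simp [BesovMorrey.stepExp, hl r h, h1]
  · have hr : 0 < r := by linarith
    have h1 : ∀ c : ℝ, HasDerivAt (fun x : ℝ => x ^ c) (c * r ^ (c - 1)) r := fun c =>
      Real.hasDerivAt_rpow_const (Or.inl hr.ne')
    have h2 : HasDerivAt g (_root_.deriv g r) r :=
      (hg.smooth.differentiable (by simp) r).hasDerivAt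
    have h3 := h2.mul ((h1 b).mul ((h1 a).const_mul (-t)).exp)
    have h4 : r ^ (b + a - 1) = r ^ b * r ^ (a - 1) := by
      rw [← Real.rpow_add hr]; ring_nf
    have h5 : _root_.deriv (BesovMorrey.stepExp t a g b) r = _ := h3.deriv
    rw [h5]
    simp only [BesovMorrey.stepExp, Pi.add_apply, Pi.smul_apply, smul_eq_mul, h4, Pi.mul_apply]
    ring

theorem IsBump.contDiffAt {g : ℝ → ℝ} (hg : IsBump g) (n : ℕ) (r : ℝ) : ContDiffAt ℝ n g r :=
  (hg.smooth.of_le (mod_cast le_top)).contDiffAt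

theorem pow_mul_exp_neg_le {x : ℝ} (hx : 0 ≤ x) (k : ℕ) : x ^ k * Real.exp (-x) ≤ k.factorial := by
  have h := Real.pow_div_factorial_le_exp x hx k
  rw [div_le_iff₀ (by positivity)] at h
  rw [Real.exp_neg, ← div_eq_mul_inv, div_le_iff₀ (Real.exp_pos x)]
  linarith

/-- Uniformly in `t ≥ 0`, the derivatives of `g(r) r^b exp(-t r^a)` decay rapidly in `t`. -/
theorem IsBump.stepExp_bound {a : ℝ} (ha : 0 < a) (n : ℕ) : ∀ {g : ℝ → ℝ} (_ : IsBump g) (b : ℝ) (k : ℕ),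
    ∃ C, 0 ≤ C ∧ ∀ t, 0 ≤ t → ∀ r, t ^ k * |iteratedDeriv n (BesovMorrey.stepExp t a g b) r| ≤ C := by
  induction n with
  | zero =>
    intro g hg b k
    obtain ⟨C, hC, h⟩ := (hg.mul_rpow b).bounded
    obtain ⟨c, hc, hl⟩ := hg.left
    have hca : 0 < c ^ a := by positivity
    refine ⟨C * ((c ^ a)⁻¹ ^ k * k.factorial), by positivity, fun t ht r => ?_⟩
    rw [iteratedDeriv_zero]
    rcases lt_or_ge r c with hr | hr
    · rw [stepExp_eq_zero (hl r hr), abs_zero, mul_zero]; positivity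
    · have h1 : t ^ k * Real.exp (-t * r ^ a) ≤ (c ^ a)⁻¹ ^ k * k.factorial := by
        have h2 := pow_mul_exp_neg_le (mul_nonneg ht hca.le) k
        calc t ^ k * Real.exp (-t * r ^ a) ≤ t ^ k * Real.exp (-(t * c ^ a)) := by
              gcongr
              rw [neg_mul, neg_le_neg_iff]
              gcongr
          _ = (c ^ a)⁻¹ ^ k * ((t * c ^ a) ^ k * Real.exp (-(t * c ^ a))) := by
              rw [mul_pow, inv_pow]; field_simp
          _ ≤ _ := by gcongr
      have h3 : |BesovMorrey.stepExp t a g b r| = |g r * r ^ b| * Real.exp (-t * r ^ a) := by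
        rw [BesovMorrey.stepExp, ← mul_assoc, abs_mul, abs_of_pos (Real.exp_pos _)]
      rw [h3]
      calc t ^ k * (|g r * r ^ b| * Real.exp (-t * r ^ a))
          = |g r * r ^ b| * (t ^ k * Real.exp (-t * r ^ a)) := by ring
        _ ≤ _ := by
          gcongr
          exact h r
  | succ n ih =>
    intro g hg b k
    obtain ⟨C₁, h₁, H₁⟩ := ih hg.deriv b k
    obtain ⟨C₂, h₂, H₂⟩ := ih hg (b - 1) k
    -- Differentiating the exponential produces a factor `t`, absorbed by using one more power of
    -- `t`; this is why the induction runs over all `g`, `b` and `k`.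
    obtain ⟨C₃, h₃, H₃⟩ := ih hg (b + a - 1) (k + 1)
    refine ⟨C₁ + (|b| * C₂ + a * C₃), by positivity, fun t ht r => ?_⟩
    have d₁ := (hg.deriv.stepExp t a b).contDiffAt n r
    have d₂ := (hg.stepExp t a (b - 1)).contDiffAt n r
    have d₃ := (hg.stepExp t a (b + a - 1)).contDiffAt n r
    have d₄ : ContDiffAt ℝ n (b • BesovMorrey.stepExp t a g (b - 1)) r := contDiffAt_const.smul d₂
    have d₅ : ContDiffAt ℝ n ((-t * a) • BesovMorrey.stepExp t a g (b + a - 1)) r :=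
      contDiffAt_const.smul d₃
    have d₆ : ContDiffAt ℝ n (b • BesovMorrey.stepExp t a g (b - 1) +
        (-t * a) • BesovMorrey.stepExp t a g (b + a - 1)) r := d₄.add d₅
    rw [iteratedDeriv_succ', hg.deriv_stepExp, iteratedDeriv_add d₁ d₆,
      iteratedDeriv_add d₄ d₅, iteratedDeriv_const_smul d₂, iteratedDeriv_const_smul d₃]
    simp only [smul_eq_mul]
    have e₁ := H₁ t ht r
    have e₂ := mul_le_mul_of_nonneg_left (H₂ t ht r) (abs_nonneg b)
    have e₃ := mul_le_mul_of_nonneg_left (H₃ t ht r) ha.le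
    have hk : 0 ≤ t ^ k := by positivity
    have key : ∀ x y z : ℝ, |x + (b * y + -t * a * z)| ≤
        |x| + (|b| * |y| + t * a * |z|) := by
      intro x y z
      have h6 : |-t * a| = t * a := by rw [neg_mul, abs_neg, abs_of_nonneg (by positivity)]
      rw [← abs_mul, ← h6, ← abs_mul]
      exact (abs_add_le _ _).trans (add_le_add le_rfl (abs_add_le _ _))
    refine (mul_le_mul_of_nonneg_left (key _ _ _) hk).trans ?_
    rw [pow_succ] at e₃
    nlinarith

/-- `g(r) (exp(-t r^a) - 1) / t`. -/
def bumpLow (t a : ℝ) (g : ℝ → ℝ) (r : ℝ) : ℝ := g r * ((Real.exp (-t * r ^ a) - 1) / t)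

theorem bumpLow_eq (t a : ℝ) (g : ℝ → ℝ) :
    bumpLow t a g = t⁻¹ • (stepExp t a g 0 - g) := by
  funext r
  simp only [bumpLow, stepExp, Real.rpow_zero, one_mul, Pi.smul_apply, Pi.sub_apply, smul_eq_mul]
  ring

theorem IsBump.low {g : ℝ → ℝ} (hg : IsBump g) (t a : ℝ) : IsBump (bumpLow t a g) := by
  obtain ⟨c, hc, hl⟩ := hg.left
  obtain ⟨R, hR⟩ := hg.right
  refine ⟨?_, ⟨c, hc, fun r hr => by simp [bumpLow, hl r hr]⟩, R,
    fun r hr => by simp [bumpLow, hR r hr]⟩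
  rw [bumpLow_eq]
  exact contDiff_const.smul ((hg.stepExp t a 0).smooth.sub hg.smooth)

theorem IsBump.deriv_low {g : ℝ → ℝ} (hg : IsBump g) {t : ℝ} (ht : t ≠ 0) (a : ℝ) :
    _root_.deriv (bumpLow t a g) = bumpLow t a (_root_.deriv g) +
      (-a) • BesovMorrey.stepExp t a g (a - 1) := by
  funext r
  have h1 : DifferentiableAt ℝ (BesovMorrey.stepExp t a g 0) r :=
    (hg.stepExp t a 0).smooth.differentiable (by simp) r
  have h2 : DifferentiableAt ℝ g r := hg.smooth.differentiable (by simp) r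
  rw [bumpLow_eq, bumpLow_eq, deriv_const_smul _ (h1.sub h2), deriv_sub h1 h2, hg.deriv_stepExp]
  simp only [Pi.add_apply, Pi.smul_apply, Pi.sub_apply, smul_eq_mul]
  field_simp
  ring_nf

/-- The division by `t` is harmless: `|exp(-x) - 1| ≤ x` settles order zero, and a derivative that
falls on the exponential brings out a factor `t` which cancels it. -/
theorem IsBump.low_bound {a : ℝ} (ha : 0 < a) (n : ℕ) : ∀ {g : ℝ → ℝ} (_ : IsBump g),
    ∃ C, 0 ≤ C ∧ ∀ t, 0 < t → ∀ r, |iteratedDeriv n (bumpLow t a g) r| ≤ C := by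
  induction n with
  | zero =>
    intro g hg
    obtain ⟨C, hC, h⟩ := (hg.mul_rpow a).bounded
    obtain ⟨c, hc, hl⟩ := hg.left
    refine ⟨C, hC, fun t ht r => ?_⟩
    rw [iteratedDeriv_zero]
    rcases lt_or_ge r c with hr | hr
    · simpa [bumpLow, hl r hr] using hC
    · have hr0 : 0 < r := by linarith
      refine le_trans ?_ (h r)
      rw [bumpLow, abs_mul, abs_mul]
      refine mul_le_mul_of_nonneg_left ?_ (abs_nonneg _)
      have hx : 0 ≤ r ^ a := by positivity
      rw [abs_div, abs_of_pos ht, div_le_iff₀ ht, abs_of_nonneg hx, abs_le]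
      have h2 := Real.add_one_le_exp (-t * r ^ a)
      have h3 : Real.exp (-t * r ^ a) ≤ 1 := Real.exp_le_one_iff.2 (by nlinarith)
      constructor <;> nlinarith
  | succ n ih =>
    intro g hg
    obtain ⟨C₁, h₁, H₁⟩ := ih hg.deriv
    obtain ⟨C₂, h₂, H₂⟩ := IsBump.stepExp_bound ha n hg (a - 1) 0
    refine ⟨C₁ + a * C₂, by positivity, fun t ht r => ?_⟩
    have d₁ := (hg.deriv.low t a).contDiffAt n r
    have d₂ := (hg.stepExp t a (a - 1)).contDiffAt n r
    have d₃ : ContDiffAt ℝ n ((-a) • BesovMorrey.stepExp t a g (a - 1)) r := contDiffAt_const.smul d₂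
    rw [iteratedDeriv_succ', hg.deriv_low ht.ne', iteratedDeriv_add d₁ d₃,
      iteratedDeriv_const_smul d₂]
    refine (abs_add_le _ _).trans (add_le_add (H₁ t ht r) ?_)
    rw [smul_eq_mul, abs_mul, abs_neg, abs_of_pos ha]
    gcongr
    simpa using H₂ t ht.le r

variable {N : ℕ}

/-- The radial function `ξ ↦ G(|ξ|²)` as a complex-valued function. -/
def radial (N : ℕ) (G : ℝ → ℝ) (ξ : Sp N) : ℂ := ((G (freq ξ ^ 2) : ℝ) : ℂ)

theorem freq_sq_proper : ∃ (k : ℕ) (C : ℝ), ∀ x : Sp N, ‖x‖ ≤ C * (1 + ‖freq x ^ 2‖) ^ k := by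
  refine ⟨1, 1, fun x => ?_⟩
  have h4 : ‖x‖ ≤ freq x := by
    rw [freq_eq]
    nlinarith [norm_nonneg x, Real.pi_gt_three]
  rw [pow_one, one_mul, Real.norm_of_nonneg (by positivity)]
  nlinarith [sq_nonneg (freq x - 1), freq_nonneg x]

theorem IsBump.hasCompactSupport {g : ℝ → ℝ} (hg : IsBump g) :
    HasCompactSupport (fun r => ((g r : ℝ) : ℂ)) := by
  obtain ⟨c, hc, hl⟩ := hg.left
  obtain ⟨R, hR⟩ := hg.right
  refine HasCompactSupport.intro (isCompact_Icc (a := c) (b := R)) fun r hr => ?_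
  rw [Set.mem_Icc, not_and_or, not_le, not_le] at hr
  rcases hr with hr | hr
  · simp [hl r hr]
  · simp [hR r hr]

/-- A bump function as a Schwartz function. -/
def IsBump.toSchwartz {g : ℝ → ℝ} (hg : IsBump g) : 𝓢(ℝ, ℂ) :=
  hg.hasCompactSupport.toSchwartzMap (Complex.ofRealCLM.contDiff.comp hg.smooth)

/-- The radial symbol of a bump function as a Schwartz function. -/
def IsBump.symbol (N : ℕ) {g : ℝ → ℝ} (hg : IsBump g) : 𝓢(Sp N, ℂ) :=
  SchwartzMap.compCLM ℂ hasTemperateGrowth_freq_sq freq_sq_proper hg.toSchwartz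

theorem IsBump.symbol_apply {g : ℝ → ℝ} (hg : IsBump g) (ξ : Sp N) :
    hg.symbol N ξ = radial N g ξ := rfl

theorem IsBump.fourierInv_symbol {g : ℝ → ℝ} (hg : IsBump g) :
    ⇑(𝓕⁻ (hg.symbol N) : 𝓢(Sp N, ℂ)) = 𝓕⁻ (radial N g) := by
  rw [SchwartzMap.fourierInv_coe]
  rfl

theorem IsBump.seminorm_le {g : ℝ → ℝ} (hg : IsBump g) {R C : ℝ} (hR0 : 0 ≤ R)
    (hR : ∀ r, R < |r| → g r = 0) (k n : ℕ) (hC0 : 0 ≤ C) (hC : ∀ r, |iteratedDeriv n g r| ≤ C) :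
    SchwartzMap.seminorm ℂ k n hg.toSchwartz ≤ R ^ k * C := by
  refine SchwartzMap.seminorm_le_bound _ _ _ _ (by positivity) fun r => ?_
  have h1 : ‖iteratedFDeriv ℝ n hg.toSchwartz r‖ = |iteratedDeriv n g r| := by
    have : ‖iteratedFDeriv ℝ n (fun ξ => ((g ξ : ℝ) : ℂ)) r‖ = ‖iteratedFDeriv ℝ n g r‖ :=
      Complex.ofRealLI.norm_iteratedFDeriv_comp_left (hg.contDiffAt n r) le_rfl
    rw [← Real.norm_eq_abs, ← norm_iteratedFDeriv_eq_norm_iteratedDeriv]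
    exact this
  rw [h1, Real.norm_eq_abs]
  rcases lt_or_ge R |r| with h | h
  · have : g =ᶠ[nhds r] fun _ => 0 := by
      filter_upwards [continuous_abs.continuousAt.eventually (lt_mem_nhds h)] with x hx using hR x hx
    have h2 : iteratedDeriv n g r = 0 := by
      rw [Filter.EventuallyEq.iteratedDeriv_eq n this]
      simp
    rw [h2, abs_zero, mul_zero]
    positivity
  · gcongr
    exact hC r

theorem rpow_neg_ge_of_natCeil {x e : ℝ} (hx : 0 ≤ x) {D C : ℝ} (hC : 0 ≤ C)
    (h : (1 + x) ^ ⌈e⌉₊ * D ≤ C) : D ≤ C * (1 + x) ^ (-e) := by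
  have h1 : (1 + x) ^ e ≤ (1 + x) ^ ⌈e⌉₊ := by
    rw [← Real.rpow_natCast]
    exact Real.rpow_le_rpow_of_exponent_le (by linarith) (Nat.le_ceil e)
  have h2 : 0 < (1 + x) ^ e := by positivity
  rw [Real.rpow_neg (by positivity), ← div_eq_mul_inv, le_div_iff₀ h2]
  rcases le_total D 0 with hD | hD
  · nlinarith
  · nlinarith

/-- Uniformly bounded families of bump functions have uniformly decaying kernels. -/
theorem exists_kernel_bound {ι : Type*} {G : ι → ℝ → ℝ} (hG : ∀ i, IsBump (G i)) {R : ℝ} (hR0 : 0 ≤ R)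
    (hR : ∀ i r, R < |r| → G i r = 0)
    (hC : ∀ n : ℕ, ∃ C, 0 ≤ C ∧ ∀ i r, |iteratedDeriv n (G i) r| ≤ C) (e : ℝ) :
    ∃ C, 0 ≤ C ∧ ∀ i (x : Sp N), ‖𝓕⁻ (radial N (G i)) x‖ ≤ C * (1 + ‖x‖) ^ (-e) := by
  choose C hC0 hC using hC
  -- The map from a one-dimensional profile to its kernel on `ℝ^N` is continuous between Schwartz
  -- spaces, so finitely many seminorms of the profile control the decay of the kernel; no
  -- derivative of a radial function is computed in several variables.
  let T : 𝓢(ℝ, ℂ) →L[ℂ] 𝓢(Sp N, ℂ) := (FourierTransform.fourierInvCLM ℂ 𝓢(Sp N, ℂ)).comp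
    (SchwartzMap.compCLM ℂ hasTemperateGrowth_freq_sq freq_sq_proper)
  let p : Seminorm ℂ 𝓢(Sp N, ℂ) :=
    2 ^ ⌈e⌉₊ • (Finset.Iic ((⌈e⌉₊, 0) : ℕ × ℕ)).sup fun m => SchwartzMap.seminorm ℂ m.1 m.2
  have hp : Continuous p := by
    have h1 : Continuous ((Finset.Iic ((⌈e⌉₊, 0) : ℕ × ℕ)).sup (schwartzSeminormFamily ℂ (Sp N) ℂ) :
        Seminorm ℂ 𝓢(Sp N, ℂ)) :=
      Seminorm.continuous_finsetSup fun i _ => (schwartz_withSeminorms ℂ (Sp N) ℂ).continuous_seminorm i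
    exact h1.const_smul (2 ^ ⌈e⌉₊ : ℕ)
  obtain ⟨s, D, -, hD⟩ := Seminorm.bound_of_continuous (schwartz_withSeminorms ℂ ℝ ℂ) (p.comp T.toLinearMap)
    (hp.comp T.continuous)
  let B : ℝ := ∑ m ∈ s, R ^ m.1 * C m.2
  have hB : 0 ≤ B := Finset.sum_nonneg fun m _ => by have := hC0 m.2; positivity
  refine ⟨D * B, by positivity, fun i x => rpow_neg_ge_of_natCeil (norm_nonneg _) (by positivity) ?_⟩
  have h1 : (1 + ‖x‖) ^ ⌈e⌉₊ * ‖T (hG i).toSchwartz x‖ ≤ p (T (hG i).toSchwartz) := by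
    have := SchwartzMap.one_add_le_sup_seminorm_apply (𝕜 := ℂ) (m := (⌈e⌉₊, 0)) le_rfl le_rfl
      (T (hG i).toSchwartz) x
    rw [norm_iteratedFDeriv_zero] at this
    simpa [p] using this
  have h2 : T (hG i).toSchwartz x = 𝓕⁻ (radial N (G i)) x := congrFun (hG i).fourierInv_symbol x
  rw [← h2]
  refine h1.trans ((hD (hG i).toSchwartz).trans ?_)
  rw [smul_apply, NNReal.smul_def, smul_eq_mul]
  gcongr
  refine Seminorm.finset_sup_apply_le hB fun m hm => ?_
  refine ((hG i).seminorm_le hR0 (hR i) m.1 m.2 (hC0 _) (hC m.2 i)).trans ?_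
  exact Finset.single_le_sum (f := fun m : ℕ × ℕ => R ^ m.1 * C m.2)
    (fun m _ => by have := hC0 m.2; positivity) hm

theorem IsBump.abs_right {g : ℝ → ℝ} (hg : IsBump g) : ∃ R, 0 ≤ R ∧ ∀ r, R < |r| → g r = 0 := by
  obtain ⟨c, hc, hl⟩ := hg.left
  obtain ⟨R, hR⟩ := hg.right
  refine ⟨max R 0, le_max_right _ _, fun r hr => ?_⟩
  rcases lt_or_ge r c with h | h
  · exact hl r h
  · exact hR r (by rw [abs_of_nonneg (by linarith)] at hr; exact (le_max_left _ _).trans_lt hr)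

theorem IsBump.exists_kernel_exp_bound {g : ℝ → ℝ} (hg : IsBump g) {a : ℝ} (ha : 0 < a) (e : ℝ) (k : ℕ) :
    ∃ C, 0 ≤ C ∧ ∀ t, 0 ≤ t → ∀ x : Sp N,
      t ^ k * ‖𝓕⁻ (radial N (BesovMorrey.stepExp t a g 0)) x‖ ≤ C * (1 + ‖x‖) ^ (-e) := by
  obtain ⟨R, hR0, hR⟩ := hg.abs_right
  have hsmul : ∀ t : Set.Ici (0 : ℝ), (fun r => t.1 ^ k * BesovMorrey.stepExp t.1 a g 0 r) =
      BesovMorrey.stepExp t.1 a (fun r => t.1 ^ k * g r) 0 := fun t => by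
    funext r; simp [BesovMorrey.stepExp, mul_assoc]
  have hb : ∀ t : Set.Ici (0 : ℝ), IsBump (fun r => t.1 ^ k * BesovMorrey.stepExp t.1 a g 0 r) := by
    intro t
    obtain ⟨c, hc, hl⟩ := (hg.stepExp t a 0).left
    obtain ⟨R, hR⟩ := (hg.stepExp t a 0).right
    exact ⟨contDiff_const.mul (hg.stepExp t a 0).smooth, ⟨c, hc, fun r hr => by simp [hl r hr]⟩, R,
      fun r hr => by simp [hR r hr]⟩
  obtain ⟨C, hC0, hC⟩ := exists_kernel_bound (N := N) hb hR0
    (fun t r hr => by simp [stepExp_eq_zero (hR r hr)]) (fun n => by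
      obtain ⟨C, hC0, hC⟩ := IsBump.stepExp_bound ha n hg 0 k
      refine ⟨C, hC0, fun t r => ?_⟩
      have : iteratedDeriv n (fun r => t.1 ^ k * BesovMorrey.stepExp t.1 a g 0 r) r =
          t.1 ^ k * iteratedDeriv n (BesovMorrey.stepExp t.1 a g 0) r :=
        iteratedDeriv_const_mul_field _ _
      rw [this, abs_mul, abs_of_nonneg (pow_nonneg t.2 k)]
      exact hC t t.2 r) e
  refine ⟨C, hC0, fun t ht x => ?_⟩
  have h1 : 𝓕⁻ (radial N (fun r => t ^ k * BesovMorrey.stepExp t a g 0 r)) x =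
      (t : ℂ) ^ k * 𝓕⁻ (radial N (BesovMorrey.stepExp t a g 0)) x := by
    have : radial N (fun r => t ^ k * BesovMorrey.stepExp t a g 0 r) =
        fun ξ => (t : ℂ) ^ k • radial N (BesovMorrey.stepExp t a g 0) ξ := by
      funext ξ; simp [radial]
    rw [this, Real.fourierInv_eq, Real.fourierInv_eq, ← smul_eq_mul, ← integral_smul]
    refine integral_congr_ae (Filter.Eventually.of_forall fun z => ?_)
    simp only [smul_eq_mul]
    rw [Circle.smul_def, Circle.smul_def]
    simp only [smul_eq_mul]
    ring
  have h2 := hC ⟨t, ht⟩ x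
  simp only [h1, norm_mul, norm_pow, Complex.norm_real, Real.norm_of_nonneg ht] at h2
  exact h2

theorem IsBump.exists_kernel_low_bound {g : ℝ → ℝ} (hg : IsBump g) {a : ℝ} (ha : 0 < a) (e : ℝ) :
    ∃ C, 0 ≤ C ∧ ∀ t, 0 < t → ∀ x : Sp N,
      ‖𝓕⁻ (radial N (bumpLow t a g)) x‖ ≤ C * (1 + ‖x‖) ^ (-e) := by
  obtain ⟨R, hR0, hR⟩ := hg.abs_right
  obtain ⟨C, hC0, hC⟩ := exists_kernel_bound (N := N) (ι := Set.Ioi (0 : ℝ))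
    (fun t => hg.low t.1 a) hR0
    (fun t r hr => by simp [bumpLow, hR r hr]) (fun n => by
      obtain ⟨C, hC0, hC⟩ := IsBump.low_bound ha n hg
      exact ⟨C, hC0, fun t r => hC t.1 t.2 r⟩) e
  exact ⟨C, hC0, fun t ht x => hC ⟨t, ht⟩ x⟩

theorem IsBump.continuousOn_kernel_exp {g : ℝ → ℝ} (hg : IsBump g) (a : ℝ) (x : Sp N) :
    ContinuousOn (fun t : ℝ => 𝓕⁻ (radial N (BesovMorrey.stepExp t a g 0)) x) (Set.Ici 0) := by
  simp only [Real.fourierInv_eq]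
  have hint : Integrable (fun ξ : Sp N => ‖hg.symbol N ξ‖) := (hg.symbol N).integrable.norm
  refine continuousOn_of_dominated (bound := fun ξ => ‖hg.symbol N ξ‖) ?_ ?_ hint ?_
  · intro t _
    have hc : Continuous (radial N (BesovMorrey.stepExp t a g 0)) :=
      ((hg.stepExp t a 0).symbol N).continuous
    exact ((Real.continuous_fourierChar.comp
      (by fun_prop : Continuous fun v : Sp N => (inner ℝ v x : ℝ))).smul hc).aestronglyMeasurable
  · intro t ht
    refine Filter.Eventually.of_forall fun ξ => ?_
    rw [Circle.norm_smul, hg.symbol_apply, radial, radial, Complex.norm_real, Complex.norm_real,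
      BesovMorrey.stepExp, Real.rpow_zero, one_mul, norm_mul]
    refine mul_le_of_le_one_right (norm_nonneg _) ?_
    rw [Real.norm_of_nonneg (Real.exp_pos _).le, Real.exp_le_one_iff]
    have : 0 ≤ (freq ξ ^ 2) ^ a := by positivity
    have ht : 0 ≤ t := ht
    nlinarith
  · refine Filter.Eventually.of_forall fun ξ => Continuous.continuousOn ?_
    simp only [radial, BesovMorrey.stepExp]
    refine Continuous.const_smul ?_ _
    fun_prop

theorem fourierInv_comp_smul (M : Sp N → ℂ) {c : ℝ} (hc : 0 < c) (x : Sp N) :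
    𝓕⁻ (fun ξ => M (c⁻¹ • ξ)) x = (c ^ N : ℝ) • 𝓕⁻ M (c • x) := by
  rw [Real.fourierInv_eq, Real.fourierInv_eq]
  have h := Measure.integral_comp_inv_smul (volume : Measure (Sp N))
    (fun ξ => (Real.fourierChar (inner ℝ ξ (c • x))) • M ξ) c
  rw [finrank_euclideanSpace, Fintype.card_fin, abs_of_pos (pow_pos hc N)] at h
  rw [← h]
  refine integral_congr_ae (Filter.Eventually.of_forall fun z => ?_)
  simp only
  rw [inner_smul_left, inner_smul_right]
  congr 3
  simp
  field_simp

end BesovMorrey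
end

noncomputable section

namespace BesovMorrey

open MeasureTheory

variable {N : ℕ}

/-! ### The heat kernel -/

theorem continuous_freq : Continuous (freq : Sp N → ℝ) := by
  have : (freq : Sp N → ℝ) = fun ξ => 2 * Real.pi * ‖ξ‖ := funext freq_eq
  rw [this]; fun_prop

theorem integrable_fourierChar_smul {f : Sp N → ℂ} (hf : Integrable f) (x : Sp N) :
    Integrable fun v => (Real.fourierChar (inner ℝ v x)) • f v := by
  refine hf.norm.mono' ?_ (Filter.Eventually.of_forall fun v => by rw [Circle.norm_smul])
  exact (Real.continuous_fourierChar.comp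
    (by fun_prop : Continuous fun v : Sp N => (inner ℝ v x : ℝ))).aestronglyMeasurable.smul
    hf.aestronglyMeasurable

theorem fourierInv_add_apply {f g : Sp N → ℂ} (hf : Integrable f) (hg : Integrable g) (x : Sp N) :
    𝓕⁻ (fun ξ => f ξ + g ξ) x = 𝓕⁻ f x + 𝓕⁻ g x := by
  simp only [Real.fourierInv_eq, smul_add]
  exact integral_add (integrable_fourierChar_smul hf x) (integrable_fourierChar_smul hg x)

theorem fourierInv_sum_apply {ι : Type*} (s : Finset ι) {f : ι → Sp N → ℂ}
    (hf : ∀ i ∈ s, Integrable (f i)) (x : Sp N) :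
    𝓕⁻ (fun ξ => ∑ i ∈ s, f i ξ) x = ∑ i ∈ s, 𝓕⁻ (f i) x := by
  simp only [Real.fourierInv_eq, Finset.smul_sum]
  exact integral_finsetSum s fun i hi => integrable_fourierChar_smul (hf i hi) x

theorem continuous_fourierInv {f : Sp N → ℂ} (hf : Integrable f) : Continuous (𝓕⁻ f) := by
  have : 𝓕⁻ f = fun x => ∫ v, (Real.fourierChar (inner ℝ v x)) • f v := funext fun x => Real.fourierInv_eq f x
  rw [this]
  refine continuous_of_dominated (bound := fun v => ‖f v‖)
    (fun x => (integrable_fourierChar_smul hf x).aestronglyMeasurable)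
    (fun x => Filter.Eventually.of_forall fun v => by rw [Circle.norm_smul]) hf.norm
    (Filter.Eventually.of_forall fun v => ?_)
  exact (Real.continuous_fourierChar.comp
    (by fun_prop : Continuous fun x : Sp N => (inner ℝ v x : ℝ))).smul continuous_const

theorem exists_schwartz_bound (Φ : 𝓢(Sp N, ℂ)) (e : ℝ) :
    ∃ C, 0 ≤ C ∧ ∀ x, ‖Φ x‖ ≤ C * (1 + ‖x‖) ^ (-e) := by
  obtain ⟨C, hC, h⟩ := one_add_norm_mul_iteratedFDeriv_le Φ ⌈e⌉₊ 0
  refine ⟨C, hC, fun x => rpow_neg_ge_of_natCeil (norm_nonneg _) hC ?_⟩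
  simpa [norm_iteratedFDeriv_zero] using h x

/-- The symbol `exp(-t|ξ|^θ)`. -/
def heatSymbol (N : ℕ) (θ t : ℝ) (ξ : Sp N) : ℂ := ((Real.exp (-t * freq ξ ^ θ) : ℝ) : ℂ)

theorem heatKernel_eq (θ t : ℝ) : heatKernel N θ t = 𝓕⁻ (heatSymbol N θ t) := rfl

/-- The part of the heat symbol at time one carried by the low frequencies, without its value
at the origin. -/
def lowHeatSymbol (N : ℕ) (ζ : Cutoff) (θ : ℝ) (ξ : Sp N) : ℂ :=
  ((ζ (freq ξ) * (Real.exp (-freq ξ ^ θ) - 1) : ℝ) : ℂ)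

/-- The first two terms are Schwartz functions. The possible lack of smoothness at the origin is
confined to the last one, which is small there, of order `|ξ|^θ`. -/
theorem heatSymbol_one_eq (ζ : Cutoff) {θ : ℝ} (hθ : 0 < θ) (ξ : Sp N) :
    heatSymbol N θ 1 ξ = lowSymbol N ζ ξ + heatHighSymbol N ζ hθ one_pos ξ +
      lowHeatSymbol N ζ θ ξ := by
  rw [lowSymbol_apply]
  change _ = _ + (((1 - ζ (freq ξ)) * Real.exp (-1 * freq ξ ^ θ) : ℝ) : ℂ) + _
  rw [lowHeatSymbol, heatSymbol]
  simp only [neg_one_mul]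
  norm_cast
  ring

theorem lowHeat_bound (ζ : Cutoff) {θ : ℝ} (ξ : Sp N) {K : ℝ} (hK : 1 ≤ K) :
    |(ζ (freq ξ) - ζ (K * freq ξ)) * (Real.exp (-freq ξ ^ θ) - 1)| ≤
      Set.indicator (Metric.closedBall (0 : Sp N) 1) (fun _ => (1 : ℝ)) ξ := by
  have hf := freq_nonneg ξ
  by_cases h : ξ ∈ Metric.closedBall (0 : Sp N) 1
  · rw [Set.indicator_of_mem h, abs_mul]
    have hKf : 0 ≤ K * freq ξ := by positivity
    have h1 : |ζ (freq ξ) - ζ (K * freq ξ)| ≤ 1 := by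
      rw [abs_le]
      constructor <;> linarith [ζ.nonneg _ hf, ζ.le_one _ hf, ζ.nonneg _ hKf, ζ.le_one _ hKf]
    have h2 : |Real.exp (-freq ξ ^ θ) - 1| ≤ 1 := by
      have h3 : Real.exp (-freq ξ ^ θ) ≤ 1 := Real.exp_le_one_iff.2 (by
        have : 0 ≤ freq ξ ^ θ := by positivity
        linarith)
      rw [abs_le]
      constructor <;> linarith [Real.exp_pos (-freq ξ ^ θ)]
    exact mul_le_one₀ h1 (abs_nonneg _) h2
  · rw [Set.indicator_of_notMem h]
    have h1 : 1 < ‖ξ‖ := by simpa using h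
    have h2 : 5 / 3 ≤ freq ξ := by
      rw [freq_eq]; nlinarith [Real.pi_gt_three]
    rw [ζ.eq_zero h2, ζ.eq_zero (by nlinarith)]
    simp

theorem integrable_unitBall_indicator :
    Integrable (Set.indicator (Metric.closedBall (0 : Sp N) 1) (fun _ => (1 : ℝ))) :=
  (integrable_indicator_iff Metric.isClosed_closedBall.measurableSet).2
    (integrableOn_const (isCompact_closedBall (0 : Sp N) 1).measure_lt_top.ne)

theorem continuous_cutoff_freq (ζ : Cutoff) {c : ℝ} (hc : 0 ≤ c) :
    Continuous fun ξ : Sp N => ζ (c * freq ξ) := by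
  have h : (fun ξ : Sp N => ζ (c * freq ξ)) = (fun r => ζ (√r)) ∘ fun ξ => (c * freq ξ) ^ 2 := by
    funext ξ
    simp only [Function.comp]
    rw [Real.sqrt_sq (mul_nonneg hc (freq_nonneg ξ))]
  rw [h]
  exact ζ.contDiff_sqrt.continuous.comp ((continuous_const.mul continuous_freq).pow 2)

theorem continuous_exp_freq {θ : ℝ} (hθ : 0 < θ) : Continuous fun ξ : Sp N => Real.exp (-freq ξ ^ θ) := by
  have := (continuous_freq (N := N)).rpow_const (p := θ) (fun _ => Or.inr hθ.le)
  fun_prop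

theorem integrable_lowHeat (ζ : Cutoff) {θ : ℝ} (hθ : 0 < θ) {K : ℝ} (hK : 1 ≤ K) :
    Integrable fun ξ : Sp N =>
      (((ζ (freq ξ) - ζ (K * freq ξ)) * (Real.exp (-freq ξ ^ θ) - 1) : ℝ) : ℂ) := by
  refine integrable_unitBall_indicator.mono' ?_ (Filter.Eventually.of_forall fun ξ => ?_)
  · have h1 := continuous_cutoff_freq (N := N) ζ zero_le_one
    simp only [one_mul] at h1
    have h2 := continuous_cutoff_freq (N := N) ζ (zero_le_one.trans hK)
    have h3 := continuous_exp_freq (N := N) hθ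
    exact (Complex.continuous_ofReal.comp
      ((h1.sub h2).mul (h3.sub continuous_const))).aestronglyMeasurable
  · rw [Complex.norm_real, Real.norm_eq_abs]
    exact lowHeat_bound ζ ξ hK

/-- The difference of two dilates of a cutoff function, as a function of the squared variable. -/
def annulus (ζ : Cutoff) (α β : ℝ) (r : ℝ) : ℝ := ζ (√(α ^ 2 * r)) - ζ (√(β ^ 2 * r))

theorem annulus_sq (ζ : Cutoff) {α β : ℝ} (hα : 0 ≤ α) (hβ : 0 ≤ β) {f : ℝ} (hf : 0 ≤ f) :
    annulus ζ α β (f ^ 2) = ζ (α * f) - ζ (β * f) := by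
  rw [annulus, ← mul_pow, ← mul_pow, Real.sqrt_sq (by positivity), Real.sqrt_sq (by positivity)]

theorem isBump_annulus (ζ : Cutoff) {α β : ℝ} (hα : 0 < α) (hαβ : α ≤ β) : IsBump (annulus ζ α β) := by
  have hβ : 0 < β := hα.trans_le hαβ
  refine ⟨(ζ.contDiff_sqrt.comp (contDiff_const.mul contDiff_id)).sub
    (ζ.contDiff_sqrt.comp (contDiff_const.mul contDiff_id)), ⟨1 / β ^ 2, by positivity, fun r hr => ?_⟩,
    4 / α ^ 2, fun r hr => ?_⟩
  · have h1 : ∀ κ, 0 < κ → κ ≤ β → ζ (√(κ ^ 2 * r)) = 1 := by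
      intro κ hκ hκβ
      refine ζ.eq_one _ (Real.sqrt_nonneg _) ?_
      rw [Real.sqrt_le_left (by norm_num)]
      rcases le_total r 0 with h | h
      · nlinarith [sq_nonneg κ]
      · rw [lt_div_iff₀ (by positivity)] at hr
        have : κ ^ 2 * r ≤ β ^ 2 * r := by gcongr
        nlinarith
    rw [annulus, h1 α hα hαβ, h1 β hβ le_rfl, sub_self]
  · have h1 : ∀ κ, α ≤ κ → ζ (√(κ ^ 2 * r)) = 0 := by
      intro κ hκ
      refine ζ.eq_zero (Real.le_sqrt_of_sq_le ?_)
      have hr0 : 0 ≤ r := le_trans (by positivity) hr.le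
      rw [div_lt_iff₀ (by positivity)] at hr
      have : α ^ 2 * r ≤ κ ^ 2 * r := by gcongr
      nlinarith
    rw [annulus, h1 α le_rfl, h1 β hαβ, sub_self]

theorem one_add_dilate_rpow_le {c e : ℝ} (hc : 0 < c) (hc1 : c ≤ 1) (he : 0 ≤ e) (x : Sp N) :
    (1 + ‖c • x‖) ^ (-e) ≤ c ^ (-e) * (1 + ‖x‖) ^ (-e) := by
  rw [norm_smul, Real.norm_of_nonneg hc.le, ← Real.mul_rpow hc.le (by positivity)]
  apply Real.rpow_le_rpow_of_nonpos (by positivity)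
  · nlinarith [norm_nonneg x]
  · linarith

/-- Decompose dyadically towards the origin. With `c = 2^{-k}`, the piece at frequency `c` has size
`c^θ`, and its kernel is at most a constant times `c^{N+θ} (1 + c|x|)^{-(N+θ/2)}`, hence `c^{θ/2}
(1+|x|)^{-(N+θ/2)}` up to a constant. Asking for only `θ/2` beyond `N` leaves the factor `c^{θ/2}`
that makes the series geometric. -/
theorem exists_lowHeat_kernel_bound (N : ℕ) (ζ : Cutoff) {θ : ℝ} (hθ : 0 < θ) :
    ∃ C, 0 ≤ C ∧ ∀ x : Sp N, ‖𝓕⁻ (lowHeatSymbol N ζ θ) x‖ ≤ C * (1 + ‖x‖) ^ (-(N + θ / 2 : ℝ)) := by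
  have hbump := isBump_annulus ζ (one_pos) (one_le_two)
  obtain ⟨C, hC0, hC⟩ := hbump.exists_kernel_low_bound (N := N) (half_pos hθ) (N + θ / 2)
  let q : ℝ := 2 ^ (-(θ / 2))
  have hq0 : 0 < q := by positivity
  have hq1 : q < 1 := Real.rpow_lt_one_of_one_lt_of_neg one_lt_two (by linarith)
  let piece : ℕ → Sp N → ℂ := fun k ξ =>
    (((ζ (2 ^ k * freq ξ) - ζ (2 ^ (k + 1) * freq ξ)) * (Real.exp (-freq ξ ^ θ) - 1) : ℝ) : ℂ)
  have hpint : ∀ k, Integrable (piece k) := by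
    intro k
    have h1 := (integrable_lowHeat (N := N) ζ hθ (one_le_pow₀ one_le_two : (1 : ℝ) ≤ 2 ^ (k + 1))).sub
      (integrable_lowHeat (N := N) ζ hθ (one_le_pow₀ one_le_two : (1 : ℝ) ≤ 2 ^ k))
    refine h1.congr (Filter.Eventually.of_forall fun ξ => ?_)
    simp only [piece, Pi.sub_apply]
    push_cast
    ring
  have hpiece : ∀ k x, ‖𝓕⁻ (piece k) x‖ ≤ C * (1 + ‖x‖) ^ (-(N + θ / 2 : ℝ)) * q ^ k := by
    intro k x
    let c : ℝ := (1 / 2) ^ k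
    have hc : 0 < c := by positivity
    have hc1 : c ≤ 1 := pow_le_one₀ (by norm_num) (by norm_num)
    have hcinv : c⁻¹ = 2 ^ k := by simp [c]
    let l : ℝ := c ^ θ
    have hl : 0 < l := by positivity
    -- Rescaling to unit frequency turns time one into time `l = c^θ`. The factor `l` compensates
    -- the division by the time in `bumpLow` and is the smallness of the piece.
    have h1 : piece k = fun ξ => (fun η => (l : ℂ) • radial N (bumpLow l (θ / 2) (annulus ζ 1 2)) η) (c⁻¹ • ξ) := by
      funext ξ
      have hf := freq_nonneg ξ
      simp only [piece, radial, bumpLow, freq_smul _ (inv_pos.2 hc).le, smul_eq_mul]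
      rw [annulus_sq ζ zero_le_one zero_le_two (by positivity)]
      have h2 : -l * ((c⁻¹ * freq ξ) ^ 2) ^ (θ / 2) = -freq ξ ^ θ := by
        rw [← Real.rpow_natCast (c⁻¹ * freq ξ) 2, ← Real.rpow_mul (by positivity), show ((2 : ℕ) * (θ / 2) : ℝ) = θ by push_cast; ring, Real.mul_rpow (by positivity) hf,
          Real.inv_rpow hc.le]
        simp only [l]
        field_simp
      rw [h2, hcinv]
      push_cast
      have : (l : ℂ) ≠ 0 := by exact_mod_cast hl.ne'
      field_simp
      ring_nf
    have h1' : 𝓕⁻ (piece k) x = (c ^ N : ℝ) • 𝓕⁻ (fun η => (l : ℂ) •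
        radial N (bumpLow l (θ / 2) (annulus ζ 1 2)) η) (c • x) := by
      rw [h1]
      exact fourierInv_comp_smul (fun η => (l : ℂ) •
        radial N (bumpLow l (θ / 2) (annulus ζ 1 2)) η) hc x
    rw [h1', norm_smul, Real.norm_of_nonneg (by positivity)]
    have h3 : 𝓕⁻ (fun η => (l : ℂ) • radial N (bumpLow l (θ / 2) (annulus ζ 1 2)) η) (c • x) =
        (l : ℂ) * 𝓕⁻ (radial N (bumpLow l (θ / 2) (annulus ζ 1 2))) (c • x) := by
      rw [Real.fourierInv_eq, Real.fourierInv_eq, ← smul_eq_mul, ← integral_smul]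
      refine integral_congr_ae (Filter.Eventually.of_forall fun z => ?_)
      exact smul_comm _ _ _
    rw [h3, norm_mul, Complex.norm_real, Real.norm_of_nonneg hl.le]
    calc c ^ N * (l * ‖𝓕⁻ (radial N (bumpLow l (θ / 2) (annulus ζ 1 2))) (c • x)‖)
        ≤ c ^ N * (l * (C * (c ^ (-(N + θ / 2 : ℝ)) * (1 + ‖x‖) ^ (-(N + θ / 2 : ℝ))))) := by
          gcongr
          refine (hC l hl _).trans ?_
          gcongr
          exact one_add_dilate_rpow_le hc hc1 (by positivity) x
      _ = C * (1 + ‖x‖) ^ (-(N + θ / 2 : ℝ)) * (c ^ (N : ℝ) * c ^ θ * c ^ (-(N + θ / 2 : ℝ))) := by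
          rw [Real.rpow_natCast]; ring
      _ = _ := by
          rw [← Real.rpow_add hc, ← Real.rpow_add hc]
          congr 1
          simp only [c, q]
          rw [← Real.rpow_natCast, ← Real.rpow_natCast, ← Real.rpow_mul (by norm_num), ← Real.rpow_mul (by norm_num),
            one_div, Real.inv_rpow (by norm_num), ← Real.rpow_neg (by norm_num)]
          congr 1
          ring
  have hsum : ∀ K ξ, ∑ k ∈ Finset.range K, piece k ξ =
      (((ζ (freq ξ) - ζ (2 ^ K * freq ξ)) * (Real.exp (-freq ξ ^ θ) - 1) : ℝ) : ℂ) := by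
    intro K ξ
    induction K with
    | zero => simp
    | succ K ih =>
      rw [Finset.sum_range_succ, ih]
      simp only [piece]
      push_cast
      ring
  have hpart : ∀ K x, ‖𝓕⁻ (fun ξ => ∑ k ∈ Finset.range K, piece k ξ) x‖ ≤
      C * (1 + ‖x‖) ^ (-(N + θ / 2 : ℝ)) * (1 - q)⁻¹ := by
    intro K x
    rw [fourierInv_sum_apply _ (fun k _ => hpint k)]
    refine (norm_sum_le _ _).trans ((Finset.sum_le_sum fun k _ => hpiece k x).trans ?_)
    rw [← Finset.mul_sum]
    gcongr
    rw [← tsum_geometric_of_lt_one hq0.le hq1]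
    exact (summable_geometric_of_lt_one hq0.le hq1).sum_le_tsum _ fun k _ => by positivity
  refine ⟨C * (1 - q)⁻¹, mul_nonneg hC0 (inv_nonneg.2 (by linarith)), fun x => ?_⟩
  have hlim : Filter.Tendsto (fun K => 𝓕⁻ (fun ξ => ∑ k ∈ Finset.range K, piece k ξ) x) Filter.atTop
      (nhds (𝓕⁻ (lowHeatSymbol N ζ θ) x)) := by
    simp only [Real.fourierInv_eq]
    refine tendsto_integral_of_dominated_convergence
      (Set.indicator (Metric.closedBall (0 : Sp N) 1) (fun _ => (1 : ℝ))) (fun K => ?_)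
      integrable_unitBall_indicator (fun K => ?_) (Filter.Eventually.of_forall fun ξ => ?_)
    · exact (integrable_fourierChar_smul (integrable_finsetSum _ fun k _ => hpint k) x).aestronglyMeasurable
    · refine Filter.Eventually.of_forall fun ξ => ?_
      rw [Circle.norm_smul, hsum, Complex.norm_real, Real.norm_eq_abs]
      exact lowHeat_bound ζ ξ (one_le_pow₀ one_le_two)
    · refine Filter.Tendsto.const_smul ?_ _
      refine tendsto_nhds_of_eventually_eq ?_
      -- At the origin the pieces vanish because `exp(0) - 1 = 0`; elsewhere the partial sums
      -- telescope and are eventually constant.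
      rcases (freq_nonneg ξ).eq_or_lt with h | h
      · refine Filter.Eventually.of_forall fun K => ?_
        rw [hsum, lowHeatSymbol, ← h, Real.zero_rpow hθ.ne']
        simp
      · have h1 := (tendsto_pow_atTop_atTop_of_one_lt (one_lt_two (α := ℝ))).atTop_mul_const h
        filter_upwards [h1.eventually_ge_atTop (5 / 3)] with K hK
        rw [hsum, lowHeatSymbol, ζ.eq_zero hK, sub_zero]
  refine (le_of_tendsto hlim.norm (Filter.Eventually.of_forall fun K => hpart K x)).trans (le_of_eq ?_)
  ring

theorem integrable_lowHeatSymbol (ζ : Cutoff) {θ : ℝ} (hθ : 0 < θ) :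
    Integrable (lowHeatSymbol N ζ θ) := by
  refine integrable_unitBall_indicator.mono' ?_ (Filter.Eventually.of_forall fun ξ => ?_)
  · have h1 := continuous_cutoff_freq (N := N) ζ zero_le_one
    simp only [one_mul] at h1
    have h3 := continuous_exp_freq (N := N) hθ
    exact (Complex.continuous_ofReal.comp
      (h1.mul (h3.sub continuous_const))).aestronglyMeasurable
  · rw [lowHeatSymbol, Complex.norm_real, Real.norm_eq_abs]
    rcases (freq_nonneg ξ).eq_or_lt with h | h
    · rw [← h, Real.zero_rpow hθ.ne']
      simp only [neg_zero, Real.exp_zero, sub_self, mul_zero, abs_zero]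
      exact Set.indicator_nonneg (fun _ _ => zero_le_one) ξ
    -- A dilation factor, depending on `ξ`, that is large enough to kill the second cutoff in
    -- `lowHeat_bound`.
    · have h2 : 1 ≤ max 1 (2 / freq ξ) := le_max_left _ _
      have h3 := lowHeat_bound ζ (θ := θ) ξ h2
      have h4 : 2 ≤ max 1 (2 / freq ξ) * freq ξ := by
        calc (2 : ℝ) = 2 / freq ξ * freq ξ := by field_simp
          _ ≤ _ := by gcongr; exact le_max_right _ _
      rwa [ζ.eq_zero (by linarith : 5 / 3 ≤ max 1 (2 / freq ξ) * freq ξ), sub_zero] at h3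

theorem integrable_heatSymbol_one (ζ : Cutoff) {θ : ℝ} (hθ : 0 < θ) : Integrable (heatSymbol N θ 1) := by
  rw [funext (heatSymbol_one_eq ζ hθ)]
  exact ((lowSymbol N ζ).integrable.add (heatHighSymbol N ζ hθ one_pos).integrable).add
    (integrable_lowHeatSymbol ζ hθ)

theorem continuous_heatKernel_one (ζ : Cutoff) {θ : ℝ} (hθ : 0 < θ) : Continuous (heatKernel N θ 1) :=
  continuous_fourierInv (integrable_heatSymbol_one ζ hθ)

theorem exists_heatKernel_one_bound (N : ℕ) (ζ : Cutoff) {θ : ℝ} (hθ : 0 < θ) :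
    ∃ C, 0 ≤ C ∧ ∀ x : Sp N, ‖heatKernel N θ 1 x‖ ≤ C * (1 + ‖x‖) ^ (-(N + θ / 2 : ℝ)) := by
  obtain ⟨C₁, h₁, H₁⟩ := exists_schwartz_bound (𝓕⁻ (lowSymbol N ζ)) (N + θ / 2)
  obtain ⟨C₂, h₂, H₂⟩ := exists_schwartz_bound (𝓕⁻ (heatHighSymbol N ζ hθ one_pos)) (N + θ / 2)
  obtain ⟨C₃, h₃, H₃⟩ := exists_lowHeat_kernel_bound N ζ hθ
  refine ⟨C₁ + C₂ + C₃, by positivity, fun x => ?_⟩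
  have e₁ := fourierInv_add_apply (f := fun ξ => lowSymbol N ζ ξ + heatHighSymbol N ζ hθ one_pos ξ)
    ((lowSymbol N ζ).integrable.add (heatHighSymbol N ζ hθ one_pos).integrable)
    (integrable_lowHeatSymbol ζ hθ) x
  rw [heatKernel_eq, funext (heatSymbol_one_eq ζ hθ), e₁,
    fourierInv_add_apply (lowSymbol N ζ).integrable (heatHighSymbol N ζ hθ one_pos).integrable,
    add_mul, add_mul]
  refine (norm_add₃_le).trans (add_le_add (add_le_add ?_ ?_) (H₃ x))
  · have := H₁ x; rwa [SchwartzMap.fourierInv_coe] at this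
  · have := H₂ x; rwa [SchwartzMap.fourierInv_coe] at this

theorem heatKernel_scale {θ t : ℝ} (hθ : 0 < θ) (ht : 0 < t) (x : Sp N) :
    heatKernel N θ t x = (((t ^ (1 / θ))⁻¹ ^ N : ℝ) : ℂ) * heatKernel N θ 1 ((t ^ (1 / θ))⁻¹ • x) := by
  have hc : 0 < (t ^ (1 / θ))⁻¹ := by positivity
  have h1 : heatSymbol N θ t = fun ξ => heatSymbol N θ 1 (((t ^ (1 / θ))⁻¹)⁻¹ • ξ) := by
    funext ξ
    rw [heatSymbol, heatSymbol, inv_inv, freq_smul _ (by positivity),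
      Real.mul_rpow (by positivity) (freq_nonneg ξ), ← Real.rpow_mul ht.le,
      one_div_mul_cancel hθ.ne', Real.rpow_one]
    ring_nf
  rw [heatKernel_eq, h1, fourierInv_comp_smul _ hc, Complex.real_smul, heatKernel_eq]

end BesovMorrey
end

noncomputable section

namespace BesovMorrey

open MeasureTheory

/-! ### Integral inequalities -/

section Integral

variable {α : Type*} [MeasurableSpace α] {μ : Measure α}

/-- Hölder's inequality with a weight. -/
theorem lintegral_weight_mul_rpow_le {q : ℝ} (hq : 1 < q) {k F G : α → ℝ≥0∞} (hk : AEMeasurable k μ)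
    (hF : AEMeasurable F μ) (hG : AEMeasurable G μ) :
    (∫⁻ y, k y * (F y * G y) ∂μ) ^ q ≤
      (∫⁻ y, k y * F y ^ (q / (q - 1)) ∂μ) ^ (q - 1) * ∫⁻ y, k y * G y ^ q ∂μ := by
  have hq0 : 0 < q := by linarith
  have hq1 : 0 < q - 1 := by linarith
  have hconj : Real.HolderConjugate (q / (q - 1)) q := (Real.HolderConjugate.conjExponent hq).symm
  -- The weight is split as `k = k^{(q-1)/q} k^{1/q}` between the two factors.
  have h := ENNReal.lintegral_mul_le_Lp_mul_Lq μ hconj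
    (f := fun y => k y ^ ((q - 1) / q) * F y) (g := fun y => k y ^ (1 / q) * G y)
    ((hk.pow_const _).mul hF) ((hk.pow_const _).mul hG)
  have e1 : ∀ y, ((fun y => k y ^ ((q - 1) / q) * F y) * fun y => k y ^ (1 / q) * G y) y =
      k y * (F y * G y) := by
    intro y
    simp only [Pi.mul_apply]
    calc k y ^ ((q - 1) / q) * F y * (k y ^ (1 / q) * G y)
        = k y ^ ((q - 1) / q) * k y ^ (1 / q) * (F y * G y) := by ring
      _ = _ := by
        rw [← ENNReal.rpow_add_of_nonneg _ _ (by positivity) (by positivity)]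
        have : (q - 1) / q + 1 / q = 1 := by field_simp; ring
        rw [this, ENNReal.rpow_one]
  have e2 : ∀ y, (k y ^ ((q - 1) / q) * F y) ^ (q / (q - 1)) = k y * F y ^ (q / (q - 1)) := by
    intro y
    rw [ENNReal.mul_rpow_of_nonneg _ _ (by positivity), ← ENNReal.rpow_mul]
    have : (q - 1) / q * (q / (q - 1)) = 1 := by field_simp
    rw [this, ENNReal.rpow_one]
  have e3 : ∀ y, (k y ^ (1 / q) * G y) ^ q = k y * G y ^ q := by
    intro y
    rw [ENNReal.mul_rpow_of_nonneg _ _ hq0.le, ← ENNReal.rpow_mul, one_div_mul_cancel hq0.ne',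
      ENNReal.rpow_one]
  simp only [e1, e2, e3] at h
  calc _ ≤ ((∫⁻ y, k y * F y ^ (q / (q - 1)) ∂μ) ^ (1 / (q / (q - 1))) *
        (∫⁻ y, k y * G y ^ q ∂μ) ^ (1 / q)) ^ q := by gcongr
    _ = _ := by
        rw [ENNReal.mul_rpow_of_nonneg _ _ hq0.le, ← ENNReal.rpow_mul, ← ENNReal.rpow_mul,
          one_div_mul_cancel hq0.ne', ENNReal.rpow_one]
        congr 2
        field_simp

theorem lintegral_weight_rpow_le {q : ℝ} (hq : 1 < q) {k G : α → ℝ≥0∞} (hk : AEMeasurable k μ)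
    (hG : AEMeasurable G μ) :
    (∫⁻ y, k y * G y ∂μ) ^ q ≤ (∫⁻ y, k y ∂μ) ^ (q - 1) * ∫⁻ y, k y * G y ^ q ∂μ := by
  simpa using lintegral_weight_mul_rpow_le hq hk (F := fun _ => 1) aemeasurable_const hG

theorem setLIntegral_rpow_le {q m : ℝ} (hm : 0 < m) (hmq : m ≤ q) {F : α → ℝ≥0∞}
    (hF : AEMeasurable F μ) :
    ∫⁻ y, F y ^ m ∂μ ≤ μ Set.univ ^ (1 - m / q) * (∫⁻ y, F y ^ q ∂μ) ^ (m / q) := by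
  have hq : 0 < q := hm.trans_le hmq
  rcases hmq.eq_or_lt with rfl | hlt
  · rw [div_self hm.ne', sub_self, ENNReal.rpow_zero, one_mul, ENNReal.rpow_one]
  · have h := lintegral_weight_rpow_le (μ := μ) (q := q / m) ((one_lt_div hm).2 hlt)
      (k := fun _ => 1) aemeasurable_const (hF.pow_const m)
    simp only [one_mul, lintegral_const, ← ENNReal.rpow_mul, mul_div_cancel₀ _ hm.ne'] at h
    have h2 := ENNReal.rpow_le_rpow h (z := m / q) (by positivity)
    rw [← ENNReal.rpow_mul, ENNReal.mul_rpow_of_nonneg _ _ (by positivity), ← ENNReal.rpow_mul] at h2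
    have e1 : q / m * (m / q) = 1 := by field_simp
    have e2 : (q / m - 1) * (m / q) = 1 - m / q := by field_simp
    rwa [e1, e2, ENNReal.rpow_one] at h2

end Integral

/-! ### Morrey bounds -/

variable {N : ℕ}

/-- The local Morrey norm of the nonnegative function `F` is at most `A`. -/
def Mor (p q : ℝ) (F : Sp N → ℝ≥0∞) (A : ℝ≥0∞) : Prop :=
  ∀ (x : Sp N) (ρ : ℝ), 0 < ρ → ρ ≤ 1 →
    ∫⁻ y in Metric.ball x ρ, F y ^ q ≤ ENNReal.ofReal (ρ ^ (N - N * q / p)) * A ^ q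

theorem ofReal_rpow_mul_inv {ρ : ℝ} (hρ : 0 < ρ) (a b : ℝ) :
    ENNReal.ofReal (ρ ^ a) * ENNReal.ofReal (ρ ^ b) = ENNReal.ofReal (ρ ^ (a + b)) := by
  rw [← ENNReal.ofReal_mul (by positivity), ← Real.rpow_add hρ]

theorem ofReal_rpow_rpow {ρ : ℝ} (hρ : 0 < ρ) (a b : ℝ) :
    ENNReal.ofReal (ρ ^ a) ^ b = ENNReal.ofReal (ρ ^ (a * b)) := by
  rw [ENNReal.ofReal_rpow_of_pos (by positivity), ← Real.rpow_mul hρ.le]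

/-- Raising to the power `q` removes the roots and the supremum; the estimates that follow are made
with `Mor` for nonnegative functions. -/
theorem morreyNorm_le_iff {p q : ℝ} (hq : 0 < q) {f : Sp N → ℂ} {A : ℝ≥0∞} :
    morreyNorm p q f ≤ A ↔ Mor p q (fun y => ‖f y‖ₑ) A := by
  simp only [morreyNorm, iSup_le_iff, Mor]
  refine forall_congr' fun x => forall_congr' fun ρ => ?_
  rw [and_imp]
  refine forall_congr' fun h0 => forall_congr' fun h1 => ?_
  rw [eLpNorm_eq_lintegral_rpow_enorm_toReal (by simpa using hq) ENNReal.ofReal_ne_top, ENNReal.toReal_ofReal hq.le]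
  set I := ∫⁻ y in Metric.ball x ρ, ‖f y‖ₑ ^ q
  have e1 : (N : ℝ) / p - N / q + (N / q - N / p) = 0 := by ring
  have e2 : ((N : ℝ) / q - N / p) * q = N - N * q / p := by field_simp
  constructor
  · intro h
    have h2 : I ^ (1 / q) ≤ ENNReal.ofReal (ρ ^ (N / q - N / p : ℝ)) * A := by
      calc I ^ (1 / q) = ENNReal.ofReal (ρ ^ (N / q - N / p : ℝ)) *
            (ENNReal.ofReal (ρ ^ (N / p - N / q : ℝ)) * I ^ (1 / q)) := by
            rw [← mul_assoc, ofReal_rpow_mul_inv h0, add_comm, e1, Real.rpow_zero]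
            simp
        _ ≤ _ := by gcongr
    have h3 := ENNReal.rpow_le_rpow h2 hq.le
    rwa [← ENNReal.rpow_mul, one_div_mul_cancel hq.ne', ENNReal.rpow_one,
      ENNReal.mul_rpow_of_nonneg _ _ hq.le, ofReal_rpow_rpow h0, e2] at h3
  · intro h
    have h2 : I ^ (1 / q) ≤ ENNReal.ofReal (ρ ^ (N / q - N / p : ℝ)) * A := by
      have h3 := ENNReal.rpow_le_rpow h (z := 1 / q) (by positivity)
      rwa [ENNReal.mul_rpow_of_nonneg _ _ (by positivity), ← ENNReal.rpow_mul A,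
        mul_one_div_cancel hq.ne', ENNReal.rpow_one, ofReal_rpow_rpow h0, ← e2,
        mul_assoc, mul_one_div_cancel hq.ne', mul_one] at h3
    calc _ ≤ ENNReal.ofReal (ρ ^ (N / p - N / q : ℝ)) * (ENNReal.ofReal (ρ ^ (N / q - N / p : ℝ)) * A) := by
          gcongr
      _ = A := by
          rw [← mul_assoc, ofReal_rpow_mul_inv h0, e1, Real.rpow_zero]
          simp

theorem Mor.mono {p q : ℝ} (hq : 0 < q) {F G : Sp N → ℝ≥0∞} {A B : ℝ≥0∞} (h : Mor p q G A)
    (hFG : ∀ y, F y ≤ G y) (hAB : A ≤ B) : Mor p q F B := fun x ρ h0 h1 =>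
  (lintegral_mono fun y => ENNReal.rpow_le_rpow (hFG y) hq.le).trans
    ((h x ρ h0 h1).trans (by gcongr))

theorem Mor.const_mul {p q : ℝ} (hq : 0 < q) {F : Sp N → ℝ≥0∞} {A : ℝ≥0∞} (h : Mor p q F A)
    {c : ℝ≥0∞} (hc : c ≠ ⊤) : Mor p q (fun y => c * F y) (c * A) := fun x ρ h0 h1 => by
  simp only [ENNReal.mul_rpow_of_nonneg _ _ hq.le]
  rw [lintegral_const_mul' _ _ (by finiteness)]
  calc _ ≤ c ^ q * (ENNReal.ofReal (ρ ^ (N - N * q / p)) * A ^ q) := by gcongr; exact h x ρ h0 h1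
    _ = _ := by ring

/-- Minkowski's integral inequality for local Morrey norms. -/
theorem Mor.lintegral {p q : ℝ} (hq : 1 < q) {α : Type*} [MeasurableSpace α] {μ : Measure α}
    [SFinite μ] {G : α → Sp N → ℝ≥0∞} (hG : Measurable fun z : α × Sp N => G z.1 z.2)
    {k : α → ℝ≥0∞} (hk : Measurable k) (hk0 : ∀ᵐ τ ∂μ, k τ ≠ 0) (hkt : ∀ᵐ τ ∂μ, k τ ≠ ⊤)
    (h : ∀ᵐ τ ∂μ, Mor p q (G τ) (k τ)) :
    Mor p q (fun x => ∫⁻ τ, G τ x ∂μ) (∫⁻ τ, k τ ∂μ) := by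
  have hq0 : 0 < q := by linarith
  intro x ρ h0 h1
  have hH : Measurable fun z : α × Sp N => G z.1 z.2 / k z.1 := hG.div (hk.comp measurable_fst)
  -- Write `G = k (G / k)` and use Hölder with weight `k`: each `G τ / k τ` has norm at most one, so
  -- integrating over a ball gives `(∫ k)^{q-1} ∫ k`. The division requires `k` to be positive and
  -- finite.
  have key : ∀ y, (∫⁻ τ, G τ y ∂μ) ^ q ≤
      (∫⁻ τ, k τ ∂μ) ^ (q - 1) * ∫⁻ τ, k τ * (G τ y / k τ) ^ q ∂μ := by
    intro y
    have hmy : Measurable fun τ => G τ y / k τ := hH.comp (measurable_id.prodMk measurable_const)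
    refine le_trans (le_of_eq ?_) (lintegral_weight_rpow_le hq hk.aemeasurable hmy.aemeasurable)
    congr 1
    refine lintegral_congr_ae ?_
    filter_upwards [hk0, hkt] with τ h0 ht
    exact (ENNReal.mul_div_cancel h0 ht).symm
  have hm2 : Measurable fun z : Sp N × α => k z.2 * (G z.2 z.1 / k z.2) ^ q :=
    (hk.comp measurable_snd).mul ((hH.comp measurable_swap).pow_const q)
  calc ∫⁻ y in Metric.ball x ρ, (∫⁻ τ, G τ y ∂μ) ^ q
      ≤ ∫⁻ y in Metric.ball x ρ, (∫⁻ τ, k τ ∂μ) ^ (q - 1) *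
          ∫⁻ τ, k τ * (G τ y / k τ) ^ q ∂μ := lintegral_mono key
    _ = (∫⁻ τ, k τ ∂μ) ^ (q - 1) * ∫⁻ y in Metric.ball x ρ,
          ∫⁻ τ, k τ * (G τ y / k τ) ^ q ∂μ := lintegral_const_mul _ hm2.lintegral_prod_right'
    _ = (∫⁻ τ, k τ ∂μ) ^ (q - 1) * ∫⁻ τ, (∫⁻ y in Metric.ball x ρ,
          k τ * (G τ y / k τ) ^ q) ∂μ := by
        rw [lintegral_lintegral_swap hm2.aemeasurable]
    _ ≤ (∫⁻ τ, k τ ∂μ) ^ (q - 1) * ∫⁻ τ, k τ * ENNReal.ofReal (ρ ^ (N - N * q / p)) ∂μ := by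
        refine mul_le_mul' le_rfl (lintegral_mono_ae ?_)
        filter_upwards [hk0, hkt, h] with τ hτ0 hτt hτ
        rw [lintegral_const_mul' _ _ hτt]
        gcongr
        simp only [ENNReal.div_rpow_of_nonneg _ _ hq0.le]
        simp only [ENNReal.div_eq_inv_mul]
        have hkq : (k τ ^ q) ≠ 0 := by simp [hτ0, hτt]
        rw [lintegral_const_mul' _ _ (ENNReal.inv_ne_top.2 hkq), ← ENNReal.div_eq_inv_mul]
        exact ENNReal.div_le_of_le_mul (hτ x ρ h0 h1)
    _ = _ := by
        rw [lintegral_mul_const _ hk, ← mul_assoc, mul_comm]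
        congr 1
        conv_lhs => rw [← ENNReal.rpow_one (∫⁻ τ, k τ ∂μ), ← ENNReal.rpow_mul, one_mul]
        rw [← ENNReal.rpow_add_of_nonneg _ _ (by linarith) zero_le_one]
        congr 1
        ring

/-! ### Positive convolution operators -/

/-- The radial profile `r^{-N} (1 + |x| / r)^{-e}`. -/
def profile (N : ℕ) (e r : ℝ) (x : Sp N) : ℝ≥0∞ :=
  ENNReal.ofReal (r⁻¹ ^ N * (1 + ‖r⁻¹ • x‖) ^ (-e))

theorem continuous_profile_real (e r : ℝ) :
    Continuous fun x : Sp N => r⁻¹ ^ N * (1 + ‖r⁻¹ • x‖) ^ (-e) := by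
  have : Continuous fun x : Sp N => (1 + ‖r⁻¹ • x‖) ^ (-e) :=
    Continuous.rpow_const (by fun_prop) fun x => Or.inl (by positivity)
  fun_prop

theorem measurable_profile (e r : ℝ) : Measurable (profile N e r) :=
  (continuous_profile_real e r).measurable.ennreal_ofReal

/-- The total mass of the profile at scale one. -/
def profileMass (N : ℕ) (e : ℝ) : ℝ≥0∞ := ∫⁻ x, profile N e 1 x

theorem profileMass_lt_top {e : ℝ} (he : N < e) : profileMass N e < ⊤ := by
  have h := integrable_one_add_norm (E := Sp N) (μ := volume) (r := e) (by simpa using he)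
  have : profileMass N e = ∫⁻ x : Sp N, ENNReal.ofReal ((1 + ‖x‖) ^ (-e)) := by
    simp [profileMass, profile]
  rw [this]
  exact h.lintegral_lt_top

theorem measurable_profile_sub (e r : ℝ) (x : Sp N) : Measurable fun y => profile N e r (x - y) :=
  (measurable_profile e r).comp (measurable_const.sub measurable_id)

theorem profile_ne_top (e r : ℝ) (x : Sp N) : profile N e r x ≠ ⊤ := ENNReal.ofReal_ne_top

theorem lintegral_profile {e r : ℝ} (he : N < e) (hr : 0 < r) : ∫⁻ x, profile N e r x = profileMass N e := by
  have h := integrable_one_add_norm (E := Sp N) (μ := volume) (r := e) (by simpa using he)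
  have hnn : ∀ x : Sp N, 0 ≤ (1 + ‖x‖) ^ (-e) := fun x => by positivity
  have h1 : profileMass N e = ENNReal.ofReal (∫ x : Sp N, (1 + ‖x‖) ^ (-e)) := by
    rw [ofReal_integral_eq_lintegral_ofReal h (Filter.Eventually.of_forall hnn)]
    simp [profileMass, profile]
  have h2 : Integrable fun x : Sp N => r⁻¹ ^ N * (1 + ‖r⁻¹ • x‖) ^ (-e) :=
    (h.comp_smul (inv_ne_zero hr.ne')).const_mul _
  have h3 : ∫⁻ x, profile N e r x = ENNReal.ofReal (∫ x : Sp N, r⁻¹ ^ N * (1 + ‖r⁻¹ • x‖) ^ (-e)) := by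
    rw [ofReal_integral_eq_lintegral_ofReal h2 (Filter.Eventually.of_forall fun x => by positivity)]
    rfl
  rw [h3, h1, integral_const_mul, Measure.integral_comp_inv_smul volume (fun x : Sp N => (1 + ‖x‖) ^ (-e))]
  congr 1
  rw [finrank_euclideanSpace, Fintype.card_fin, abs_of_pos (pow_pos hr N), smul_eq_mul, ← mul_assoc,
    inv_pow, inv_mul_cancel₀ (by positivity), one_mul]

/-- Convolution with the profile at scale `r`. -/
def posOp (e r : ℝ) (F : Sp N → ℝ≥0∞) (x : Sp N) : ℝ≥0∞ := ∫⁻ y, profile N e r (x - y) * F y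

theorem posOp_mono {e r : ℝ} {F G : Sp N → ℝ≥0∞} (h : ∀ y, F y ≤ G y) (x : Sp N) :
    posOp e r F x ≤ posOp e r G x := by
  unfold posOp
  gcongr with y
  exact h y

theorem posOp_eq (e r : ℝ) (F : Sp N → ℝ≥0∞) (x : Sp N) :
    posOp e r F x = ∫⁻ w, profile N e r w * F (x - w) := by
  rw [posOp, ← lintegral_sub_left_eq_self _ x]
  simp only [sub_sub_cancel]

theorem lintegral_profile_sub {e r : ℝ} (he : N < e) (hr : 0 < r) (x : Sp N) :
    ∫⁻ y, profile N e r (x - y) = profileMass N e := by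
  rw [lintegral_sub_left_eq_self (profile N e r) x, lintegral_profile he hr]

theorem posOp_le_mul_sup {e r : ℝ} (he : N < e) (hr : 0 < r) {F : Sp N → ℝ≥0∞} {S : ℝ≥0∞}
    (hS : ∀ y, F y ≤ S) (x : Sp N) : posOp e r F x ≤ profileMass N e * S := by
  calc posOp e r F x ≤ ∫⁻ y, profile N e r (x - y) * S := by
        unfold posOp; gcongr with y; exact hS y
    _ = _ := by
        rw [lintegral_mul_const _ (measurable_profile_sub e r x), lintegral_profile_sub he hr]

theorem posOp_mul_sup {e r : ℝ} {F G : Sp N → ℝ≥0∞} {S : ℝ≥0∞} (hSt : S ≠ ⊤)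
    (hS : ∀ y, G y ≤ S) (x : Sp N) : posOp e r (fun y => F y * G y) x ≤ S * posOp e r F x := by
  unfold posOp
  rw [← lintegral_const_mul' _ _ hSt]
  refine lintegral_mono fun y => ?_
  calc profile N e r (x - y) * (F y * G y) ≤ profile N e r (x - y) * (F y * S) := by gcongr; exact hS y
    _ = _ := by ring

theorem measurable_posOp (e r : ℝ) {F : Sp N → ℝ≥0∞} (hF : Measurable F) : Measurable (posOp e r F) := by
  have : Measurable fun z : Sp N × Sp N => profile N e r (z.1 - z.2) * F z.2 :=
    ((measurable_profile e r).comp (measurable_fst.sub measurable_snd)).mul (hF.comp measurable_snd)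
  exact this.lintegral_prod_right'

theorem setLIntegral_sub_ball (F : Sp N → ℝ≥0∞) (z w : Sp N) (ρ : ℝ) :
    ∫⁻ x in Metric.ball z ρ, F (x - w) = ∫⁻ x in Metric.ball (z - w) ρ, F x := by
  rw [← lintegral_indicator Metric.isOpen_ball.measurableSet, ← lintegral_indicator Metric.isOpen_ball.measurableSet,
    ← lintegral_sub_right_eq_self (Set.indicator (Metric.ball (z - w) ρ) F) w]
  refine lintegral_congr fun x => ?_
  by_cases h : x ∈ Metric.ball z ρ
  · rw [Set.indicator_of_mem h, Set.indicator_of_mem]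
    simpa [dist_eq_norm] using h
  · rw [Set.indicator_of_notMem h, Set.indicator_of_notMem]
    simpa [dist_eq_norm] using h

/-- The convolution is a superposition of translates, and the family of balls of radius `ρ` is
translation invariant. The bound does not depend on how `r` compares with `ρ`. -/
theorem setLIntegral_posOp_le {e r ρ : ℝ} (he : N < e) (hr : 0 < r) {F : Sp N → ℝ≥0∞} (hF : Measurable F)
    {S : ℝ≥0∞} (hS : ∀ z, ∫⁻ y in Metric.ball z ρ, F y ≤ S) (z : Sp N) :
    ∫⁻ x in Metric.ball z ρ, posOp e r F x ≤ profileMass N e * S := by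
  have hm : Measurable fun a : Sp N × Sp N => profile N e r a.2 * F (a.1 - a.2) :=
    ((measurable_profile e r).comp measurable_snd).mul (hF.comp (measurable_fst.sub measurable_snd))
  simp only [posOp_eq]
  rw [lintegral_lintegral_swap hm.aemeasurable]
  calc ∫⁻ w, ∫⁻ x in Metric.ball z ρ, profile N e r w * F (x - w)
      ≤ ∫⁻ w, profile N e r w * S := by
        refine lintegral_mono fun w => ?_
        rw [lintegral_const_mul' _ _ (profile_ne_top e r w), setLIntegral_sub_ball]
        exact mul_le_mul' le_rfl (hS _)
    _ = _ := by rw [lintegral_mul_const _ (measurable_profile e r), lintegral_profile he hr]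

/-- The weighted `L^q` mean appears here because it is the factor that Hölder's inequality leaves in
the product estimate `exists_posOp_mul_le`. -/
theorem Mor.posOp_rpow {p q e r : ℝ} (hq : 0 < q) (he : N < e) (hr : 0 < r) {F : Sp N → ℝ≥0∞}
    (hF : Measurable F) {A : ℝ≥0∞} (h : Mor p q F A) :
    Mor p q (fun x => posOp e r (fun y => F y ^ q) x ^ (1 / q)) (profileMass N e ^ (1 / q) * A) := by
  intro x ρ h0 h1
  simp only [← ENNReal.rpow_mul, one_div_mul_cancel hq.ne', ENNReal.rpow_one,
    ENNReal.mul_rpow_of_nonneg _ _ hq.le]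
  refine (setLIntegral_posOp_le he hr (hF.pow_const q) (fun z => h z ρ h0 h1) x).trans (le_of_eq ?_)
  ring

theorem Mor.posOp {p q e r : ℝ} (hq : 1 < q) (he : N < e) (hr : 0 < r) {F : Sp N → ℝ≥0∞}
    (hF : Measurable F) {A : ℝ≥0∞} (h : Mor p q F A) :
    Mor p q (posOp e r F) (profileMass N e * A) := by
  have hq0 : 0 < q := by linarith
  have h1 := (h.posOp_rpow hq0 he hr hF).const_mul hq0 (c := profileMass N e ^ ((q - 1) / q))
    (ENNReal.rpow_ne_top_of_nonneg (div_nonneg (by linarith) hq0.le) (profileMass_lt_top he).ne)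
  refine h1.mono hq0 (fun x => ?_) (le_of_eq ?_)
  · have h2 := lintegral_weight_rpow_le (μ := volume) hq (k := fun y => profile N e r (x - y)) (G := F)
      (measurable_profile_sub e r x).aemeasurable hF.aemeasurable
    rw [lintegral_profile_sub he hr] at h2
    have h3 := ENNReal.rpow_le_rpow h2 (z := 1 / q) (by positivity)
    rwa [← ENNReal.rpow_mul, mul_one_div_cancel hq0.ne', ENNReal.rpow_one,
      ENNReal.mul_rpow_of_nonneg _ _ (by positivity), ← ENNReal.rpow_mul, mul_one_div] at h3
  · rw [← mul_assoc, ← ENNReal.rpow_add_of_nonneg _ _ (div_nonneg (by linarith) hq0.le) (by positivity)]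
    have : (q - 1) / q + 1 / q = 1 := by field_simp; ring
    rw [this, ENNReal.rpow_one]

theorem volume_ball_eq (z : Sp N) {r : ℝ} (hr : 0 < r) :
    volume (Metric.ball z r) = ENNReal.ofReal (r ^ N) * volume (Metric.ball (0 : Sp N) 1) := by
  have := Measure.addHaar_ball_of_pos (volume : Measure (Sp N)) z hr
  rwa [finrank_euclideanSpace, Fintype.card_fin] at this

theorem profile_le_of_dist {e r : ℝ} (he : 0 ≤ e) (hr : 0 < r) {x y : Sp N} (h : ‖x - y‖ ≤ r) :
    profile N e r x ≤ ENNReal.ofReal (2 ^ e) * profile N e r y := by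
  rw [profile, profile, ← ENNReal.ofReal_mul (by positivity)]
  refine ENNReal.ofReal_le_ofReal ?_
  have h1 : ‖r⁻¹ • y‖ ≤ 1 + ‖r⁻¹ • x‖ := by
    have h2 : ‖r⁻¹ • y‖ ≤ ‖r⁻¹ • (y - x)‖ + ‖r⁻¹ • x‖ := by
      refine le_trans (le_of_eq ?_) (norm_add_le _ _)
      rw [← smul_add, sub_add_cancel]
    have h3 : ‖r⁻¹ • (y - x)‖ ≤ 1 := by
      rw [norm_smul, Real.norm_of_nonneg (by positivity), norm_sub_rev, inv_mul_le_iff₀ hr]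
      linarith
    linarith
  have h4 : (1 + ‖r⁻¹ • x‖) ^ (-e) ≤ 2 ^ e * (1 + ‖r⁻¹ • y‖) ^ (-e) := by
    rw [show (2 : ℝ) ^ e = (2⁻¹ : ℝ) ^ (-e) by rw [Real.rpow_neg (by norm_num), Real.inv_rpow (by norm_num), inv_inv],
      ← Real.mul_rpow (by norm_num) (by positivity)]
    apply Real.rpow_le_rpow_of_nonpos (by positivity)
    · linarith [norm_nonneg (r⁻¹ • x)]
    · linarith
  calc r⁻¹ ^ N * (1 + ‖r⁻¹ • x‖) ^ (-e) ≤ r⁻¹ ^ N * (2 ^ e * (1 + ‖r⁻¹ • y‖) ^ (-e)) := by gcongr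
    _ = _ := by ring

/-- The value of the positive operator at scale `r` is controlled by the means over balls of
radius `r`. -/
theorem posOp_le_of_ball {e r : ℝ} (he : N < e) (hr : 0 < r) {F : Sp N → ℝ≥0∞} (hF : Measurable F)
    {S : ℝ≥0∞} (hS : ∀ z, ∫⁻ y in Metric.ball z r, F y ≤ S) (x : Sp N) :
    posOp e r F x ≤ ENNReal.ofReal (2 ^ e) * profileMass N e * (volume (Metric.ball (0 : Sp N) r))⁻¹ * S := by
  have he0 : 0 ≤ e := (Nat.cast_nonneg N).trans he.le
  set V := volume (Metric.ball (0 : Sp N) r)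
  have hV0 : V ≠ 0 := (Metric.measure_ball_pos volume _ hr).ne'
  have hVt : V ≠ ⊤ := measure_ball_lt_top.ne
  have hVz : ∀ z : Sp N, volume (Metric.ball z r) = V := fun z => Measure.addHaar_ball_center _ _ _
  let B : Set (Sp N × Sp N) := {a | dist a.1 a.2 < r}
  have hB : MeasurableSet B := measurableSet_lt measurable_dist measurable_const
  let Φ : Sp N × Sp N → ℝ≥0∞ := Set.indicator B
      (fun a => ENNReal.ofReal (2 ^ e) * V⁻¹ * profile N e r (x - a.2) * F a.1)
  -- The profile at scale `r` is essentially constant on balls of radius `r`, so its value at `y`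
  -- may be replaced by its mean over the ball about `y`. Exchanging the integrals then leaves
  -- integrals of `F` over balls of radius `r`.
  have h1 : ∀ y, profile N e r (x - y) * F y ≤ ∫⁻ z, Φ (y, z) := by
    intro y
    have e1 : ∀ z, Φ (y, z) =
      Set.indicator (Metric.ball y r)
        (fun z => ENNReal.ofReal (2 ^ e) * V⁻¹ * profile N e r (x - z) * F y) z := by
      intro z
      simp only [Φ]
      by_cases h : dist y z < r
      · rw [Set.indicator_of_mem (show (y, z) ∈ B from h), Set.indicator_of_mem]
        rwa [Metric.mem_ball, dist_comm]
      · rw [Set.indicator_of_notMem (show (y, z) ∉ B from h), Set.indicator_of_notMem]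
        rwa [Metric.mem_ball, dist_comm]
    simp only [e1]
    rw [lintegral_indicator Metric.isOpen_ball.measurableSet]
    calc profile N e r (x - y) * F y = ∫⁻ z in Metric.ball y r, V⁻¹ * (profile N e r (x - y) * F y) := by
          rw [setLIntegral_const, hVz, mul_right_comm, ENNReal.inv_mul_cancel hV0 hVt, one_mul]
      _ ≤ _ := by
          refine setLIntegral_mono' Metric.isOpen_ball.measurableSet fun z hz => ?_
          have := profile_le_of_dist he0 hr (x := x - y) (y := x - z) (by
            rw [sub_sub_sub_cancel_left, ← dist_eq_norm]; exact (Metric.mem_ball.1 hz).le)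
          calc V⁻¹ * (profile N e r (x - y) * F y)
              ≤ V⁻¹ * (ENNReal.ofReal (2 ^ e) * profile N e r (x - z) * F y) := by gcongr
            _ = _ := by ring
  have hm : Measurable Φ :=
    ((((measurable_profile e r).comp (measurable_const.sub measurable_snd)).const_mul _).mul
      (hF.comp measurable_fst)).indicator hB
  calc posOp e r F x ≤ ∫⁻ y, ∫⁻ z, Φ (y, z) :=
        lintegral_mono h1
    _ = ∫⁻ z, ∫⁻ y, Φ (y, z) :=
        lintegral_lintegral_swap hm.aemeasurable
    _ ≤ ∫⁻ z, ENNReal.ofReal (2 ^ e) * V⁻¹ * profile N e r (x - z) * S := by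
        gcongr with z
        have e2 : ∀ y, Φ (y, z) =
          Set.indicator (Metric.ball z r)
            (fun y => ENNReal.ofReal (2 ^ e) * V⁻¹ * profile N e r (x - z) * F y) y := by
          intro y
          simp only [Φ]
          by_cases h : dist y z < r
          · rw [Set.indicator_of_mem (show (y, z) ∈ B from h), Set.indicator_of_mem]
            rwa [Metric.mem_ball]
          · rw [Set.indicator_of_notMem (show (y, z) ∉ B from h), Set.indicator_of_notMem]
            rwa [Metric.mem_ball]
        simp only [e2]
        rw [lintegral_indicator Metric.isOpen_ball.measurableSet, lintegral_const_mul _ hF]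
        gcongr
        exact hS z
    _ = _ := by
        rw [lintegral_mul_const _ ((measurable_profile_sub e r x).const_mul _),
          lintegral_const_mul _ (measurable_profile_sub e r x),
          lintegral_profile_sub he hr]
        ring

/-- Smoothing: powers of functions in a local Morrey space become bounded. -/
theorem exists_posOp_rpow_le {p q e m : ℝ} (hm : 0 < m) (hmq : m ≤ q) (he : N < e) :
    ∃ C : ℝ, 0 < C ∧ ∀ (r : ℝ), 0 < r → r ≤ 1 → ∀ (F : Sp N → ℝ≥0∞), Measurable F → ∀ A : ℝ≥0∞, Mor p q F A →
      ∀ x, posOp e r (fun y => F y ^ m) x ≤ ENNReal.ofReal (C * r ^ (-(N * m / p))) * A ^ m := by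
  have hq : 0 < q := hm.trans_le hmq
  set v := volume (Metric.ball (0 : Sp N) 1)
  have hv0 : v ≠ 0 := (Metric.measure_ball_pos volume _ one_pos).ne'
  have hvt : v ≠ ⊤ := measure_ball_lt_top.ne
  let C' : ℝ≥0∞ := ENNReal.ofReal (2 ^ e) * profileMass N e * v⁻¹ * v ^ (1 - m / q)
  have h1q : 0 ≤ 1 - m / q := by
    rw [sub_nonneg, div_le_one hq]; exact hmq
  have hC't : C' ≠ ⊤ := ENNReal.mul_ne_top (ENNReal.mul_ne_top (ENNReal.mul_ne_top ENNReal.ofReal_ne_top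
    (profileMass_lt_top he).ne) (ENNReal.inv_ne_top.2 hv0)) (ENNReal.rpow_ne_top_of_nonneg h1q hvt)
  refine ⟨C'.toReal + 1, by positivity, fun r hr hr1 F hF A hA x => ?_⟩
  -- Hölder from exponent `m` to `q` on one ball. Together with the Morrey bound it gives `r^{N -
  -- Nm/p}`; dividing by the volume leaves the loss `r^{-Nm/p}`.
  have hS : ∀ z, ∫⁻ y in Metric.ball z r, F y ^ m ≤
      v ^ (1 - m / q) * ENNReal.ofReal (r ^ (N - N * m / p)) * A ^ m := by
    intro z
    refine (setLIntegral_rpow_le hm hmq hF.aemeasurable).trans ?_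
    rw [Measure.restrict_apply_univ, volume_ball_eq z hr]
    calc (ENNReal.ofReal (r ^ N) * v) ^ (1 - m / q) * (∫⁻ y in Metric.ball z r, F y ^ q) ^ (m / q)
        ≤ (ENNReal.ofReal (r ^ N) * v) ^ (1 - m / q) *
          (ENNReal.ofReal (r ^ (N - N * q / p)) * A ^ q) ^ (m / q) := by
          gcongr
          exact hA z r hr hr1
      _ = v ^ (1 - m / q) * ENNReal.ofReal (r ^ (N - N * m / p)) * A ^ m := by
          rw [ENNReal.mul_rpow_of_nonneg _ _ h1q, ENNReal.mul_rpow_of_nonneg _ _ (by positivity),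
            ← Real.rpow_natCast r N, ofReal_rpow_rpow hr, ofReal_rpow_rpow hr, ← ENNReal.rpow_mul A]
          have e1 : q * (m / q) = m := by field_simp
          have e2 : (N : ℝ) * (1 - m / q) + (N - N * q / p) * (m / q) = N - N * m / p := by
            field_simp
            ring
          rw [e1, ← e2, ← ofReal_rpow_mul_inv hr]
          ring
  refine (posOp_le_of_ball he hr (hF.pow_const m) hS x).trans ?_
  rw [volume_ball_eq 0 hr, ENNReal.mul_inv (Or.inr hvt) (Or.inr hv0)]
  have e3 : (ENNReal.ofReal (r ^ N))⁻¹ = ENNReal.ofReal (r ^ (-N : ℝ)) := by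
    rw [← ENNReal.ofReal_inv_of_pos (by positivity), Real.rpow_neg hr.le, Real.rpow_natCast]
  rw [e3]
  calc _ = C' * (ENNReal.ofReal (r ^ (-N : ℝ)) * ENNReal.ofReal (r ^ (N - N * m / p))) * A ^ m := by
        simp only [C']; ring
    _ = C' * ENNReal.ofReal (r ^ (-(N * m / p))) * A ^ m := by
        rw [ofReal_rpow_mul_inv hr]
        congr 4
        ring
    _ ≤ ENNReal.ofReal (C'.toReal + 1) * ENNReal.ofReal (r ^ (-(N * m / p))) * A ^ m := by
        gcongr
        rw [ENNReal.le_ofReal_iff_toReal_le hC't (by positivity)]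
        linarith
    _ = _ := by rw [← ENNReal.ofReal_mul (by positivity)]

end BesovMorrey
end

noncomputable section

namespace BesovMorrey

open MeasureTheory

variable {N : ℕ}

/-! ### Kernel bounds -/

theorem enorm_conv_le {e r : ℝ} {c : ℝ≥0∞} (hc : c ≠ ⊤) {k : Sp N → ℂ}
    (hk : ∀ x, ‖k x‖ₑ ≤ c * profile N e r x) (f : Sp N → ℂ) (x : Sp N) :
    ‖∫ y, k (x - y) * f y‖ₑ ≤ c * posOp e r (fun y => ‖f y‖ₑ) x := by
  refine (enorm_integral_le_lintegral_enorm _).trans ?_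
  rw [posOp, ← lintegral_const_mul' _ _ hc]
  refine lintegral_mono fun y => ?_
  rw [enorm_mul, ← mul_assoc]
  exact mul_le_mul' (hk _) le_rfl

theorem exists_heatKernel_le (N : ℕ) (ζ : Cutoff) {θ : ℝ} (hθ : 0 < θ) :
    ∃ C : ℝ, 0 ≤ C ∧ ∀ t, 0 < t → ∀ x : Sp N, ‖heatKernel N θ t x‖ₑ ≤
      ENNReal.ofReal C * profile N (N + θ / 2) (t ^ (1 / θ)) x := by
  obtain ⟨C, hC, h⟩ := exists_heatKernel_one_bound N ζ hθ
  refine ⟨C, hC, fun t ht x => ?_⟩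
  rw [heatKernel_scale hθ ht, profile, ← ENNReal.ofReal_mul hC, ← ofReal_norm]
  refine ENNReal.ofReal_le_ofReal ?_
  rw [norm_mul, Complex.norm_real, Real.norm_of_nonneg (by positivity), mul_left_comm]
  gcongr
  exact h _

theorem exists_semigroupFun_le (N : ℕ) (ζ : Cutoff) {θ : ℝ} (hθ : 0 < θ) :
    ∃ C : ℝ, 0 ≤ C ∧ ∀ t, 0 < t → ∀ (f : Sp N → ℂ) (x : Sp N), ‖semigroupFun θ t f x‖ₑ ≤
      ENNReal.ofReal C * posOp (N + θ / 2) (t ^ (1 / θ)) (fun y => ‖f y‖ₑ) x := by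
  obtain ⟨C, hC, h⟩ := exists_heatKernel_le N ζ hθ
  exact ⟨C, hC, fun t ht f x => enorm_conv_le ENNReal.ofReal_ne_top (h t ht) f x⟩

theorem integrable_heatKernel_one (ζ : Cutoff) {θ : ℝ} (hθ : 0 < θ) :
    Integrable (heatKernel N θ 1) := by
  obtain ⟨C, -, h⟩ := exists_heatKernel_one_bound N ζ hθ
  have hi := integrable_one_add_norm (E := Sp N) (μ := volume) (r := N + θ / 2) (by simp; linarith)
  exact (hi.const_mul C).mono' (continuous_heatKernel_one ζ hθ).aestronglyMeasurable
    (Filter.Eventually.of_forall h)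

/-- After this substitution the kernel no longer depends on `t`, and its time-one version serves as
a dominating function for limits in all parameters. -/
theorem semigroupFun_eq {θ t : ℝ} (hθ : 0 < θ) (ht : 0 < t) (g : Sp N → ℂ) (x : Sp N) :
    semigroupFun θ t g x = ∫ z, heatKernel N θ 1 z * g (x - t ^ (1 / θ) • z) := by
  set r := t ^ (1 / θ) with hr
  have hr0 : 0 < r := by positivity
  have h1 : semigroupFun θ t g x = ∫ w, heatKernel N θ t w * g (x - w) := by
    rw [semigroupFun, ← integral_sub_left_eq_self _ _ x]
    simp only [sub_sub_cancel]
  have h2 := Measure.integral_comp_inv_smul (volume : Measure (Sp N))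
    (fun z => heatKernel N θ 1 z * g (x - r • z)) r
  rw [finrank_euclideanSpace, Fintype.card_fin, abs_of_pos (pow_pos hr0 N)] at h2
  rw [h1]
  simp only [heatKernel_scale hθ ht, ← hr, mul_assoc]
  rw [integral_const_mul]
  have h3 : ∀ w : Sp N, r • r⁻¹ • w = w := fun w => smul_inv_smul₀ hr0.ne' w
  simp only [h3] at h2
  rw [h2, Complex.real_smul, ← mul_assoc, ← Complex.ofReal_mul, inv_pow,
    inv_mul_cancel₀ (by positivity), Complex.ofReal_one, one_mul]

/-- Convolution of a bounded continuous family with the heat kernels is continuous in all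
parameters. -/
theorem continuousOn_semigroupFun (ζ : Cutoff) {θ : ℝ} (hθ : 0 < θ) {X : Type*} [TopologicalSpace X]
    [FirstCountableTopology X] {s : Set X} {σ : X → ℝ} {ξ : X → Sp N} {g : X → Sp N → ℂ} {C : ℝ}
    (hσ : ContinuousOn σ s) (hσ0 : ∀ a ∈ s, 0 < σ a) (hξ : ContinuousOn ξ s)
    (hg : ContinuousOn (fun z : X × Sp N => g z.1 z.2) (s ×ˢ Set.univ))
    (hC : ∀ a ∈ s, ∀ y, ‖g a y‖ ≤ C) :
    ContinuousOn (fun a => semigroupFun θ (σ a) (g a) (ξ a)) s := by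
  have hK := integrable_heatKernel_one (N := N) ζ hθ
  have h1 : ∀ a ∈ s, semigroupFun θ (σ a) (g a) (ξ a) =
      ∫ z, heatKernel N θ 1 z * g a (ξ a - σ a ^ (1 / θ) • z) := fun a ha =>
    semigroupFun_eq hθ (hσ0 a ha) _ _
  refine ContinuousOn.congr ?_ h1
  refine continuousOn_of_dominated (bound := fun z => ‖heatKernel N θ 1 z‖ * C) ?_ ?_
    (hK.norm.mul_const C) ?_
  · intro a ha
    have hga : Continuous (g a) := by
      rw [← continuousOn_univ]
      exact hg.comp (by fun_prop : ContinuousOn (fun y : Sp N => (a, y)) Set.univ)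
        fun y _ => ⟨ha, trivial⟩
    exact ((continuous_heatKernel_one ζ hθ).mul (hga.comp (by fun_prop))).aestronglyMeasurable
  · intro a ha
    refine Filter.Eventually.of_forall fun z => ?_
    rw [norm_mul]
    gcongr
    exact hC a ha _
  · refine Filter.Eventually.of_forall fun z => continuousOn_const.mul ?_
    have h2 : ContinuousOn (fun a => (a, ξ a - σ a ^ (1 / θ) • z)) s :=
      continuousOn_id.prodMk (hξ.sub
        ((hσ.rpow_const fun a ha => Or.inl (hσ0 a ha).ne').smul continuousOn_const))
    exact hg.comp h2 fun a ha => ⟨ha, trivial⟩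

/-! ### Dyadic pieces of the semigroup -/

/-- The kernel of `S(t)` localized to frequencies of size about `2^j`. -/
def dyadicKernel (N : ℕ) (ζ : Cutoff) (θ : ℝ) (j : ℕ) (t : ℝ) (x : Sp N) : ℂ :=
  (((2 : ℝ) ^ j) ^ N : ℝ) •
    𝓕⁻ (radial N (stepExp (t * ((2 : ℝ) ^ j) ^ θ) (θ / 2) (annulus ζ (1 / 2) 4) 0)) ((2 : ℝ) ^ j • x)

/-- The part of `S(t)u` of frequencies of size about `2^j`. -/
def dyadicPart (ζ : Cutoff) (θ : ℝ) (u : 𝓢'(Sp N, ℂ)) (j : ℕ) (t : ℝ) (x : Sp N) : ℂ :=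
  ∫ y, dyadicKernel N ζ θ j t (x - y) * multiplier (dyadicSymbol N ζ j) u y

theorem isBump_annulus_half_four (ζ : Cutoff) : IsBump (annulus ζ (1 / 2) 4) :=
  isBump_annulus ζ (by norm_num) (by norm_num)

/-- Rescaling frequency `2^j` to one changes the time into `λ = t 2^{jθ}`. On an annulus away from
zero the exponential decays faster than any power of `λ`, and its derivatives do as well. -/
theorem exists_dyadicKernel_le (N : ℕ) (ζ : Cutoff) {θ : ℝ} (hθ : 0 < θ) (k : ℕ) :
    ∃ C : ℝ, 0 ≤ C ∧ ∀ (j : ℕ) (t : ℝ), 0 < t → ∀ x : Sp N, ‖dyadicKernel N ζ θ j t x‖ₑ ≤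
      ENNReal.ofReal (C * min 1 ((t * ((2 : ℝ) ^ j) ^ θ) ^ k)⁻¹) *
        profile N (N + θ / 2) ((2 : ℝ) ^ j)⁻¹ x := by
  obtain ⟨C₁, h₁, H₁⟩ := (isBump_annulus_half_four ζ).exists_kernel_exp_bound (N := N)
    (half_pos hθ) (N + θ / 2) 0
  obtain ⟨C₂, h₂, H₂⟩ := (isBump_annulus_half_four ζ).exists_kernel_exp_bound (N := N)
    (half_pos hθ) (N + θ / 2) k
  refine ⟨max C₁ C₂, h₁.trans (le_max_left _ _), fun j t ht x => ?_⟩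
  have hlam : 0 < t * ((2 : ℝ) ^ j) ^ θ := by positivity
  set lam := t * ((2 : ℝ) ^ j) ^ θ
  have e₁ := H₁ lam hlam.le ((2 : ℝ) ^ j • x)
  have e₂ := H₂ lam hlam.le ((2 : ℝ) ^ j • x)
  rw [pow_zero, one_mul] at e₁
  rw [profile, ← ENNReal.ofReal_mul (mul_nonneg (h₁.trans (le_max_left _ _)) (by positivity)), ← ofReal_norm]
  refine ENNReal.ofReal_le_ofReal ?_
  rw [dyadicKernel, norm_smul, Real.norm_of_nonneg (by positivity), inv_inv, mul_left_comm]
  refine mul_le_mul_of_nonneg_left ?_ (by positivity)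
  rw [mul_min_of_nonneg _ _ (h₁.trans (le_max_left _ _)), min_mul_of_nonneg _ _ (by positivity)]
  refine le_min ?_ ?_
  · rw [mul_one]
    refine e₁.trans ?_
    gcongr
    exact le_max_left _ _
  · rw [mul_assoc, mul_left_comm, ← div_eq_inv_mul, le_div_iff₀ (by positivity), mul_comm]
    refine e₂.trans ?_
    gcongr
    exact le_max_right _ _

theorem continuousOn_dyadicKernel (ζ : Cutoff) {θ : ℝ} (j : ℕ) (x : Sp N) :
    ContinuousOn (fun t => dyadicKernel N ζ θ j t x) (Set.Ioi 0) := by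
  have h1 : ContinuousOn (fun t : ℝ => t * ((2 : ℝ) ^ j) ^ θ) (Set.Ioi 0) := by fun_prop
  refine ContinuousOn.const_smul (M := ℝ) (((isBump_annulus_half_four ζ).continuousOn_kernel_exp (θ / 2)
    ((2 : ℝ) ^ j • x)).comp h1 fun t ht => ?_) _
  have ht : 0 < t := ht
  exact Set.mem_Ici.2 (by positivity)

theorem sq_rpow_half {f : ℝ} (hf : 0 ≤ f) (θ : ℝ) : (f ^ 2) ^ (θ / 2) = f ^ θ := by
  rw [← Real.rpow_natCast, ← Real.rpow_mul hf]
  congr 1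
  push_cast
  ring

/-- The wider annulus in `dyadicKernel` equals one on the support of the dyadic symbol. So the block
symbol is a product of two Schwartz symbols, and `multiplier_mul` expresses the block by a
convolution with a smooth kernel. -/
theorem exists_symbol_dyadicPart (ζ : Cutoff) (θ : ℝ) {t : ℝ} (ht : 0 < t) (j : ℕ) :
    ∃ m : 𝓢(Sp N, ℂ), (∀ ξ, m ξ = dyadicSymbol N ζ j ξ * heatSymbol N θ t ξ) ∧
      ∀ u x, multiplier m u x = dyadicPart ζ θ u j t x := by
  set c : ℝ := (2 : ℝ) ^ j with hc
  have hc0 : 0 < c := by positivity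
  have hc2 : (2 : ℝ) ^ (-(j : ℤ)) = c⁻¹ := by rw [zpow_neg, zpow_natCast]
  have hc3 : (2 : ℝ) ^ (1 - (j : ℤ)) = 2 * c⁻¹ := by
    rw [zpow_sub₀ (by norm_num), zpow_one, zpow_natCast, div_eq_mul_inv]
  have hb₁ := isBump_annulus ζ (α := c⁻¹) (β := 2 * c⁻¹) (by positivity) (by
    have : 0 < c⁻¹ := by positivity
    linarith)
  have hb₂ := isBump_annulus ζ (α := 1 / 2 * c⁻¹) (β := 4 * c⁻¹) (by positivity) (by
    have : 0 < c⁻¹ := by positivity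
    linarith)
  have hd : ∀ ξ : Sp N, dyadicSymbol N ζ j ξ =
      ((ζ (c⁻¹ * freq ξ) - ζ (2 * c⁻¹ * freq ξ) : ℝ) : ℂ) := by
    intro ξ; rw [dyadicSymbol_apply, hc2, hc3]
  have hm₁ : ∀ ξ, (hb₁.stepExp t (θ / 2) 0).symbol N ξ =
      dyadicSymbol N ζ j ξ * heatSymbol N θ t ξ := by
    intro ξ
    rw [IsBump.symbol_apply, radial, stepExp, Real.rpow_zero, one_mul, sq_rpow_half (freq_nonneg ξ),
      annulus_sq ζ (by positivity) (by positivity) (freq_nonneg ξ), hd, heatSymbol, Complex.ofReal_mul]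
  have hm₂ : ∀ ξ, (hb₂.stepExp t (θ / 2) 0).symbol N ξ =
      radial N (stepExp (t * c ^ θ) (θ / 2) (annulus ζ (1 / 2) 4) 0) (c⁻¹ • ξ) := by
    intro ξ
    rw [IsBump.symbol_apply, radial, radial, freq_smul _ (by positivity), stepExp, stepExp,
      annulus_sq ζ (by positivity) (by positivity) (freq_nonneg ξ),
      annulus_sq ζ (by positivity) (by positivity) (mul_nonneg (by positivity) (freq_nonneg ξ)),
      sq_rpow_half (freq_nonneg ξ), sq_rpow_half (mul_nonneg (by positivity) (freq_nonneg ξ)),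
      Real.mul_rpow (by positivity) (freq_nonneg ξ), Real.inv_rpow hc0.le, mul_assoc, mul_assoc,
      Real.rpow_zero, Real.rpow_zero]
    have : -(t * c ^ θ) * ((c ^ θ)⁻¹ * freq ξ ^ θ) = -t * freq ξ ^ θ := by field_simp
    rw [this]
  refine ⟨(hb₁.stepExp t (θ / 2) 0).symbol N, hm₁, fun u x => ?_⟩
  have hprod : ∀ ξ, (hb₁.stepExp t (θ / 2) 0).symbol N ξ =
      (hb₂.stepExp t (θ / 2) 0).symbol N ξ * dyadicSymbol N ζ j ξ := by
    intro ξ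
    rw [hm₁, hd, IsBump.symbol_apply, radial, stepExp, Real.rpow_zero, one_mul, sq_rpow_half (freq_nonneg ξ),
      annulus_sq ζ (by positivity) (by positivity) (freq_nonneg ξ), heatSymbol, ← Complex.ofReal_mul,
      ← Complex.ofReal_mul]
    congr 1
    have hf : 0 ≤ c⁻¹ * freq ξ := mul_nonneg (by positivity) (freq_nonneg ξ)
    -- With `f = c⁻¹ freq ξ`, the dyadic symbol vanishes for `f ≤ 3/4` and for `f ≥ 5/3`; in between
    -- `f/2 ≤ 3/2` and `4f ≥ 5/3`, so that the wide annulus is one.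
    rcases le_or_gt (2 * (c⁻¹ * freq ξ)) (3 / 2) with h | h
    · rw [mul_assoc 2, ζ.eq_one _ (by positivity) h, ζ.eq_one _ hf (by linarith)]
      ring
    · rcases le_or_gt (5 / 3) (c⁻¹ * freq ξ) with h' | h'
      · rw [mul_assoc 2, ζ.eq_zero h', ζ.eq_zero (by linarith : 5 / 3 ≤ 2 * (c⁻¹ * freq ξ))]
        ring
      · rw [mul_assoc (1 / 2), mul_assoc 4, ζ.eq_one (1 / 2 * (c⁻¹ * freq ξ)) (by positivity) (by linarith),
          ζ.eq_zero (by linarith : 5 / 3 ≤ 4 * (c⁻¹ * freq ξ))]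
        ring
  rw [multiplier_mul hprod, dyadicPart]
  refine integral_congr_ae (Filter.Eventually.of_forall fun y => ?_)
  simp only
  congr 1
  rw [IsBump.fourierInv_symbol, dyadicKernel, ← hc, ← fourierInv_comp_smul _ hc0]
  refine congrArg (fun M : Sp N → ℂ => (𝓕⁻ M) (x - y)) (funext fun ξ => ?_)
  rw [← hm₂, IsBump.symbol_apply]

theorem dilate_mul_dilate (ζ : Cutoff) {k l : ℤ} (h : l < k) (ξ : Sp N) :
    dilate N ζ k ξ * dilate N ζ l ξ = dilate N ζ l ξ := by
  rw [dilate_apply, dilate_apply]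
  have hl : (0 : ℝ) < 2 ^ (-l) := by positivity
  have hk : (2 : ℝ) ^ (-k) ≤ 2 ^ (-l) / 2 := by
    rw [div_eq_mul_inv, ← zpow_neg_one, ← zpow_add₀ (by norm_num)]
    exact zpow_le_zpow_right₀ (by norm_num) (by omega)
  have hf := freq_nonneg ξ
  rcases le_or_gt (5 / 3) ((2 : ℝ) ^ (-l) * freq ξ) with h | h
  · rw [ζ.eq_zero h]; simp
  · rw [ζ.eq_one _ (mul_nonneg (by positivity) hf), Complex.ofReal_one, one_mul]
    calc (2 : ℝ) ^ (-k) * freq ξ ≤ 2 ^ (-l) / 2 * freq ξ := by gcongr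
      _ ≤ 3 / 2 := by linarith

/-- The symbols telescope to the truncation of the high frequency symbol at `2^J`, which converges
in the Schwartz topology. That topology is what makes the limit legitimate for an arbitrary tempered
distribution. -/
theorem tendsto_sum_dyadicPart (ζ : Cutoff) {θ t : ℝ} (hθ : 0 < θ) (ht : 0 < t) (u : 𝓢'(Sp N, ℂ))
    (x : Sp N) : Filter.Tendsto (fun J => ∑ j ∈ Finset.range J, dyadicPart ζ θ u (j + 1) t x)
      Filter.atTop (nhds (multiplier (heatHighSymbol N ζ hθ ht) u x)) := by
  choose m hm hmu using fun j => exists_symbol_dyadicPart (N := N) ζ θ ht j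
  have h1 : Filter.Tendsto (fun J => ∑ j ∈ Finset.range J, m (j + 1)) Filter.atTop
      (nhds (heatHighSymbol N ζ hθ ht)) := by
    refine tendsto_of_eq_dilate_mul ζ _ fun J hJ ξ => ?_
    have h2 : heatHighSymbol N ζ hθ ht ξ = (1 - dilate N ζ 0 ξ) * heatSymbol N θ t ξ := by
      change (((1 - ζ (freq ξ)) * Real.exp (-t * freq ξ ^ θ) : ℝ) : ℂ) = _
      rw [heatSymbol, dilate_apply]
      simp
    have h3 : ∀ J : ℕ, (∑ j ∈ Finset.range J, m (j + 1)) ξ =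
        (dilate N ζ J ξ - dilate N ζ 0 ξ) * heatSymbol N θ t ξ := by
      intro J
      induction J with
      | zero => simp
      | succ J ih =>
        rw [Finset.sum_range_succ, add_apply, ih, hm, dyadicSymbol, sub_apply]
        push_cast
        rw [add_sub_cancel_right]
        ring
    have h4 := dilate_mul_dilate ζ (k := J) (l := 0) (by exact_mod_cast hJ) ξ
    rw [h3, h2]
    linear_combination heatSymbol N θ t ξ * h4
  have h5 := tendsto_multiplier h1 u x
  simpa only [multiplier_sum, hmu] using h5

end BesovMorrey
end

noncomputable section

namespace BesovMorrey

open MeasureTheory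

variable {N : ℕ}

/-! ### Sums in local Morrey spaces -/

theorem Mor.of_forall_add {p q : ℝ} {F : Sp N → ℝ≥0∞} {A : ℝ≥0∞}
    (h : ∀ η : ℝ≥0∞, η ≠ 0 → Mor p q F (A + η)) : Mor p q F A := by
  intro x ρ h0 h1
  have hlim : Filter.Tendsto (fun η : ℝ≥0∞ => ENNReal.ofReal (ρ ^ (N - N * q / p)) * (A + η) ^ q)
      (nhdsWithin 0 {0}ᶜ) (nhds (ENNReal.ofReal (ρ ^ (N - N * q / p)) * (A + 0) ^ q)) := by
    refine ENNReal.Tendsto.const_mul ?_ (Or.inr ENNReal.ofReal_ne_top)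
    exact ((ENNReal.continuous_rpow_const.comp (continuous_const.add continuous_id)).tendsto 0).mono_left
      nhdsWithin_le_nhds
  rw [add_zero] at hlim
  refine ge_of_tendsto hlim ?_
  filter_upwards [self_mem_nhdsWithin] with η hη using h η hη x ρ h0 h1

theorem Mor.top {p q : ℝ} (hq : 0 < q) (F : Sp N → ℝ≥0∞) : Mor p q F ⊤ := by
  intro x ρ h0 h1
  rw [ENNReal.top_rpow_of_pos hq, ENNReal.mul_top]
  · exact le_top
  · simpa using Real.rpow_pos_of_pos h0 _

theorem Mor.tsum {p q : ℝ} (hq : 1 < q) {ι : Type*} [Countable ι] {G : ι → Sp N → ℝ≥0∞}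
    (hG : ∀ i, Measurable (G i)) {k : ι → ℝ≥0∞} (h : ∀ i, Mor p q (G i) (k i)) :
    Mor p q (fun x => ∑' i, G i x) (∑' i, k i) := by
  by_cases hk : ∃ i, k i = ⊤
  · obtain ⟨i, hi⟩ := hk
    rw [ENNReal.tsum_eq_top_of_eq_top ⟨i, hi⟩]
    exact Mor.top (by linarith) _
  push Not at hk
  -- Minkowski's inequality was proved for positive weights, so the bounds are increased by a
  -- summable positive sequence of total less than `η`.
  refine Mor.of_forall_add fun η hη => ?_
  obtain ⟨ε, hε0, hε⟩ := ENNReal.exists_pos_sum_of_countable' hη ι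
  let _ : MeasurableSpace ι := ⊤
  have : MeasurableSingletonClass ι := ⟨fun _ => trivial⟩
  have hεt : ∀ i, ε i ≠ ⊤ := fun i => ne_top_of_le_ne_top (hε.trans_le le_top).ne (ENNReal.le_tsum i)
  have h1 := Mor.lintegral (p := p) hq (μ := Measure.count) (G := G)
    (measurable_from_prod_countable_right hG) (k := fun i => k i + ε i) measurable_from_top
    (Filter.Eventually.of_forall fun i => by simp [(hε0 i).ne'])
    (Filter.Eventually.of_forall fun i => by simp [hk i, hεt i])
    (Filter.Eventually.of_forall fun i => (h i).mono (by linarith) (fun _ => le_rfl) le_self_add)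
  simp only [lintegral_count] at h1
  refine h1.mono (by linarith) (fun _ => le_rfl) ?_
  rw [ENNReal.tsum_add]
  gcongr

theorem Mor.add {p q : ℝ} (hq : 1 < q) {F G : Sp N → ℝ≥0∞} (hF : Measurable F) (hG : Measurable G)
    {A B : ℝ≥0∞} (h₁ : Mor p q F A) (h₂ : Mor p q G B) :
    Mor p q (fun x => F x + G x) (A + B) := by
  have h := Mor.tsum (p := p) hq (G := fun b : Bool => cond b G F) (by rintro (_ | _); exacts [hF, hG])
    (k := fun b => cond b B A) (by rintro (_ | _); exacts [h₁, h₂])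
  simpa only [tsum_bool, cond_true, cond_false] using h

/-! ### Dyadic weights -/

/-- Comparison with a telescoping sum: `min(y, 1/y)` is at most a constant times `ψ(ry) - ψ(y)` for
the bounded increasing function `ψ(y) = y/(1+y)`. The bound is independent of `x`, hence later of
`t`. -/
theorem sum_min_geometric_le {x r : ℝ} (hx : 0 < x) (hr : 1 < r) (n : ℕ) :
    ∑ j ∈ Finset.range n, min (x * r ^ j) (x * r ^ j)⁻¹ ≤ 2 * (r + 1) / (r - 1) := by
  have hr1 : 0 < r - 1 := by linarith
  let ψ : ℝ → ℝ := fun y => y / (1 + y)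
  have h1 : ∀ y, 0 < y → min y y⁻¹ ≤ 2 * (r + 1) / (r - 1) * (ψ (r * y) - ψ y) := by
    intro y hy
    have hry : 0 < r * y := by positivity
    have e : 2 * (r + 1) / (r - 1) * (ψ (r * y) - ψ y) = 2 * (r + 1) * y / ((1 + r * y) * (1 + y)) := by
      simp only [ψ]
      field_simp
      ring
    rw [e, le_div_iff₀ (by positivity)]
    rcases le_or_gt y 1 with h | h
    · calc _ ≤ y * ((1 + r * y) * (1 + y)) := by gcongr; exact min_le_left _ _
        _ ≤ y * ((1 + r * 1) * (1 + 1)) := by gcongr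
        _ = _ := by ring
    · calc _ ≤ y⁻¹ * ((1 + r * y) * (1 + y)) := by gcongr; exact min_le_right _ _
        _ ≤ y⁻¹ * ((y + r * y) * (y + y)) := by gcongr
        _ = _ := by field_simp; ring
  calc _ ≤ ∑ j ∈ Finset.range n, 2 * (r + 1) / (r - 1) * (ψ (x * r ^ (j + 1)) - ψ (x * r ^ j)) := by
        refine Finset.sum_le_sum fun j _ => ?_
        have := h1 (x * r ^ j) (by positivity)
        rwa [show r * (x * r ^ j) = x * r ^ (j + 1) by ring] at this
    _ = 2 * (r + 1) / (r - 1) * (ψ (x * r ^ n) - ψ (x * r ^ 0)) := by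
        rw [← Finset.mul_sum, Finset.sum_range_sub (fun j => ψ (x * r ^ j))]
    _ ≤ 2 * (r + 1) / (r - 1) * 1 := by
        have h2 : 0 ≤ ψ (x * r ^ 0) := by simp only [ψ]; positivity
        have h3 : ψ (x * r ^ n) ≤ 1 := by
          simp only [ψ]
          rw [div_le_one (by positivity)]
          linarith
        gcongr
        linarith
    _ = _ := mul_one _

/-- `min(λ^c, λ^{-c})` for `λ = t 2^{jθ}`. -/
def dyadicWeight (θ c t : ℝ) (j : ℕ) : ℝ :=
  min ((t * ((2 : ℝ) ^ j) ^ θ) ^ c) ((t * ((2 : ℝ) ^ j) ^ θ) ^ c)⁻¹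

theorem tsum_dyadicWeight_le {θ c : ℝ} (hθ : 0 < θ) (hc : 0 < c) :
    ∃ K : ℝ, 0 < K ∧ ∀ t, 0 < t →
      ∑' j : ℕ, ENNReal.ofReal (dyadicWeight θ c t (j + 1)) ≤ ENNReal.ofReal K := by
  have hr : (1 : ℝ) < 2 ^ (θ * c) := Real.one_lt_rpow (by norm_num) (by positivity)
  have hr1 : (0 : ℝ) < 2 ^ (θ * c) - 1 := by linarith
  refine ⟨2 * (2 ^ (θ * c) + 1) / (2 ^ (θ * c) - 1), by positivity, fun t ht => ?_⟩
  have hw : ∀ j, dyadicWeight θ c t (j + 1) =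
      min ((t * 2 ^ θ) ^ c * (2 ^ (θ * c)) ^ j) ((t * 2 ^ θ) ^ c * (2 ^ (θ * c)) ^ j)⁻¹ := by
    intro j
    have : (t * ((2 : ℝ) ^ (j + 1)) ^ θ) ^ c = (t * 2 ^ θ) ^ c * (2 ^ (θ * c)) ^ j := by
      have e : ((2 : ℝ) ^ (j + 1)) ^ θ = 2 ^ θ * (2 ^ j) ^ θ := by
        rw [pow_succ', Real.mul_rpow (by positivity) (by positivity)]
      rw [e, ← mul_assoc, Real.mul_rpow (by positivity) (by positivity), ← Real.rpow_natCast,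
        ← Real.rpow_natCast, ← Real.rpow_mul (by norm_num), ← Real.rpow_mul (by positivity),
        ← Real.rpow_mul (by norm_num)]
      congr 2
      ring
    rw [dyadicWeight, this]
  refine ENNReal.tsum_le_of_sum_range_le fun n => ?_
  rw [← ENNReal.ofReal_sum_of_nonneg]
  · refine ENNReal.ofReal_le_ofReal ?_
    simp only [hw]
    exact sum_min_geometric_le (by positivity) hr n
  · intro j _
    rw [hw]
    positivity

/-- Here smallness of the limsup suffices in place of smallness of the norm. For high `j` the sizes
are at most `δ` and the weights are summable; the finitely many other weights are at most `λ^c` and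
tend to zero with `t`. The constant `K` does not depend on the sequence, but the admissible times
do. -/
theorem exists_tsum_dyadicWeight_mul_le {θ c : ℝ} (hθ : 0 < θ) (hc : 0 < c) :
    ∃ K : ℝ, 0 < K ∧ ∀ (β : ℕ → ℝ≥0∞) (B : ℝ≥0∞), B ≠ ⊤ → (∀ j, β (j + 1) ≤ B) → ∀ δ : ℝ, 0 < δ →
      (∀ᶠ j in Filter.atTop, β j ≤ ENNReal.ofReal δ) → ∀ᶠ t in nhdsWithin (0 : ℝ) (Set.Ioi 0),
        ∑' j, ENNReal.ofReal (dyadicWeight θ c t (j + 1)) * β (j + 1) ≤ ENNReal.ofReal (K * δ) := by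
  obtain ⟨K, hK, h⟩ := tsum_dyadicWeight_le hθ hc
  refine ⟨K + 1, by positivity, fun β B hB hβB δ hδ hβδ => ?_⟩
  obtain ⟨J, hJ⟩ := Filter.eventually_atTop.1 hβδ
  have hlim : Filter.Tendsto (fun t : ℝ => ∑ j ∈ Finset.range J,
      ENNReal.ofReal ((t * ((2 : ℝ) ^ (j + 1)) ^ θ) ^ c) * B) (nhdsWithin 0 (Set.Ioi 0)) (nhds 0) := by
    have : (0 : ℝ≥0∞) = ∑ j ∈ Finset.range J,
        ENNReal.ofReal (((0 : ℝ) * ((2 : ℝ) ^ (j + 1)) ^ θ) ^ c) * B := by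
      simp [Real.zero_rpow hc.ne']
    rw [this]
    refine tendsto_finsetSum _ fun j _ => ENNReal.Tendsto.mul_const ?_ (Or.inr hB)
    refine (ENNReal.continuous_ofReal.comp ?_).tendsto 0 |>.mono_left nhdsWithin_le_nhds
    exact (continuous_id.mul continuous_const).rpow_const fun _ => Or.inr hc.le
  have hev := hlim.eventually (gt_mem_nhds (ENNReal.ofReal_pos.2 hδ))
  filter_upwards [hev, self_mem_nhdsWithin] with t ht1 ht
  have ht : 0 < t := ht
  have hsplit : ∀ j, ENNReal.ofReal (dyadicWeight θ c t (j + 1)) * β (j + 1) ≤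
      ENNReal.ofReal (dyadicWeight θ c t (j + 1)) * ENNReal.ofReal δ +
        if j ∈ Finset.range J then ENNReal.ofReal ((t * ((2 : ℝ) ^ (j + 1)) ^ θ) ^ c) * B else 0 := by
    intro j
    split_ifs with hj
    · refine le_add_left (mul_le_mul' (ENNReal.ofReal_le_ofReal (min_le_left _ _)) (hβB j))
    · rw [add_zero]
      refine mul_le_mul' le_rfl (hJ _ ?_)
      rw [Finset.mem_range] at hj
      omega
  refine (ENNReal.tsum_le_tsum hsplit).trans ?_
  rw [ENNReal.tsum_add, ENNReal.tsum_mul_right, add_mul, ENNReal.ofReal_add (by positivity) (by positivity),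
    one_mul, ENNReal.ofReal_mul hK.le]
  refine add_le_add (mul_le_mul' (h t ht) le_rfl) ?_
  rw [tsum_eq_sum (s := Finset.range J) fun j hj => by simp [hj]]
  refine le_trans (le_of_eq (Finset.sum_congr rfl fun j hj => ?_)) ht1.le
  simp only [hj, if_true]

end BesovMorrey
end

noncomputable section

namespace BesovMorrey

open MeasureTheory

variable {N : ℕ}

/-! ### Estimates for the linear evolution -/

theorem measurable_enorm_multiplier (m : 𝓢(Sp N, ℂ)) (u : 𝓢'(Sp N, ℂ)) :
    Measurable fun x => ‖multiplier m u x‖ₑ :=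
  (multiplier_continuous m u).enorm.measurable

theorem mor_morreyNorm {p q : ℝ} (hq : 0 < q) (f : Sp N → ℂ) :
    Mor p q (fun x => ‖f x‖ₑ) (morreyNorm p q f) :=
  (morreyNorm_le_iff hq).1 le_rfl

theorem exists_posOp_le {p q e : ℝ} (hq : 1 ≤ q) (he : N < e) :
    ∃ C : ℝ, 0 < C ∧ ∀ r : ℝ, 0 < r → r ≤ 1 → ∀ F : Sp N → ℝ≥0∞, Measurable F → ∀ A : ℝ≥0∞,
      Mor p q F A → ∀ x, posOp e r F x ≤ ENNReal.ofReal (C * r ^ (-(N / p : ℝ))) * A := by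
  obtain ⟨C, hC, h⟩ := exists_posOp_rpow_le (N := N) (p := p) one_pos hq he
  refine ⟨C, hC, fun r hr hr1 F hF A hA x => ?_⟩
  simpa using h r hr hr1 F hF A hA x

theorem rpow_mul_min_le {lam c : ℝ} {k : ℕ} (hlam : 0 < lam) (hc : 0 ≤ c) (hk : 2 * c ≤ k) :
    lam ^ c * min 1 (lam ^ k)⁻¹ ≤ min (lam ^ c) (lam ^ c)⁻¹ := by
  have h0 : 0 < lam ^ c := by positivity
  refine le_min (mul_le_of_le_one_right h0.le (min_le_left _ _)) ?_
  rcases le_or_gt lam 1 with h | h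
  · have h1 : lam ^ c ≤ 1 := Real.rpow_le_one hlam.le h hc
    calc _ ≤ lam ^ c * 1 := by gcongr; exact min_le_left _ _
      _ ≤ 1 := by linarith
      _ ≤ _ := (one_le_inv₀ h0).2 h1
  · calc _ ≤ lam ^ c * (lam ^ k)⁻¹ := by gcongr; exact min_le_right _ _
      _ = lam ^ (c - k) := by
        rw [Real.rpow_sub hlam, Real.rpow_natCast, div_eq_mul_inv]
      _ ≤ lam ^ (-c) := Real.rpow_le_rpow_of_exponent_le h.le (by linarith)
      _ = _ := Real.rpow_neg hlam.le _

theorem morreyNorm_dyadic_eq (ζ : Cutoff) (s p q : ℝ) (u : 𝓢'(Sp N, ℂ)) (j : ℕ) :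
    morreyNorm p q (multiplier (dyadicSymbol N ζ j) u) =
      ENNReal.ofReal (((2 : ℝ) ^ j) ^ (-s)) * dyadicSize ζ s p q u j := by
  have h : (2 : ℝ) ^ (s * j) = ((2 : ℝ) ^ j) ^ s := by
    rw [mul_comm, Real.rpow_mul (by norm_num), Real.rpow_natCast]
  rw [dyadicSize, h, ← mul_assoc, ← ENNReal.ofReal_mul (by positivity), ← Real.rpow_add (by positivity),
    neg_add_cancel, Real.rpow_zero, ENNReal.ofReal_one, one_mul]

/-- The exponents are fixed by scaling: `t^a 2^{-sj} = λ^a`, and `t^b 2^{(N/p - s)j} = λ^b`, where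
`2^{jN/p}` is the price of passing from a Morrey to a sup bound at scale `2^{-j}`. The rapid decay
of the kernel in `λ` turns `λ^c` into `min(λ^c, λ^{-c})`. -/
theorem exists_dyadicPart_le (N : ℕ) (ζ : Cutoff) {θ s p q a b : ℝ} (hθ : 0 < θ) (hq : 1 < q)
    (ha0 : 0 ≤ a) (hb0 : 0 ≤ b) (ha : a * θ = -s) (hb : b * θ = N / p - s) :
    ∃ C : ℝ, 0 ≤ C ∧ ∀ (u : 𝓢'(Sp N, ℂ)) (j : ℕ) (t : ℝ), 0 < t →
      Mor p q (fun x => ENNReal.ofReal (t ^ a) * ‖dyadicPart ζ θ u j t x‖ₑ)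
        (ENNReal.ofReal (C * dyadicWeight θ a t j) * dyadicSize ζ s p q u j) ∧
      ∀ x, ENNReal.ofReal (t ^ b) * ‖dyadicPart ζ θ u j t x‖ₑ ≤
        ENNReal.ofReal (C * dyadicWeight θ b t j) * dyadicSize ζ s p q u j := by
  have he : (N : ℝ) < N + θ / 2 := by linarith
  -- Decay of order `2c` is needed to pass from `λ^c` to `λ^{-c}` when `λ > 1`.
  obtain ⟨k, hk⟩ := exists_nat_ge (2 * max a b)
  obtain ⟨C₁, h₁, H₁⟩ := exists_dyadicKernel_le N ζ hθ k
  obtain ⟨C₂, h₂, H₂⟩ := exists_posOp_le (N := N) (p := p) hq.le he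
  set μ₀ := (profileMass N (N + θ / 2)).toReal
  have hμ₀ : 0 ≤ μ₀ := ENNReal.toReal_nonneg
  have hμ : profileMass N (N + θ / 2) = ENNReal.ofReal μ₀ :=
    (ENNReal.ofReal_toReal (profileMass_lt_top he).ne).symm
  refine ⟨C₁ * max μ₀ C₂, by positivity, fun u j t ht => ?_⟩
  set R : ℝ := (2 : ℝ) ^ j with hR
  have hR0 : 0 < R := by positivity
  have hR1 : R⁻¹ ≤ 1 := inv_le_one_of_one_le₀ (one_le_pow₀ (by norm_num))
  set lam := t * R ^ θ with hlam
  have hlam0 : 0 < lam := by positivity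
  set w := min 1 (lam ^ k)⁻¹
  have hw : 0 ≤ w := by positivity
  have hpow : ∀ c, lam ^ c = t ^ c * R ^ (c * θ) := by
    intro c
    rw [hlam, Real.mul_rpow ht.le (by positivity), ← Real.rpow_mul hR0.le, mul_comm θ]
  have hm := measurable_enorm_multiplier (dyadicSymbol N ζ j) u
  have hM := mor_morreyNorm (p := p) (by linarith : 0 < q) (multiplier (dyadicSymbol N ζ j) u)
  have hpt : ∀ x, ‖dyadicPart ζ θ u j t x‖ₑ ≤ ENNReal.ofReal (C₁ * w) *
      posOp (N + θ / 2) R⁻¹ (fun y => ‖multiplier (dyadicSymbol N ζ j) u y‖ₑ) x :=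
    fun x => enorm_conv_le ENNReal.ofReal_ne_top (H₁ j t ht) _ x
  have hcomb : ∀ (x y z v : ℝ) (β : ℝ≥0∞), 0 ≤ x → 0 ≤ y → 0 ≤ z → 
      ENNReal.ofReal x * (ENNReal.ofReal y * (ENNReal.ofReal z * (ENNReal.ofReal v * β))) =
        ENNReal.ofReal (x * y * z * v) * β := by
    intro x y z v β hx hy hz
    rw [ENNReal.ofReal_mul (by positivity), ENNReal.ofReal_mul (by positivity), ENNReal.ofReal_mul hx]
    ring
  rw [morreyNorm_dyadic_eq ζ s] at hM
  have hfin : ∀ c m : ℝ, 0 ≤ c → 2 * c ≤ k → 0 ≤ m → m ≤ max μ₀ C₂ →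
      t ^ c * R ^ (c * θ) * (C₁ * w) * m ≤ C₁ * max μ₀ C₂ * dyadicWeight θ c t j := by
    intro c m hc hck hm0 hm
    have := rpow_mul_min_le hlam0 hc hck
    calc t ^ c * R ^ (c * θ) * (C₁ * w) * m = C₁ * m * (lam ^ c * w) := by rw [hpow]; ring
      _ ≤ C₁ * max μ₀ C₂ * min (lam ^ c) (lam ^ c)⁻¹ := by gcongr
      _ = _ := rfl
  constructor
  · have h3 := ((hM.posOp hq he (inv_pos.2 hR0) hm).const_mul (by linarith)
      (ENNReal.ofReal_ne_top (r := C₁ * w))).const_mul (by linarith) (ENNReal.ofReal_ne_top (r := t ^ a))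
    refine h3.mono (by linarith) (fun x => mul_le_mul' le_rfl (hpt x)) ?_
    rw [hμ, ← hR, hcomb _ _ _ _ _ (by positivity) (by positivity) (by positivity)]
    refine mul_le_mul' (ENNReal.ofReal_le_ofReal ?_) le_rfl
    refine le_trans (le_of_eq ?_) (hfin a μ₀ ha0 ((mul_le_mul_of_nonneg_left (le_max_left _ _)
      (by norm_num)).trans hk) hμ₀ (le_max_left _ _))
    rw [ha]
    ring
  · intro x
    refine (mul_le_mul' le_rfl (hpt x)).trans ?_
    refine (mul_le_mul' le_rfl (mul_le_mul' le_rfl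
      (H₂ _ (inv_pos.2 hR0) hR1 _ hm _ hM x))).trans ?_
    rw [← hR, hcomb _ _ _ _ _ (by positivity) (by positivity) (by positivity)]
    refine mul_le_mul' (ENNReal.ofReal_le_ofReal ?_) le_rfl
    refine le_trans (le_of_eq ?_) (hfin b C₂ hb0 ((mul_le_mul_of_nonneg_left (le_max_right _ _)
      (by norm_num)).trans hk) h₂.le (le_max_right _ _))
    rw [hb, sub_eq_add_neg, Real.rpow_add hR0, Real.inv_rpow hR0.le, Real.rpow_neg hR0.le (N / p : ℝ), inv_inv]
    ring

/-- A band-limited function in a local Morrey space is bounded. -/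
theorem exists_multiplier_le {p q : ℝ} (hq : 1 ≤ q) {χ m : 𝓢(Sp N, ℂ)}
    (h : ∀ ξ, m ξ = χ ξ * m ξ) {u : 𝓢'(Sp N, ℂ)} (hu : morreyNorm p q (multiplier m u) < ⊤) :
    ∃ D : ℝ, 0 ≤ D ∧ ∀ x, ‖multiplier m u x‖ ≤ D := by
  obtain ⟨C₁, h₁, H₁⟩ := exists_schwartz_bound (𝓕⁻ χ) (N + 1)
  obtain ⟨C₂, h₂, H₂⟩ := exists_posOp_le (N := N) (p := p) hq (by linarith : (N : ℝ) < N + 1)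
  have hk : ∀ x, ‖(𝓕⁻ χ) x‖ₑ ≤ ENNReal.ofReal C₁ * profile N (N + 1) 1 x := by
    intro x
    rw [profile, ← ENNReal.ofReal_mul h₁, ← ofReal_norm]
    refine ENNReal.ofReal_le_ofReal ?_
    simpa using H₁ x
  have hb : ∀ x, ‖multiplier m u x‖ₑ ≤ ENNReal.ofReal C₁ *
      (ENNReal.ofReal (C₂ * 1 ^ (-(N / p : ℝ))) * morreyNorm p q (multiplier m u)) := by
    intro x
    -- Since `χ` is one where `m` lives, the function reproduces itself under convolution with the
    -- kernel of `χ`; smoothing at scale one then bounds it.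
    have h3 := multiplier_mul h u x
    rw [h3]
    refine (enorm_conv_le ENNReal.ofReal_ne_top hk _ x).trans (mul_le_mul' le_rfl ?_)
    exact H₂ 1 one_pos le_rfl _ (measurable_enorm_multiplier m u) _ (mor_morreyNorm (by linarith) _) x
  set D := ENNReal.ofReal C₁ * (ENNReal.ofReal (C₂ * 1 ^ (-(N / p : ℝ))) * morreyNorm p q (multiplier m u))
  have hD : D ≠ ⊤ := ENNReal.mul_ne_top ENNReal.ofReal_ne_top
    (ENNReal.mul_ne_top ENNReal.ofReal_ne_top hu.ne)
  refine ⟨D.toReal, ENNReal.toReal_nonneg, fun x => ?_⟩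
  rw [← toReal_enorm]
  exact ENNReal.toReal_mono hD (hb x)

theorem exists_lowPart_le (ζ : Cutoff) {p q : ℝ} (hq : 1 ≤ q) {u : 𝓢'(Sp N, ℂ)}
    (hu : morreyNorm p q (multiplier (lowSymbol N ζ) u) < ⊤) :
    ∃ D : ℝ, 0 ≤ D ∧ ∀ x, ‖multiplier (lowSymbol N ζ) u x‖ ≤ D :=
  exists_multiplier_le hq (χ := dilate N ζ 1) (fun ξ => (dilate_mul_dilate ζ one_pos ξ).symm) hu

theorem exists_multiplier_dyadic_le (ζ : Cutoff) {p q : ℝ} (hq : 1 ≤ q) {u : 𝓢'(Sp N, ℂ)} (j : ℕ)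
    (hu : morreyNorm p q (multiplier (dyadicSymbol N ζ j) u) < ⊤) :
    ∃ D : ℝ, 0 ≤ D ∧ ∀ x, ‖multiplier (dyadicSymbol N ζ j) u x‖ ≤ D := by
  refine exists_multiplier_le hq (χ := dilate N ζ (j + 1)) (fun ξ => ?_) hu
  rw [dyadicSymbol, sub_apply, mul_sub, dilate_mul_dilate ζ (by omega), dilate_mul_dilate ζ (by omega)]

/-- `S(t)u` as a function of `(x,t)`, for `t > 0`. -/
def linearFlow (ζ : Cutoff) {θ : ℝ} (hθ : 0 < θ) (u : 𝓢'(Sp N, ℂ)) (x : Sp N) (t : ℝ) : ℂ :=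
  if h : 0 < t then semigroup ζ hθ h u x else 0

theorem linearFlow_of_pos (ζ : Cutoff) {θ t : ℝ} (hθ : 0 < θ) (ht : 0 < t) (u : 𝓢'(Sp N, ℂ)) (x : Sp N) :
    linearFlow ζ hθ u x t = semigroup ζ hθ ht u x := dif_pos ht

theorem dyadicSize_le_besovMorreyNorm (ζ : Cutoff) (s p q : ℝ) (u : 𝓢'(Sp N, ℂ)) (j : ℕ) :
    dyadicSize ζ s p q u (j + 1) ≤ besovMorreyNorm ζ s p q u :=
  (le_iSup₂_of_le (f := fun (j : ℕ) (_ : 1 ≤ j) => dyadicSize ζ s p q u j) (j + 1) (by omega) le_rfl).trans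
    le_add_self

theorem enorm_multiplier_heatHigh_le (ζ : Cutoff) {θ t : ℝ} (hθ : 0 < θ) (ht : 0 < t) (u : 𝓢'(Sp N, ℂ))
    (x : Sp N) : ‖multiplier (heatHighSymbol N ζ hθ ht) u x‖ₑ ≤ ∑' j, ‖dyadicPart ζ θ u (j + 1) t x‖ₑ := by
  refine le_of_tendsto ((continuous_enorm.tendsto _).comp (tendsto_sum_dyadicPart ζ hθ ht u x))
    (Filter.Eventually.of_forall fun J => ?_)
  exact (enorm_sum_le _ _).trans (ENNReal.sum_le_tsum _)

theorem continuous_dyadicKernel (ζ : Cutoff) (θ : ℝ) (j : ℕ) (t : ℝ) :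
    Continuous (dyadicKernel N ζ θ j t) := by
  have h2 : Continuous (𝓕⁻ (radial N (stepExp (t * ((2 : ℝ) ^ j) ^ θ) (θ / 2) (annulus ζ (1 / 2) 4) 0))) := by
    rw [← IsBump.fourierInv_symbol ((isBump_annulus_half_four ζ).stepExp _ _ _)]
    exact (𝓕⁻ (((isBump_annulus_half_four ζ).stepExp _ _ _).symbol N)).continuous
  exact (h2.comp (continuous_const_smul ((2 : ℝ) ^ j))).const_smul (((2 : ℝ) ^ j) ^ N)

theorem continuousOn_dyadicPart (ζ : Cutoff) {θ p q : ℝ} (hθ : 0 < θ) (hq : 1 ≤ q) {u : 𝓢'(Sp N, ℂ)} (j : ℕ)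
    (hu : morreyNorm p q (multiplier (dyadicSymbol N ζ j) u) < ⊤) :
    ContinuousOn (fun z : Sp N × ℝ => dyadicPart ζ θ u j z.2 z.1) (Set.univ ×ˢ Set.Ioi 0) := by
  obtain ⟨D, hD0, hD⟩ := exists_multiplier_dyadic_le ζ hq j hu
  obtain ⟨C, hC, H⟩ := exists_dyadicKernel_le N ζ hθ 0
  have he : (N : ℝ) < N + θ / 2 := by linarith
  have hrw : ∀ z : Sp N × ℝ, dyadicPart ζ θ u j z.2 z.1 =
      ∫ w, dyadicKernel N ζ θ j z.2 w * multiplier (dyadicSymbol N ζ j) u (z.1 - w) := by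
    intro z
    rw [dyadicPart, ← integral_sub_left_eq_self _ _ z.1]
    simp only [sub_sub_cancel]
  simp only [hrw]
  have hint : Integrable fun w => (ENNReal.ofReal C * profile N (N + θ / 2) ((2 : ℝ) ^ j)⁻¹ w).toReal * D := by
    refine (integrable_toReal_of_lintegral_ne_top
      ((measurable_profile _ _).const_mul _).aemeasurable ?_).mul_const D
    rw [lintegral_const_mul _ (measurable_profile _ _), lintegral_profile he (by positivity)]
    exact ENNReal.mul_ne_top ENNReal.ofReal_ne_top (profileMass_lt_top he).ne
  refine continuousOn_of_dominated ?_ ?_ hint ?_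
  · intro z _
    exact ((continuous_dyadicKernel ζ θ j z.2).mul ((multiplier_continuous _ u).comp
      (continuous_const.sub continuous_id))).aestronglyMeasurable
  · rintro ⟨x, t⟩ ⟨-, ht⟩
    refine Filter.Eventually.of_forall fun w => ?_
    rw [norm_mul, ← toReal_enorm]
    refine mul_le_mul (ENNReal.toReal_mono (ENNReal.mul_ne_top ENNReal.ofReal_ne_top (profile_ne_top _ _ _)) ?_)
      (hD _) (norm_nonneg _) ENNReal.toReal_nonneg
    have := H j t ht w
    simpa using this
  · refine Filter.Eventually.of_forall fun w => ContinuousOn.mul ?_ ?_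
    · exact (continuousOn_dyadicKernel ζ j w).comp continuousOn_snd fun z hz => hz.2
    · exact ((multiplier_continuous _ u).comp (continuous_fst.sub continuous_const)).continuousOn

theorem continuous_dyadicPart (ζ : Cutoff) {θ p q t : ℝ} (hθ : 0 < θ) (hq : 1 ≤ q) {u : 𝓢'(Sp N, ℂ)} (j : ℕ)
    (hu : morreyNorm p q (multiplier (dyadicSymbol N ζ j) u) < ⊤) (ht : 0 < t) :
    Continuous fun x => dyadicPart ζ θ u j t x := by
  have h1 : Continuous fun x : Sp N => (x, t) := by fun_prop
  have h2 : ∀ x : Sp N, (x, t) ∈ (Set.univ ×ˢ Set.Ioi 0 : Set (Sp N × ℝ)) := fun x =>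
    Set.mk_mem_prod (Set.mem_univ x) (Set.mem_Ioi.2 ht)
  have h3 := (continuousOn_dyadicPart ζ hθ hq j hu).comp_continuous h1 h2
  exact h3

theorem ofReal_mul_le_iff {t c B : ℝ} (ht : 0 < t) {X : ℝ≥0∞} (h : ENNReal.ofReal (t ^ c) * X ≤ ENNReal.ofReal B) :
    X ≤ ENNReal.ofReal (B * t ^ (-c)) := by
  calc X = ENNReal.ofReal (t ^ (-c)) * (ENNReal.ofReal (t ^ c) * X) := by
        rw [← mul_assoc, ofReal_rpow_mul_inv ht, neg_add_cancel, Real.rpow_zero, ENNReal.ofReal_one, one_mul]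
    _ ≤ ENNReal.ofReal (t ^ (-c)) * ENNReal.ofReal B := by gcongr
    _ = _ := by rw [← ENNReal.ofReal_mul (by positivity), mul_comm]

/-- For `t > τ > 0` the branch `λ^{-b}` of the weight makes the dyadic series geometric, uniformly
in `x` and `t`, so continuity passes from the blocks to the sum. -/
theorem continuousOn_linearFlow (ζ : Cutoff) {θ s p q b : ℝ} (hθ : 0 < θ) (hq : 1 < q) (hs : s ≤ 0)
    (hb0 : 0 < b) (hb : b * θ = N / p - s) {u : 𝓢'(Sp N, ℂ)} (hu : MemBesovMorrey ζ s p q u) :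
    ContinuousOn (fun z : Sp N × ℝ => linearFlow ζ hθ u z.1 z.2) (Set.univ ×ˢ Set.Ioi 0) := by
  obtain ⟨hu0, huj, hfin⟩ := hu
  obtain ⟨C, hC, H⟩ := exists_dyadicPart_le N ζ (a := -s / θ) hθ hq
    (div_nonneg (by linarith) hθ.le) hb0.le (by field_simp) hb
  obtain ⟨D, hD0, hD⟩ := exists_lowPart_le ζ hq.le hu0.2
  set B := (besovMorreyNorm ζ s p q u).toReal
  have hB : besovMorreyNorm ζ s p q u = ENNReal.ofReal B := (ENNReal.ofReal_toReal hfin.ne).symm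
  have hB0 : 0 ≤ B := ENNReal.toReal_nonneg
  have hlow : ContinuousOn (fun z : Sp N × ℝ => semigroupFun θ z.2 (multiplier (lowSymbol N ζ) u) z.1)
      (Set.univ ×ˢ Set.Ioi 0) :=
    continuousOn_semigroupFun ζ hθ continuousOn_snd (fun z hz => hz.2) continuousOn_fst
      ((multiplier_continuous _ u).comp continuous_snd).continuousOn fun _ _ => hD
  have hbound : ∀ τ, 0 < τ → ∀ (j : ℕ) (z : Sp N × ℝ), z ∈ (Set.univ ×ˢ Set.Ioi τ : Set (Sp N × ℝ)) →
      ‖dyadicPart ζ θ u (j + 1) z.2 z.1‖ ≤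
        C * B * τ ^ (-(2 * b)) * 2 ^ (-(θ * b)) * (2 ^ (-(θ * b))) ^ j := by
    rintro τ hτ j ⟨x, t⟩ ⟨-, ht⟩
    have ht : τ < t := ht
    have ht0 : 0 < t := hτ.trans ht
    have h1 := ((H u (j + 1) t ht0).2 x).trans (mul_le_mul' le_rfl (dyadicSize_le_besovMorreyNorm ζ s p q u j))
    rw [hB, ← ENNReal.ofReal_mul (mul_nonneg hC (by unfold dyadicWeight; positivity))] at h1
    have h2 := ofReal_mul_le_iff ht0 h1
    rw [← ofReal_norm, ENNReal.ofReal_le_ofReal_iff (by unfold dyadicWeight; positivity)] at h2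
    refine h2.trans ?_
    have h3 : dyadicWeight θ b t (j + 1) ≤ t ^ (-b) * (2 ^ (-(θ * b)) * (2 ^ (-(θ * b))) ^ j) := by
      refine (min_le_right _ _).trans (le_of_eq ?_)
      rw [← pow_succ', Real.mul_rpow ht0.le (by positivity), mul_inv, ← Real.rpow_neg ht0.le,
        ← Real.rpow_natCast, ← Real.rpow_natCast, ← Real.rpow_mul (by positivity), ← Real.rpow_mul (by positivity),
        ← Real.rpow_mul (by positivity), ← Real.rpow_neg (by positivity)]
      congr 2
      ring
    calc C * dyadicWeight θ b t (j + 1) * B * t ^ (-b)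
        ≤ C * (t ^ (-b) * (2 ^ (-(θ * b)) * (2 ^ (-(θ * b))) ^ j)) * B * t ^ (-b) := by gcongr
      _ = C * B * t ^ (-(2 * b)) * 2 ^ (-(θ * b)) * (2 ^ (-(θ * b))) ^ j := by
          rw [show -(2 * b) = -b + -b by ring, Real.rpow_add ht0]
          ring
      _ ≤ _ := by
          have : t ^ (-(2 * b)) ≤ τ ^ (-(2 * b)) := Real.rpow_le_rpow_of_nonpos hτ ht.le (by linarith)
          gcongr
  have hgeo : (2 : ℝ) ^ (-(θ * b)) < 1 := Real.rpow_lt_one_of_one_lt_of_neg (by norm_num) (by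
    have : 0 < θ * b := by positivity
    linarith)
  have hsum : ∀ τ : ℝ, Summable fun j : ℕ => C * B * τ ^ (-(2 * b)) * 2 ^ (-(θ * b)) * (2 ^ (-(θ * b)) : ℝ) ^ j :=
    fun τ => (summable_geometric_of_lt_one (by positivity) hgeo).mul_left _
  have heq : ∀ z ∈ (Set.univ ×ˢ Set.Ioi 0 : Set (Sp N × ℝ)), linearFlow ζ hθ u z.1 z.2 =
      semigroupFun θ z.2 (multiplier (lowSymbol N ζ) u) z.1 + ∑' j, dyadicPart ζ θ u (j + 1) z.2 z.1 := by
    rintro ⟨x, t⟩ ⟨-, ht⟩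
    have ht : 0 < t := ht
    rw [linearFlow_of_pos ζ hθ ht, semigroup]
    congr 1
    have hs1 : Summable fun j => dyadicPart ζ θ u (j + 1) t x :=
      Summable.of_norm_bounded (hsum (t / 2)) fun j => hbound (t / 2) (by positivity) j (x, t)
        ⟨trivial, half_lt_self ht⟩
    exact tendsto_nhds_unique (tendsto_sum_dyadicPart ζ hθ ht u x) hs1.hasSum.tendsto_sum_nat
  refine ContinuousOn.congr (hlow.add ?_) heq
  intro z hz
  have hz0 : 0 < z.2 := hz.2
  have h1 : ContinuousOn (fun z : Sp N × ℝ => ∑' j, dyadicPart ζ θ u (j + 1) z.2 z.1)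
      (Set.univ ×ˢ Set.Ioi (z.2 / 2)) :=
    continuousOn_tsum (fun j => (continuousOn_dyadicPart ζ hθ hq.le (j + 1) (huj (j + 1) (by omega)).2).mono
      (Set.prod_mono le_rfl (Set.Ioi_subset_Ioi (by positivity)))) (hsum (z.2 / 2))
      (fun j w hw => hbound _ (by positivity) j w hw)
  exact (h1.continuousAt ((isOpen_univ.prod isOpen_Ioi).mem_nhds
    ⟨trivial, half_lt_self hz0⟩)).continuousWithinAt

/-- The low frequency part has bounded Morrey and sup norms, so `t^a` and `t^b` make its
contribution at most `δ` for small `t`; the blocks contribute a multiple of `δ`. Only the range of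
`t` depends on `u`, which lets `δ` be chosen before the initial value. -/
theorem exists_linearFlow_le (N : ℕ) (ζ : Cutoff) {θ s p q a b : ℝ} (hθ : 0 < θ) (hq : 1 < q)
    (ha0 : 0 < a) (hb0 : 0 < b) (ha : a * θ = -s) (hb : b * θ = N / p - s) :
    ∃ K : ℝ, 0 < K ∧ ∀ u : 𝓢'(Sp N, ℂ), MemBesovMorrey ζ s p q u → ∀ δ : ℝ, 0 < δ →
      Filter.limsup (dyadicSize ζ s p q u) Filter.atTop < ENNReal.ofReal δ →
      ∀ᶠ t in nhdsWithin (0 : ℝ) (Set.Ioi 0),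
        Mor p q (fun x => ‖linearFlow ζ hθ u x t‖ₑ) (ENNReal.ofReal (K * δ * t ^ (-a))) ∧
        ∀ x, ‖linearFlow ζ hθ u x t‖ₑ ≤ ENNReal.ofReal (K * δ * t ^ (-b)) := by
  have hq0 : 0 < q := by linarith
  have he : (N : ℝ) < N + θ / 2 := by linarith
  obtain ⟨C, hC, H⟩ := exists_dyadicPart_le N ζ hθ hq ha0.le hb0.le ha hb
  obtain ⟨C₁, hC₁, H₁⟩ := exists_semigroupFun_le N ζ hθ
  obtain ⟨Ka, hKa, Ha⟩ := exists_tsum_dyadicWeight_mul_le hθ ha0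
  obtain ⟨Kb, hKb, Hb⟩ := exists_tsum_dyadicWeight_mul_le hθ hb0
  refine ⟨1 + C * max Ka Kb, by positivity, fun u hu δ hδ hlim => ?_⟩
  obtain ⟨hu0, huj, hfin⟩ := hu
  obtain ⟨D, hD0, hD⟩ := exists_lowPart_le ζ hq.le hu0.2
  have hev : ∀ᶠ j in Filter.atTop, dyadicSize ζ s p q u j ≤ ENNReal.ofReal δ :=
    (Filter.eventually_lt_of_limsup_lt hlim).mono fun j h => h.le
  have hβ := dyadicSize_le_besovMorreyNorm ζ s p q u
  have hA := Ha _ _ hfin.ne hβ δ hδ hev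
  have hB := Hb _ _ hfin.ne hβ δ hδ hev
  set f₀ := multiplier (lowSymbol N ζ) u
  set A₀ := ENNReal.ofReal C₁ * (profileMass N (N + θ / 2) * morreyNorm p q f₀)
  set B₀ := ENNReal.ofReal C₁ * (profileMass N (N + θ / 2) * ENNReal.ofReal D)
  have hmass := (profileMass_lt_top he).ne
  have hA₀ : A₀ ≠ ⊤ := ENNReal.mul_ne_top ENNReal.ofReal_ne_top (ENNReal.mul_ne_top hmass hu0.2.ne)
  have hB₀ : B₀ ≠ ⊤ := ENNReal.mul_ne_top ENNReal.ofReal_ne_top (ENNReal.mul_ne_top hmass ENNReal.ofReal_ne_top)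
  have hsmall : ∀ c : ℝ, 0 < c → ∀ A : ℝ≥0∞, A ≠ ⊤ → ∀ᶠ t in nhdsWithin (0 : ℝ) (Set.Ioi 0),
      ENNReal.ofReal (t ^ c) * A ≤ ENNReal.ofReal δ := by
    intro c hc A hA
    have h1 : Filter.Tendsto (fun t : ℝ => ENNReal.ofReal (t ^ c) * A) (nhdsWithin 0 (Set.Ioi 0))
        (nhds (ENNReal.ofReal ((0 : ℝ) ^ c) * A)) := by
      refine ENNReal.Tendsto.mul_const ?_ (Or.inr hA)
      exact ((ENNReal.continuous_ofReal.comp (continuous_id.rpow_const fun _ => Or.inr hc.le)).tendsto 0).mono_left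
        nhdsWithin_le_nhds
    rw [Real.zero_rpow hc.ne', ENNReal.ofReal_zero, zero_mul] at h1
    exact (h1.eventually (gt_mem_nhds (ENNReal.ofReal_pos.2 hδ))).mono fun t ht => ht.le
  have hmax : ∀ K, 0 < K → K ≤ max Ka Kb → ENNReal.ofReal δ + ENNReal.ofReal C * ENNReal.ofReal (K * δ) ≤
      ENNReal.ofReal ((1 + C * max Ka Kb) * δ) := by
    intro K hK hKm
    rw [← ENNReal.ofReal_mul hC, ← ENNReal.ofReal_add hδ.le (by positivity)]
    refine ENNReal.ofReal_le_ofReal ?_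
    have : C * K * δ ≤ C * max Ka Kb * δ := by gcongr
    linarith
  filter_upwards [hA, hB, hsmall a ha0 A₀ hA₀, hsmall b hb0 B₀ hB₀, self_mem_nhdsWithin]
    with t hAt hBt hA₀t hB₀t ht
  have ht : 0 < t := ht
  have hr : 0 < t ^ (1 / θ) := by positivity
  have hpt : ∀ (c : ℝ) (x), ENNReal.ofReal (t ^ c) * ‖linearFlow ζ hθ u x t‖ₑ ≤
      ENNReal.ofReal (t ^ c) * (ENNReal.ofReal C₁ * posOp (N + θ / 2) (t ^ (1 / θ)) (fun y => ‖f₀ y‖ₑ) x) +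
        ∑' j, ENNReal.ofReal (t ^ c) * ‖dyadicPart ζ θ u (j + 1) t x‖ₑ := by
    intro c x
    rw [ENNReal.tsum_mul_left, ← mul_add, linearFlow_of_pos ζ hθ ht, semigroup]
    exact mul_le_mul' le_rfl ((enorm_add_le _ _).trans
      (add_le_add (H₁ t ht f₀ x) (enorm_multiplier_heatHigh_le ζ hθ ht u x)))
  have hweight : ∀ c, ∑' j, ENNReal.ofReal (C * dyadicWeight θ c t (j + 1)) * dyadicSize ζ s p q u (j + 1) =
      ENNReal.ofReal C * ∑' j, ENNReal.ofReal (dyadicWeight θ c t (j + 1)) * dyadicSize ζ s p q u (j + 1) := by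
    intro c
    rw [← ENNReal.tsum_mul_left]
    refine tsum_congr fun j => ?_
    rw [ENNReal.ofReal_mul hC, mul_assoc]
  have hf₀m := measurable_enorm_multiplier (lowSymbol N ζ) u
  have hdm : ∀ j, Measurable fun x => ENNReal.ofReal (t ^ a) * ‖dyadicPart ζ θ u (j + 1) t x‖ₑ := by
    exact fun j => (continuous_dyadicPart ζ hθ hq.le (j + 1) (huj (j + 1) (by omega)).2 ht).enorm.measurable.const_mul _
  constructor
  · have h1 := (((mor_morreyNorm (p := p) hq0 f₀).posOp hq he hr hf₀m).const_mul hq0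
      (ENNReal.ofReal_ne_top (r := C₁))).const_mul hq0 (ENNReal.ofReal_ne_top (r := t ^ a))
    have h2 := Mor.tsum (p := p) hq hdm fun j => (H u (j + 1) t ht).1
    have h3 := Mor.add hq (((measurable_posOp _ _ hf₀m).const_mul _).const_mul _)
      (Measurable.tsum hdm) h1 h2
    have h4 := h3.mono hq0 (hpt a) ((add_le_add hA₀t (by
      rw [hweight]; exact mul_le_mul' le_rfl hAt)).trans (hmax Ka hKa (le_max_left _ _)))
    refine (h4.const_mul hq0 (ENNReal.ofReal_ne_top (r := t ^ (-a)))).mono hq0 (fun x => le_of_eq ?_) (le_of_eq ?_)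
    · rw [← mul_assoc, ofReal_rpow_mul_inv ht, neg_add_cancel, Real.rpow_zero, ENNReal.ofReal_one, one_mul]
    · rw [← ENNReal.ofReal_mul (by positivity), mul_comm]
  · intro x
    refine ofReal_mul_le_iff ht ((hpt b x).trans ?_)
    refine le_trans (add_le_add ?_ ?_) (hmax Kb hKb (le_max_right _ _))
    · refine le_trans (mul_le_mul' le_rfl (mul_le_mul' le_rfl (posOp_le_mul_sup he hr
        (S := ENNReal.ofReal D) (fun y => ?_) x))) hB₀t
      rw [← ofReal_norm]
      exact ENNReal.ofReal_le_ofReal (hD y)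
    · refine (ENNReal.tsum_le_tsum fun j => (H u (j + 1) t ht).2 x).trans ?_
      rw [hweight]
      exact mul_le_mul' le_rfl hBt

end BesovMorrey
end

noncomputable section

namespace BesovMorrey

open MeasureTheory

variable {N : ℕ}

/-! ### Multilinear smoothing estimates -/

/-- Hölder with respect to the kernel, with exponents `q/(q-1)` and `q`. The smoothing estimate
applies to the first factor because `(γ-1) q/(q-1) ≤ q`, which is the condition `γ ≤ q`; the factor
`W` keeps its full power `q`, so its Morrey exponents are preserved. -/
theorem exists_posOp_mul_le {p q e γ : ℝ} (hγ : 1 < γ) (hγq : γ ≤ q) (he : N < e) :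
    ∃ C : ℝ, 0 < C ∧ ∀ r : ℝ, 0 < r → r ≤ 1 → ∀ U W : Sp N → ℝ≥0∞, Measurable U → Measurable W →
      ∀ A : ℝ≥0∞, Mor p q U A → ∀ x, posOp e r (fun y => U y ^ (γ - 1) * W y) x ≤
        ENNReal.ofReal (C * r ^ (-(N * (γ - 1) / p))) * A ^ (γ - 1) *
          posOp e r (fun y => W y ^ q) x ^ (1 / q) := by
  have hq : 1 < q := by linarith
  have hq0 : 0 < q := by linarith
  have hq1 : 0 < q - 1 := by linarith
  have hγ1 : 0 < γ - 1 := by linarith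
  have hm : 0 < (γ - 1) * (q / (q - 1)) := by positivity
  have hmq : (γ - 1) * (q / (q - 1)) ≤ q := by
    rw [← mul_div_assoc, div_le_iff₀ hq1, mul_comm]
    gcongr
  obtain ⟨C, hC, H⟩ := exists_posOp_rpow_le (N := N) (p := p) hm hmq he
  refine ⟨C ^ ((q - 1) / q), by positivity, fun r hr hr1 U W hU hW A hA x => ?_⟩
  have h1 := lintegral_weight_mul_rpow_le (μ := volume) hq (k := fun y => profile N e r (x - y))
    (F := fun y => U y ^ (γ - 1)) (G := W) (measurable_profile_sub e r x).aemeasurable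
    (hU.pow_const _).aemeasurable hW.aemeasurable
  simp only [← ENNReal.rpow_mul] at h1
  have h2 := H r hr hr1 U hU A hA x
  have h3 := ENNReal.rpow_le_rpow (h1.trans (mul_le_mul' (ENNReal.rpow_le_rpow h2 hq1.le) le_rfl))
    (z := 1 / q) (by positivity)
  rw [← ENNReal.rpow_mul, mul_one_div_cancel hq0.ne', ENNReal.rpow_one,
    ENNReal.mul_rpow_of_nonneg _ _ (by positivity), ← ENNReal.rpow_mul, mul_one_div,
    ENNReal.mul_rpow_of_nonneg _ _ (by positivity), ← ENNReal.rpow_mul A,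
    ENNReal.ofReal_rpow_of_pos (by positivity), Real.mul_rpow hC.le (by positivity), ← Real.rpow_mul hr.le] at h3
  have e1 : (γ - 1) * (q / (q - 1)) * ((q - 1) / q) = γ - 1 := by field_simp
  have e2 : ∀ m w : ℝ, -(N * m / p) * w = -(N * (m * w) / p) := fun m w => by ring
  rw [e2, e1] at h3
  exact h3

theorem Mor.posOp_mul {p q e γ C r : ℝ} (hq : 0 < q) (he : N < e) (hr : 0 < r) {U W : Sp N → ℝ≥0∞}
    (hW : Measurable W) {A D : ℝ≥0∞} (hA : A ≠ ⊤) (hγ : 0 ≤ γ - 1)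
    (h : ∀ x, BesovMorrey.posOp e r (fun y => U y ^ (γ - 1) * W y) x ≤
        ENNReal.ofReal (C * r ^ (-(N * (γ - 1) / p))) * A ^ (γ - 1) *
          BesovMorrey.posOp e r (fun y => W y ^ q) x ^ (1 / q)) (hD : Mor p q W D) :
    Mor p q (BesovMorrey.posOp e r (fun y => U y ^ (γ - 1) * W y))
      (ENNReal.ofReal (C * r ^ (-(N * (γ - 1) / p))) * A ^ (γ - 1) * (profileMass N e ^ (1 / q) * D)) :=
  ((hD.posOp_rpow hq he hr hW).const_mul hq (ENNReal.mul_ne_top ENNReal.ofReal_ne_top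
    (ENNReal.rpow_ne_top_of_nonneg hγ hA))).mono hq h le_rfl

/-- The three estimates of the product `U^{γ-1} W` after smoothing at scale `t^{1/θ}`. -/
theorem exists_posOp_product {p q e γ θ : ℝ} (hθ : 0 < θ) (hγ : 1 < γ) (hγq : γ ≤ q) (he : N < e) :
    ∃ C : ℝ, 0 < C ∧ ∀ t : ℝ, 0 < t → t ≤ 1 → ∀ U W : Sp N → ℝ≥0∞, Measurable U → Measurable W →
      ∀ A D S : ℝ, 0 ≤ A → 0 ≤ D → 0 ≤ S → Mor p q U (ENNReal.ofReal A) →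
        (Mor p q W (ENNReal.ofReal D) →
          Mor p q (posOp e (t ^ (1 / θ)) (fun y => U y ^ (γ - 1) * W y))
            (ENNReal.ofReal (C * A ^ (γ - 1) * D * t ^ (-(N * (γ - 1) / (p * θ)))))) ∧
        (Mor p q W (ENNReal.ofReal D) → ∀ x, posOp e (t ^ (1 / θ)) (fun y => U y ^ (γ - 1) * W y) x ≤
          ENNReal.ofReal (C * A ^ (γ - 1) * D * t ^ (-(N * γ / (p * θ))))) ∧
        ((∀ y, W y ≤ ENNReal.ofReal S) → ∀ x, posOp e (t ^ (1 / θ)) (fun y => U y ^ (γ - 1) * W y) x ≤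
          ENNReal.ofReal (C * A ^ (γ - 1) * S * t ^ (-(N * (γ - 1) / (p * θ))))) := by
  have hq0 : 0 < q := by linarith
  have hγ1 : 0 < γ - 1 := by linarith
  obtain ⟨C₁, h₁, H₁⟩ := exists_posOp_mul_le (N := N) (p := p) hγ hγq he
  obtain ⟨C₂, h₂, H₂⟩ := exists_posOp_rpow_le (N := N) (p := p) hq0 le_rfl he
  obtain ⟨C₃, h₃, H₃⟩ := exists_posOp_rpow_le (N := N) (p := p) hγ1 (by linarith : γ - 1 ≤ q) he
  set μ₀ := (profileMass N e).toReal
  have hμ₀ : 0 ≤ μ₀ := ENNReal.toReal_nonneg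
  have hμ : profileMass N e = ENNReal.ofReal μ₀ := (ENNReal.ofReal_toReal (profileMass_lt_top he).ne).symm
  let K := max (C₁ * μ₀ ^ (1 / q)) (max (C₁ * C₂ ^ (1 / q)) C₃)
  have hK1 : C₁ * μ₀ ^ (1 / q) ≤ K := le_max_left _ _
  have hK2 : C₁ * C₂ ^ (1 / q) ≤ K := (le_max_left _ _).trans (le_max_right _ _)
  have hK3 : C₃ ≤ K := (le_max_right _ _).trans (le_max_right _ _)
  refine ⟨K, h₃.trans_le hK3, fun t ht ht1 U W hU hW A D S hA hD hS hUA => ?_⟩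
  have hr : 0 < t ^ (1 / θ) := by positivity
  have hr1 : t ^ (1 / θ) ≤ 1 := Real.rpow_le_one ht.le ht1 (by positivity)
  have hrt : ∀ c : ℝ, (t ^ (1 / θ)) ^ (-(c / p)) = t ^ (-(c / (p * θ))) := by
    intro c
    rw [← Real.rpow_mul ht.le]
    congr 1
    rw [div_mul_eq_div_div]
    ring
  have key := H₁ _ hr hr1 U W hU hW _ hUA
  have hAγ : ENNReal.ofReal A ^ (γ - 1) = ENNReal.ofReal (A ^ (γ - 1)) :=
    ENNReal.ofReal_rpow_of_nonneg hA hγ1.le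
  refine ⟨fun hWD => ?_, fun hWD x => ?_, fun hWS x => ?_⟩
  · refine (Mor.posOp_mul hq0 he hr hW ENNReal.ofReal_ne_top hγ1.le key hWD).mono hq0 (fun _ => le_rfl) ?_
    rw [hμ, hAγ, ENNReal.ofReal_rpow_of_nonneg hμ₀ (by positivity), ← ENNReal.ofReal_mul (by positivity),
      ← ENNReal.ofReal_mul (by positivity), ← ENNReal.ofReal_mul (by positivity), hrt]
    refine ENNReal.ofReal_le_ofReal ?_
    calc _ = C₁ * μ₀ ^ (1 / q) * A ^ (γ - 1) * D * t ^ (-(N * (γ - 1) / (p * θ))) := by ring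
      _ ≤ _ := by gcongr
  -- Smoothing with `m = q` bounds the remaining `L^q` mean pointwise, with an additional loss
  -- `r^{-N/p}`.
  · have h4 := ENNReal.rpow_le_rpow (H₂ _ hr hr1 W hW _ hWD x) (z := 1 / q) (by positivity)
    refine ((key x).trans (mul_le_mul' le_rfl h4)).trans ?_
    rw [hAγ, ENNReal.mul_rpow_of_nonneg _ _ (by positivity), ← ENNReal.rpow_mul (ENNReal.ofReal D),
      mul_one_div_cancel hq0.ne', ENNReal.rpow_one, ENNReal.ofReal_rpow_of_pos (by positivity),
      ← ENNReal.ofReal_mul (by positivity), ← ENNReal.ofReal_mul (by positivity),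
      ← ENNReal.ofReal_mul (by positivity), hrt, hrt, Real.mul_rpow h₂.le (by positivity), ← Real.rpow_mul ht.le]
    refine ENNReal.ofReal_le_ofReal ?_
    have e1 : t ^ (-(N * γ / (p * θ))) = t ^ (-(N * (γ - 1) / (p * θ))) * t ^ (-(N * q / (p * θ)) * (1 / q)) := by
      rw [← Real.rpow_add ht]
      congr 1
      field_simp
      ring
    rw [e1]
    calc _ = C₁ * C₂ ^ (1 / q) * A ^ (γ - 1) * D *
          (t ^ (-(N * (γ - 1) / (p * θ))) * t ^ (-(N * q / (p * θ)) * (1 / q))) := by ring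
      _ ≤ _ := by gcongr
  · refine (posOp_mul_sup ENNReal.ofReal_ne_top hWS x).trans ?_
    refine (mul_le_mul' le_rfl (H₃ _ hr hr1 U hU _ hUA x)).trans ?_
    rw [hAγ, ← ENNReal.ofReal_mul (by positivity), ← ENNReal.ofReal_mul (by positivity), hrt]
    refine ENNReal.ofReal_le_ofReal ?_
    calc _ = C₃ * A ^ (γ - 1) * S * t ^ (-(N * (γ - 1) / (p * θ))) := by ring
      _ ≤ _ := by gcongr

/-! ### Time integrals -/

theorem setLIntegral_rpow_neg {h c : ℝ} (hh : 0 < h) (hc : c < 1) :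
    ∫⁻ τ in Set.Ioc 0 h, ENNReal.ofReal (τ ^ (-c)) = ENNReal.ofReal (h ^ (1 - c) / (1 - c)) := by
  have hint : IntegrableOn (fun τ : ℝ => τ ^ (-c)) (Set.Ioc 0 h) :=
    (intervalIntegrable_iff_integrableOn_Ioc_of_le hh.le).1 (intervalIntegral.intervalIntegrable_rpow' (by linarith))
  rw [← ofReal_integral_eq_lintegral_ofReal hint
    ((ae_restrict_mem measurableSet_Ioc).mono fun τ hτ => Real.rpow_nonneg hτ.1.le _),
    ← intervalIntegral.integral_of_le hh.le, integral_rpow (Or.inl (by linarith)),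
    Real.zero_rpow (by linarith), sub_zero, neg_add_eq_sub]

theorem setLIntegral_sub_rpow_neg {t h c : ℝ} (hh : 0 < h) (hc : c < 1) :
    ∫⁻ τ in Set.Ico (t - h) t, ENNReal.ofReal ((t - τ) ^ (-c)) = ENNReal.ofReal (h ^ (1 - c) / (1 - c)) := by
  rw [← setLIntegral_rpow_neg hh hc, ← lintegral_indicator measurableSet_Ico,
    ← lintegral_indicator measurableSet_Ioc,
    ← lintegral_sub_left_eq_self (Set.indicator (Set.Ioc 0 h) fun τ : ℝ => ENNReal.ofReal (τ ^ (-c))) t]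
  refine lintegral_congr fun τ => ?_
  by_cases hτ : τ ∈ Set.Ico (t - h) t
  · rw [Set.indicator_of_mem hτ, Set.indicator_of_mem]
    exact ⟨by linarith [hτ.2], by linarith [hτ.1]⟩
  · rw [Set.indicator_of_notMem hτ, Set.indicator_of_notMem]
    exact fun h' => hτ ⟨by linarith [h'.2], by linarith [h'.1]⟩

theorem setLIntegral_Ioo_le_add {t : ℝ} (f : ℝ → ℝ≥0∞) :
    ∫⁻ τ in Set.Ioo 0 t, f τ ≤ (∫⁻ τ in Set.Ioc 0 (t / 2), f τ) + ∫⁻ τ in Set.Ico (t - t / 2) t, f τ := by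
  refine (lintegral_mono_set (t := Set.Ioc 0 (t / 2) ∪ Set.Ico (t - t / 2) t) fun τ hτ => ?_).trans
    (lintegral_union_le _ _ _)
  rcases le_or_gt τ (t / 2) with h | h
  · exact Or.inl ⟨hτ.1, h⟩
  · exact Or.inr ⟨by linarith, hτ.2⟩

/-- Splitting a time integral at the midpoint. -/
theorem setLIntegral_le_of_halves {t x y c d A B : ℝ} (ht : 0 < t) (hc : c < 1) (hd : d < 1)
    (hA : 0 ≤ A) (hB : 0 ≤ B) {f : ℝ → ℝ≥0∞} (hx : 0 ≤ x) (hy : 0 ≤ y)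
    (h₁ : ∀ τ ∈ Set.Ioo 0 t, τ ≤ t / 2 → f τ ≤ ENNReal.ofReal (A * (t - τ) ^ (-x) * τ ^ (-c)))
    (h₂ : ∀ τ ∈ Set.Ioo 0 t, t / 2 ≤ τ → f τ ≤ ENNReal.ofReal (B * τ ^ (-y) * (t - τ) ^ (-d))) :
    ∫⁻ τ in Set.Ioo 0 t, f τ ≤ ENNReal.ofReal (A * (t / 2) ^ (1 - c - x) / (1 - c) +
      B * (t / 2) ^ (1 - d - y) / (1 - d)) := by
  have hc1 : 0 < 1 - c := by linarith
  have hd1 : 0 < 1 - d := by linarith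
  have ht2 : 0 < t / 2 := by positivity
  rw [ENNReal.ofReal_add (by positivity) (by positivity)]
  refine (setLIntegral_Ioo_le_add f).trans (add_le_add ?_ ?_)
  · calc ∫⁻ τ in Set.Ioc 0 (t / 2), f τ
        ≤ ∫⁻ τ in Set.Ioc 0 (t / 2), ENNReal.ofReal (A * (t / 2) ^ (-x)) * ENNReal.ofReal (τ ^ (-c)) := by
          refine setLIntegral_mono' measurableSet_Ioc fun τ hτ => ?_
          have hτ0 : 0 < τ := hτ.1
          refine (h₁ τ ⟨hτ.1, by linarith [hτ.2]⟩ hτ.2).trans ?_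
          rw [← ENNReal.ofReal_mul (by positivity)]
          refine ENNReal.ofReal_le_ofReal ?_
          have := Real.rpow_le_rpow_of_nonpos ht2 (by linarith [hτ.2] : t / 2 ≤ t - τ) (by linarith : -x ≤ 0)
          gcongr
      _ = _ := by
          rw [lintegral_const_mul' _ _ ENNReal.ofReal_ne_top, setLIntegral_rpow_neg ht2 hc,
            ← ENNReal.ofReal_mul (by positivity)]
          congr 1
          rw [show 1 - c - x = -x + (1 - c) by ring, Real.rpow_add ht2]
          ring
  · calc ∫⁻ τ in Set.Ico (t - t / 2) t, f τ
        ≤ ∫⁻ τ in Set.Ico (t - t / 2) t,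
            ENNReal.ofReal (B * (t / 2) ^ (-y)) * ENNReal.ofReal ((t - τ) ^ (-d)) := by
          refine setLIntegral_mono' measurableSet_Ico fun τ hτ => ?_
          have hτ0 : t / 2 ≤ τ := by linarith [hτ.1]
          have hτt : 0 < t - τ := by linarith [hτ.2]
          refine (h₂ τ ⟨by linarith, hτ.2⟩ hτ0).trans ?_
          rw [← ENNReal.ofReal_mul (by positivity)]
          refine ENNReal.ofReal_le_ofReal ?_
          have := Real.rpow_le_rpow_of_nonpos ht2 hτ0 (by linarith : -y ≤ 0)
          gcongr
      _ = _ := by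
          rw [lintegral_const_mul' _ _ ENNReal.ofReal_ne_top, setLIntegral_sub_rpow_neg ht2 hd,
            ← ENNReal.ofReal_mul (by positivity)]
          congr 1
          rw [show 1 - d - y = -y + (1 - d) by ring, Real.rpow_add ht2]
          ring

end BesovMorrey
end

noncomputable section

namespace BesovMorrey

open MeasureTheory

variable {N : ℕ}

/-! ### The nonlinearity -/

theorem norm_nonlinearity {γ : ℝ} (hγ : 1 < γ) (z : ℂ) : ‖nonlinearity γ z‖ = ‖z‖ ^ γ := by
  rw [nonlinearity, norm_mul, Complex.norm_real, Real.norm_of_nonneg (by positivity)]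
  rcases eq_or_ne z 0 with rfl | hz
  · simp [Real.zero_rpow (by linarith : γ ≠ 0)]
  · rw [Real.rpow_sub_one (norm_ne_zero_iff.2 hz), div_mul_cancel₀ _ (norm_ne_zero_iff.2 hz)]

theorem nonlinearity_zero (γ : ℝ) : nonlinearity γ 0 = 0 := by simp [nonlinearity]

theorem continuous_nonlinearity {γ : ℝ} (hγ : 1 < γ) : Continuous (nonlinearity γ) :=
  (Complex.continuous_ofReal.comp (continuous_norm.rpow_const fun _ => Or.inr (by linarith))).mul continuous_id

/-- By symmetry let `|w| ≤ |z|`. The difference is `|z|^{γ-1}(z-w)` plus `(|z|^{γ-1} - |w|^{γ-1})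
w`. When `γ < 2` the power `γ-1` is not Lipschitz at zero, but multiplied by `|w|` its increment is
dominated by `|z|^γ - |w|^γ`, which Bernoulli's inequality bounds. -/
theorem norm_nonlinearity_sub_le {γ : ℝ} (hγ : 1 < γ) (z w : ℂ) :
    ‖nonlinearity γ z - nonlinearity γ w‖ ≤ (1 + γ) * (‖z‖ + ‖w‖) ^ (γ - 1) * ‖z - w‖ := by
  have key : ∀ z w : ℂ, ‖w‖ ≤ ‖z‖ →
      ‖nonlinearity γ z - nonlinearity γ w‖ ≤ (1 + γ) * (‖z‖ + ‖w‖) ^ (γ - 1) * ‖z - w‖ := by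
    intro z w h
    rcases eq_or_ne z 0 with rfl | hz
    · have : w = 0 := by simpa using h
      simp [this]
    have hy : 0 < ‖z‖ := norm_pos_iff.2 hz
    have hx := norm_nonneg w
    set x := ‖w‖
    set y := ‖z‖
    have h1 : y ^ γ - x ^ γ ≤ γ * y ^ (γ - 1) * (y - x) := by
      have hb := one_add_mul_self_le_rpow_one_add (s := x / y - 1)
        (by have : 0 ≤ x / y := by positivity
            linarith) hγ.le
      rw [add_sub_cancel, Real.div_rpow hx hy.le, le_div_iff₀ (by positivity)] at hb
      have e : y ^ γ = y ^ (γ - 1) * y := by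
        rw [Real.rpow_sub_one hy.ne', div_mul_cancel₀ _ hy.ne']
      have e2 : γ * y ^ (γ - 1) * (y - x) = y ^ γ - (1 + γ * (x / y - 1)) * y ^ γ := by
        rw [e]; field_simp; ring
      linarith
    have hmono : x ^ (γ - 1) ≤ y ^ (γ - 1) := Real.rpow_le_rpow hx h (by linarith)
    have h2 : (y ^ (γ - 1) - x ^ (γ - 1)) * x ≤ γ * y ^ (γ - 1) * ‖z - w‖ := by
      have e : y ^ γ = y ^ (γ - 1) * y := by
        rw [Real.rpow_sub_one hy.ne', div_mul_cancel₀ _ hy.ne']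
      have e' : x ^ γ = x ^ (γ - 1) * x := by
        have := norm_nonlinearity hγ w
        rw [nonlinearity, norm_mul, Complex.norm_real, Real.norm_of_nonneg (by positivity)] at this
        exact this.symm
      calc (y ^ (γ - 1) - x ^ (γ - 1)) * x = y ^ (γ - 1) * x - x ^ γ := by rw [e']; ring
        _ ≤ y ^ (γ - 1) * y - x ^ γ := by gcongr
        _ ≤ γ * y ^ (γ - 1) * (y - x) := by rw [← e]; exact h1
        _ ≤ _ := by
          have : y - x ≤ ‖z - w‖ := norm_sub_norm_le z w
          gcongr
    have h3 : nonlinearity γ z - nonlinearity γ w =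
        ((y ^ (γ - 1) : ℝ) : ℂ) * (z - w) + ((y ^ (γ - 1) - x ^ (γ - 1) : ℝ) : ℂ) * w := by
      simp only [nonlinearity, x, y]
      push_cast
      ring
    rw [h3]
    refine (norm_add_le _ _).trans ?_
    rw [norm_mul, norm_mul, Complex.norm_real, Complex.norm_real, Real.norm_of_nonneg (by positivity),
      Real.norm_of_nonneg (by linarith)]
    calc _ ≤ y ^ (γ - 1) * ‖z - w‖ + γ * y ^ (γ - 1) * ‖z - w‖ := by gcongr
      _ = (1 + γ) * y ^ (γ - 1) * ‖z - w‖ := by ring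
      _ ≤ _ := by
        have hle : y ≤ y + x := by linarith
        gcongr
  rcases le_total ‖w‖ ‖z‖ with h | h
  · exact key z w h
  · rw [norm_sub_rev, norm_sub_rev z, add_comm ‖z‖]
    exact key w z h

theorem enorm_nonlinearity_sub_le {γ : ℝ} (hγ : 1 < γ) (z w : ℂ) :
    ‖nonlinearity γ z - nonlinearity γ w‖ₑ ≤
      ENNReal.ofReal (1 + γ) * ((‖z‖ₑ + ‖w‖ₑ) ^ (γ - 1) * ‖z - w‖ₑ) := by
  rw [← ofReal_norm, ← ofReal_norm, ← ofReal_norm, ← ofReal_norm,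
    ← ENNReal.ofReal_add (norm_nonneg _) (norm_nonneg _),
    ENNReal.ofReal_rpow_of_nonneg (by positivity) (by linarith), ← ENNReal.ofReal_mul (by positivity),
    ← ENNReal.ofReal_mul (by linarith), ← mul_assoc]
  exact ENNReal.ofReal_le_ofReal (norm_nonlinearity_sub_le hγ z w)

/-! ### Estimates of the positive Duhamel operator -/

/-- The relations between the exponents of the problem. -/
structure Exponents (N : ℕ) (θ γ p q a b : ℝ) : Prop where
  θ_pos : 0 < θ
  one_lt : 1 < γ
  le_q : γ ≤ q
  q_le : q ≤ p
  a_pos : 0 < a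
  a_mul_lt : a * γ < 1
  b_eq : b = N / (p * θ) + a
  critical : N * (γ - 1) / (p * θ) + a * (γ - 1) ≤ 1

namespace Exponents

variable {θ γ p q a b : ℝ}

theorem one_lt_q (E : Exponents N θ γ p q a b) : 1 < q := E.one_lt.trans_le E.le_q

theorem p_pos (E : Exponents N θ γ p q a b) : 0 < p := by linarith [E.one_lt_q, E.q_le]

theorem alpha_lt (E : Exponents N θ γ p q a b) : N * (γ - 1) / (p * θ) < 1 := by
  have := mul_pos E.a_pos (sub_pos.2 E.one_lt)
  linarith [E.critical]

theorem alpha_nonneg (E : Exponents N θ γ p q a b) : 0 ≤ N * (γ - 1) / (p * θ) := by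
  have h1 := sub_pos.2 E.one_lt
  have h2 := E.p_pos
  have h3 := E.θ_pos
  positivity

theorem a_le_b (E : Exponents N θ γ p q a b) : a ≤ b := by
  have h2 := E.p_pos
  have h3 := E.θ_pos
  have : 0 ≤ (N : ℝ) / (p * θ) := by positivity
  linarith [E.b_eq]

theorem b_pos (E : Exponents N θ γ p q a b) : 0 < b := E.a_pos.trans_le E.a_le_b

theorem lt_order (E : Exponents N θ γ p q a b) : (N : ℝ) < N + θ / 2 := by linarith [E.θ_pos]

end Exponents

/-- The positive majorant of the Duhamel term. -/
def posDuhamel (e θ γ : ℝ) (U W : ℝ → Sp N → ℝ≥0∞) (t : ℝ) (x : Sp N) : ℝ≥0∞ :=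
  ∫⁻ τ in Set.Ioo 0 t, posOp e ((t - τ) ^ (1 / θ)) (fun y => U τ y ^ (γ - 1) * W τ y) x

theorem measurable_posOp_param {e : ℝ} {r : ℝ → ℝ} (hr : Measurable r) {F : ℝ → Sp N → ℝ≥0∞}
    (hF : Measurable fun z : ℝ × Sp N => F z.1 z.2) :
    Measurable fun z : ℝ × Sp N => posOp e (r z.1) (F z.1) z.2 := by
  have h1 : Measurable fun z : (ℝ × Sp N) × Sp N => profile N e (r z.1.1) (z.1.2 - z.2) * F z.1.1 z.2 := by
    have h2 : Measurable fun z : (ℝ × Sp N) × Sp N => r z.1.1 := hr.comp (measurable_fst.comp measurable_fst)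
    refine Measurable.mul ?_ (hF.comp ((measurable_fst.comp measurable_fst).prodMk measurable_snd))
    unfold profile
    refine ENNReal.measurable_ofReal.comp ?_
    refine (h2.inv.pow_const N).mul (Measurable.pow_const (Measurable.const_add (Measurable.norm ?_) _) _)
    exact h2.inv.smul ((measurable_snd.comp measurable_fst).sub measurable_snd)
  exact h1.lintegral_prod_right'

/-- The Morrey bound integrates `(t-τ)^{-α} τ^{-aγ}`, with both exponents below one, and gives
`t^{1-α-aγ}`, which `critical` and `t ≤ 1` bound by `t^{-a}`. It uses no sup bound on `W`. The sup
bound needs different estimates on the two halves of the time interval. -/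
theorem Exponents.exists_posDuhamel_le {θ γ p q a b : ℝ} (E : Exponents N θ γ p q a b) :
    ∃ C : ℝ, 0 < C ∧ ∀ t : ℝ, 0 < t → t ≤ 1 → ∀ U W : ℝ → Sp N → ℝ≥0∞,
      (Measurable fun z : ℝ × Sp N => U z.1 z.2) → (Measurable fun z : ℝ × Sp N => W z.1 z.2) →
      ∀ A D : ℝ, 0 < A → 0 < D →
      (∀ τ ∈ Set.Ioo 0 t, Mor p q (U τ) (ENNReal.ofReal (A * τ ^ (-a)))) →
      (∀ τ ∈ Set.Ioo 0 t, Mor p q (W τ) (ENNReal.ofReal (D * τ ^ (-a)))) →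
      Mor p q (posDuhamel (N + θ / 2) θ γ U W t) (ENNReal.ofReal (C * A ^ (γ - 1) * D * t ^ (-a))) ∧
      ((∀ τ ∈ Set.Ioo 0 t, ∀ y, W τ y ≤ ENNReal.ofReal (D * τ ^ (-b))) →
        ∀ x, posDuhamel (N + θ / 2) θ γ U W t x ≤ ENNReal.ofReal (C * A ^ (γ - 1) * D * t ^ (-b))) := by
  obtain ⟨C₀, h₀, H₀⟩ := exists_posOp_product (N := N) (p := p) E.θ_pos E.one_lt E.le_q E.lt_order
  have hα1 := E.alpha_lt
  have hα0 := E.alpha_nonneg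
  have hcrit := E.critical
  have haγ := E.a_mul_lt
  have ha := E.a_pos
  have hb := E.b_pos
  have hθ := E.θ_pos
  have hp := E.p_pos
  have hγ := E.one_lt
  have hq : 0 < q := by linarith [E.one_lt_q]
  set α := N * (γ - 1) / (p * θ) with hα
  have hα' : N * γ / (p * θ) = α + (b - a) := by
    rw [hα, E.b_eq]; ring
  have hL : 0 < 1 / (1 - a * γ) + 1 / (1 - α) := by
    have h1 : 0 < 1 - a * γ := by linarith
    have h2 : 0 < 1 - α := by linarith
    positivity
  refine ⟨C₀ * (2 ^ a + 2 ^ b) * (1 / (1 - a * γ) + 1 / (1 - α)), by positivity,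
    fun t ht ht1 U W hU hW A D hA hD hUA hWD => ?_⟩
  have hprod := fun τ (hτ : τ ∈ Set.Ioo 0 t) => H₀ (t - τ) (by linarith [hτ.2]) (by linarith [hτ.1])
    (U τ) (W τ) (hU.comp measurable_prodMk_left) (hW.comp measurable_prodMk_left)
  have hpw : ∀ τ : ℝ, 0 < τ → (A * τ ^ (-a)) ^ (γ - 1) = A ^ (γ - 1) * τ ^ (-(a * (γ - 1))) := by
    intro τ hτ
    rw [Real.mul_rpow hA.le (by positivity), ← Real.rpow_mul hτ.le, neg_mul]
  have hpw2 : ∀ τ : ℝ, 0 < τ → τ ^ (-(a * (γ - 1))) * τ ^ (-a) = τ ^ (-(a * γ)) := by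
    intro τ hτ
    rw [← Real.rpow_add hτ]; congr 1; ring
  have hhalf : ∀ y c : ℝ, -c ≤ y → (t / 2) ^ y ≤ 2 ^ c * t ^ (-c) := by
    intro y c hy
    calc (t / 2) ^ y ≤ (t / 2) ^ (-c) := Real.rpow_le_rpow_of_exponent_ge (by positivity) (by linarith) hy
      _ = _ := by
        rw [Real.div_rpow ht.le (by norm_num), Real.rpow_neg (by norm_num : (0 : ℝ) ≤ 2), div_inv_eq_mul, mul_comm]
  have hfin : ∀ c y z : ℝ, -c ≤ y → -c ≤ z → (2 : ℝ) ^ c ≤ 2 ^ a + 2 ^ b →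
      C₀ * A ^ (γ - 1) * D * (t / 2) ^ y / (1 - a * γ) + C₀ * A ^ (γ - 1) * D * (t / 2) ^ z / (1 - α) ≤
      C₀ * (2 ^ a + 2 ^ b) * (1 / (1 - a * γ) + 1 / (1 - α)) * A ^ (γ - 1) * D * t ^ (-c) := by
    intro c y z hy hz hc
    have h1 : 0 < 1 - a * γ := by linarith
    have h2 : 0 < 1 - α := by linarith
    have h3 := hhalf y c hy
    have h4 := hhalf z c hz
    calc _ ≤ C₀ * A ^ (γ - 1) * D * (2 ^ c * t ^ (-c)) / (1 - a * γ) +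
          C₀ * A ^ (γ - 1) * D * (2 ^ c * t ^ (-c)) / (1 - α) := by gcongr
      _ = C₀ * 2 ^ c * (1 / (1 - a * γ) + 1 / (1 - α)) * A ^ (γ - 1) * D * t ^ (-c) := by ring
      _ ≤ _ := by gcongr
  have h2a : (2 : ℝ) ^ a ≤ 2 ^ a + 2 ^ b := le_add_of_nonneg_right (by positivity)
  have h2b : (2 : ℝ) ^ b ≤ 2 ^ a + 2 ^ b := le_add_of_nonneg_left (by positivity)
  have hK : 0 < C₀ * A ^ (γ - 1) * D := by positivity
  constructor
  · let k : ℝ → ℝ≥0∞ := fun τ => ENNReal.ofReal (C₀ * A ^ (γ - 1) * D * (t - τ) ^ (-α) * τ ^ (-(a * γ)))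
    have hk : Measurable k := by
      refine ENNReal.measurable_ofReal.comp ?_
      fun_prop
    have hG := measurable_posOp_param (e := N + θ / 2) (r := fun τ => (t - τ) ^ (1 / θ)) (by fun_prop)
      (F := fun τ y => U τ y ^ (γ - 1) * W τ y) ((hU.pow_const _).mul hW)
    have hmor := Mor.lintegral (p := p) E.one_lt_q (μ := volume.restrict (Set.Ioo 0 t)) hG hk
      ((ae_restrict_mem measurableSet_Ioo).mono fun τ hτ => by
        have h1 : 0 < τ := hτ.1
        have h2 : 0 < t - τ := by linarith [hτ.2]
        simp only [k, ne_eq, ENNReal.ofReal_eq_zero, not_le]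
        positivity)
      (Filter.Eventually.of_forall fun τ => ENNReal.ofReal_ne_top)
      ((ae_restrict_mem measurableSet_Ioo).mono fun τ hτ => by
        have h1 : 0 < τ := hτ.1
        refine ((hprod τ hτ _ _ 0 (by positivity) (by positivity) le_rfl (hUA τ hτ)).1 (hWD τ hτ)).mono hq
          (fun _ => le_rfl) (le_of_eq ?_)
        simp only [k]
        congr 1
        rw [hpw τ h1, ← hpw2 τ h1]
        ring)
    refine hmor.mono hq (fun _ => le_rfl) ?_
    refine (setLIntegral_le_of_halves ht haγ hα1 hK.le hK.le hα0 (by positivity : 0 ≤ a * γ)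
      (fun τ hτ _ => le_rfl) (fun τ hτ _ => le_of_eq ?_)).trans (ENNReal.ofReal_le_ofReal
        (hfin a (1 - a * γ - α) (1 - α - a * γ) (by linarith) (by linarith) h2a))
    congr 1
    ring
  · intro hWS x
    have hb1 : b - a ≥ 0 := by linarith [E.a_le_b]
    have hy : 0 ≤ a * (γ - 1) + b := by
      have := mul_pos ha (sub_pos.2 hγ)
      linarith
    -- Near `τ = 0` the Morrey bound of `W` keeps the singularity `τ^{-aγ}` integrable, but its
    -- factor `(t-τ)^{-Nγ/(pθ)}` need not be integrable at `t`. Near `τ = t` the sup bound of `W`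
    -- leaves only `(t-τ)^{-α}`, at the price of `τ^{-a(γ-1)-b}`. Both halves scale like
    -- `t^{1-α-a(γ-1)-b}`.
    refine (setLIntegral_le_of_halves ht haγ hα1 hK.le hK.le (x := N * γ / (p * θ)) (y := a * (γ - 1) + b)
      (by positivity) hy (fun τ hτ _ => ?_) (fun τ hτ _ => ?_)).trans (ENNReal.ofReal_le_ofReal
        (hfin b (1 - a * γ - N * γ / (p * θ)) (1 - α - (a * (γ - 1) + b)) (by linarith) (by linarith) h2b))
    · have h1 : 0 < τ := hτ.1
      refine ((hprod τ hτ _ _ 0 (by positivity) (by positivity) le_rfl (hUA τ hτ)).2.1 (hWD τ hτ) x).trans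
        (le_of_eq ?_)
      congr 1
      rw [hpw τ h1, ← hpw2 τ h1]
      ring
    · have h1 : 0 < τ := hτ.1
      refine ((hprod τ hτ _ 0 _ (by positivity) le_rfl (by positivity) (hUA τ hτ)).2.2 (hWS τ hτ) x).trans
        (le_of_eq ?_)
      congr 1
      rw [hpw τ h1, neg_add, Real.rpow_add h1]
      ring

end BesovMorrey
end

noncomputable section

namespace BesovMorrey

open MeasureTheory

variable {N : ℕ}

/-! ### The Duhamel term -/

/-- Continuous functions on `ℝ^N × (0,T)` that are bounded away from `t = 0` and whose local Morrey
norms are at most `A t^{-a}`. -/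
structure Controlled (p q a A T : ℝ) (u : Sp N → ℝ → ℂ) : Prop where
  cont : ContinuousOn (fun z : Sp N × ℝ => u z.1 z.2) (Set.univ ×ˢ Set.Ioo 0 T)
  bdd : ∀ τ ∈ Set.Ioo 0 T, ∃ C : ℝ, ∀ x, ∀ t ∈ Set.Ioo τ T, ‖u x t‖ ≤ C
  mor : ∀ t ∈ Set.Ioo 0 T, Mor p q (fun x => ‖u x t‖ₑ) (ENNReal.ofReal (A * t ^ (-a)))

/-- The integrand of the Duhamel term. -/
def duhamelIntegrand (θ γ : ℝ) (u : Sp N → ℝ → ℂ) (x : Sp N) (t τ : ℝ) : ℂ :=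
  semigroupFun θ (t - τ) (fun y => nonlinearity γ (u y τ)) x

/-- The Duhamel term. -/
def duhamel (θ γ : ℝ) (u : Sp N → ℝ → ℂ) (x : Sp N) (t : ℝ) : ℂ :=
  ∫ τ in (0 : ℝ)..t, duhamelIntegrand θ γ u x t τ

theorem duhamel_eq (θ γ : ℝ) (u : Sp N → ℝ → ℂ) (x : Sp N) {t : ℝ} (ht : 0 < t) :
    duhamel θ γ u x t = ∫ τ in Set.Ioo 0 t, duhamelIntegrand θ γ u x t τ := by
  rw [duhamel, intervalIntegral.integral_of_le ht.le, integral_Ioc_eq_integral_Ioo]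

section Slices

variable {p q a A T : ℝ} {u : Sp N → ℝ → ℂ}

theorem continuous_slice (hc : ContinuousOn (fun z : Sp N × ℝ => u z.1 z.2) (Set.univ ×ˢ Set.Ioo 0 T))
    {t : ℝ} (ht : t ∈ Set.Ioo 0 T) : Continuous fun x => u x t := by
  have h1 : Continuous fun x : Sp N => (x, t) := by fun_prop
  have h2 : ∀ x : Sp N, (x, t) ∈ (Set.univ ×ˢ Set.Ioo 0 T : Set (Sp N × ℝ)) := fun x =>
    Set.mk_mem_prod (Set.mem_univ x) ht
  exact hc.comp_continuous h1 h2

theorem Controlled.bdd_slice (hu : Controlled p q a A T u) {t : ℝ} (ht : t ∈ Set.Ioo 0 T) :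
    ∃ C : ℝ, 0 ≤ C ∧ ∀ x, ‖u x t‖ ≤ C := by
  have h0 : 0 < t := ht.1
  obtain ⟨C, hC⟩ := hu.bdd (t / 2) ⟨by positivity, by linarith [ht.2]⟩
  have := fun x => hC x t ⟨by linarith, ht.2⟩
  exact ⟨C, (norm_nonneg _).trans (this 0), this⟩

/-- Restriction of a function to `ℝ^N × (0,T)`, extended by zero. -/
def cut (T : ℝ) (u : Sp N → ℝ → ℂ) (x : Sp N) (t : ℝ) : ℂ := Set.indicator (Set.Ioo 0 T) (u x) t

theorem cut_of_mem {t : ℝ} (ht : t ∈ Set.Ioo 0 T) (x : Sp N) : cut T u x t = u x t :=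
  Set.indicator_of_mem ht _

/-- Minkowski's inequality in time needs joint measurability on the whole product, whereas
continuity is known only on `(0,T)`. -/
theorem measurable_cut (hc : ContinuousOn (fun z : Sp N × ℝ => u z.1 z.2) (Set.univ ×ˢ Set.Ioo 0 T)) :
    Measurable fun z : ℝ × Sp N => cut T u z.2 z.1 := by
  classical
  have h1 : ContinuousOn (fun z : ℝ × Sp N => u z.2 z.1) (Set.Ioo 0 T ×ˢ Set.univ) :=
    hc.comp continuous_swap.continuousOn fun z hz => Set.mk_mem_prod hz.2 hz.1
  have h2 := h1.measurable_piecewise (g := fun _ => (0 : ℂ)) continuousOn_const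
    (measurableSet_Ioo.prod MeasurableSet.univ)
  convert h2 using 1
  funext z
  by_cases hz : z.1 ∈ Set.Ioo 0 T
  · rw [cut_of_mem hz, Set.piecewise_eq_of_mem _ _ _ (Set.mk_mem_prod hz (Set.mem_univ z.2))]
  · rw [cut, Set.indicator_of_notMem hz, Set.piecewise_eq_of_notMem _ _ _ fun h => hz h.1]

end Slices

theorem integrable_heatKernel_mul (ζ : Cutoff) {θ C : ℝ} (hθ : 0 < θ) {g : Sp N → ℂ} (hg : Continuous g)
    (hC : ∀ y, ‖g y‖ ≤ C) (r : ℝ) (x : Sp N) :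
    Integrable fun z => heatKernel N θ 1 z * g (x - r • z) := by
  refine ((integrable_heatKernel_one ζ hθ).norm.mul_const C).mono'
    ((continuous_heatKernel_one ζ hθ).mul (hg.comp (by fun_prop))).aestronglyMeasurable
    (Filter.Eventually.of_forall fun z => ?_)
  rw [norm_mul]
  gcongr
  exact hC _

theorem semigroupFun_sub (ζ : Cutoff) {θ t C : ℝ} (hθ : 0 < θ) (ht : 0 < t) {f g : Sp N → ℂ}
    (hf : Continuous f) (hg : Continuous g) (hfC : ∀ y, ‖f y‖ ≤ C) (hgC : ∀ y, ‖g y‖ ≤ C) (x : Sp N) :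
    semigroupFun θ t f x - semigroupFun θ t g x = semigroupFun θ t (fun y => f y - g y) x := by
  rw [semigroupFun_eq hθ ht, semigroupFun_eq hθ ht, semigroupFun_eq hθ ht,
    ← integral_sub (integrable_heatKernel_mul ζ hθ hf hfC _ x) (integrable_heatKernel_mul ζ hθ hg hgC _ x)]
  simp only [mul_sub]

theorem tendsto_semigroupFun (ζ : Cutoff) {θ t C : ℝ} (hθ : 0 < θ) (ht : 0 < t) {f : ℕ → Sp N → ℂ}
    {g : Sp N → ℂ} (hf : ∀ n, Continuous (f n)) (hC : ∀ n y, ‖f n y‖ ≤ C)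
    (hlim : ∀ y, Filter.Tendsto (fun n => f n y) Filter.atTop (nhds (g y))) (x : Sp N) :
    Filter.Tendsto (fun n => semigroupFun θ t (f n) x) Filter.atTop (nhds (semigroupFun θ t g x)) := by
  simp only [semigroupFun_eq hθ ht]
  refine tendsto_integral_of_dominated_convergence (fun z => ‖heatKernel N θ 1 z‖ * C)
    (fun n => (integrable_heatKernel_mul ζ hθ (hf n) (hC n) _ x).aestronglyMeasurable)
    ((integrable_heatKernel_one ζ hθ).norm.mul_const C) (fun n => Filter.Eventually.of_forall fun z => ?_)
    (Filter.Eventually.of_forall fun z => (hlim _).const_mul _)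
  rw [norm_mul]
  gcongr
  exact hC n _

section Duhamel

variable {θ γ p q a b A T : ℝ} {u : Sp N → ℝ → ℂ}

/-- An integrable majorant in `τ`, uniform in `x` and in `t` away from zero. It also depends on `u`
only through `A` and `B`, so it dominates a whole sequence of iterates. -/
theorem Exponents.exists_integrand_le (ζ : Cutoff) (E : Exponents N θ γ p q a b) :
    ∃ K : ℝ, 0 ≤ K ∧ ∀ (A B T τ₀ : ℝ) (u : Sp N → ℝ → ℂ), 0 ≤ A → 0 ≤ B → T ≤ 1 → 0 < τ₀ →
      Controlled p q a A T u → (∀ x, ∀ t ∈ Set.Ioo τ₀ T, ‖u x t‖ ≤ B) →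
      ∀ x, ∀ t ∈ Set.Ioo (2 * τ₀) T, ∀ τ ∈ Set.Ioo 0 t, ‖duhamelIntegrand θ γ u x t τ‖ ≤
        K * (A ^ (γ - 1) * A * τ₀ ^ (-(N * γ / (p * θ))) * τ ^ (-(a * γ)) + B ^ γ) := by
  have hθ := E.θ_pos
  have hγ := E.one_lt
  have hp := E.p_pos
  have ha := E.a_pos
  obtain ⟨C₀, h₀, H₀⟩ := exists_posOp_product (N := N) (p := p) hθ hγ E.le_q E.lt_order
  obtain ⟨C₁, h₁, H₁⟩ := exists_semigroupFun_le N ζ hθ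
  set μ₀ := (profileMass N (N + θ / 2)).toReal
  have hμ₀ : 0 ≤ μ₀ := ENNReal.toReal_nonneg
  have hμ : profileMass N (N + θ / 2) = ENNReal.ofReal μ₀ :=
    (ENNReal.ofReal_toReal (profileMass_lt_top E.lt_order).ne).symm
  refine ⟨C₁ * max C₀ μ₀, by positivity, fun A B T τ₀ u hA hB hT hτ₀ hu hb x t ht τ hτ => ?_⟩
  have hτ0 : 0 < τ := hτ.1
  have htτ : 0 < t - τ := by linarith [hτ.2]
  have htτ1 : t - τ ≤ 1 := by linarith [ht.2]
  have hτT : τ ∈ Set.Ioo 0 T := ⟨hτ0, hτ.2.trans ht.2⟩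
  have hK := H₁ (t - τ) htτ (fun y => nonlinearity γ (u y τ)) x
  have hpos : ∀ X Y : ℝ, 0 ≤ X → 0 ≤ Y → X ≤ X + Y ∧ Y ≤ X + Y := fun X Y hX hY => ⟨by linarith, by linarith⟩
  have hsum := hpos (A ^ (γ - 1) * A * τ₀ ^ (-(N * γ / (p * θ))) * τ ^ (-(a * γ))) (B ^ γ)
    (by positivity) (by positivity)
  have hnn : 0 ≤ A ^ (γ - 1) * A * τ₀ ^ (-(N * γ / (p * θ))) * τ ^ (-(a * γ)) + B ^ γ := by positivity
  rw [← ENNReal.ofReal_le_ofReal_iff (by positivity), ofReal_norm]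
  refine hK.trans ?_
  rw [mul_assoc, ENNReal.ofReal_mul h₁]
  refine mul_le_mul' le_rfl ?_
  -- For `τ ≤ τ₀` one has `t - τ ≥ τ₀`, so the smoothing from Morrey to sup is not singular; for `τ
  -- > τ₀` the function is bounded by `B`.
  rcases le_or_gt τ τ₀ with h | h
  · have hm : Measurable fun y => ‖u y τ‖ₑ := (continuous_slice hu.cont hτT).enorm.measurable
    have hAτ : 0 ≤ A * τ ^ (-a) := by positivity
    have h2 := ((H₀ (t - τ) htτ htτ1 _ _ hm hm _ _ 0 hAτ hAτ le_rfl (hu.mor τ hτT)).2.1 (hu.mor τ hτT)) x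
    refine (posOp_mono (fun y => le_of_eq ?_) x).trans (h2.trans (ENNReal.ofReal_le_ofReal ?_))
    · rw [nonlinearity, enorm_mul]
      congr 1
      rw [← ofReal_norm, ← ofReal_norm, Complex.norm_real, Real.norm_of_nonneg (by positivity),
        ENNReal.ofReal_rpow_of_nonneg (norm_nonneg _) (by linarith)]
    · have h3 : (t - τ) ^ (-(N * γ / (p * θ))) ≤ τ₀ ^ (-(N * γ / (p * θ))) := by
        refine Real.rpow_le_rpow_of_nonpos hτ₀ (by linarith [ht.1]) ?_
        have : 0 ≤ N * γ / (p * θ) := by positivity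
        linarith
      have h4 : (A * τ ^ (-a)) ^ (γ - 1) * (A * τ ^ (-a)) = A ^ (γ - 1) * A * τ ^ (-(a * γ)) := by
        rw [Real.mul_rpow hA (by positivity), ← Real.rpow_mul hτ0.le,
          show -(a * γ) = -a * (γ - 1) + -a by ring, Real.rpow_add hτ0]
        ring
      calc _ = C₀ * (A ^ (γ - 1) * A * (t - τ) ^ (-(N * γ / (p * θ))) * τ ^ (-(a * γ))) := by
            rw [mul_assoc C₀, h4]; ring
        _ ≤ max C₀ μ₀ * (A ^ (γ - 1) * A * τ₀ ^ (-(N * γ / (p * θ))) * τ ^ (-(a * γ))) := by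
            gcongr
            exact le_max_left _ _
        _ ≤ _ := mul_le_mul_of_nonneg_left hsum.1 (by positivity)
  · refine (posOp_le_mul_sup E.lt_order (by positivity) (S := ENNReal.ofReal (B ^ γ)) (fun y => ?_) x).trans ?_
    · rw [← ofReal_norm, norm_nonlinearity hγ]
      refine ENNReal.ofReal_le_ofReal ?_
      gcongr
      exact hb y τ ⟨h, hτT.2⟩
    · rw [hμ, ← ENNReal.ofReal_mul hμ₀]
      refine ENNReal.ofReal_le_ofReal ?_
      exact mul_le_mul (le_max_right _ _) hsum.2 (by positivity) (by positivity)

theorem integrableOn_majorant (K A B c : ℝ) {d : ℝ} (hd : d < 1) :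
    IntegrableOn (fun τ : ℝ => K * (A * c * τ ^ (-d) + B)) (Set.Ioo 0 1) := by
  have h1 : IntegrableOn (fun τ : ℝ => τ ^ (-d)) (Set.Ioo 0 1) :=
    (intervalIntegrable_iff_integrableOn_Ioo_of_le zero_le_one).1
      (intervalIntegral.intervalIntegrable_rpow' (by linarith))
  exact ((h1.const_mul (A * c)).add (integrableOn_const (by simp))).const_mul K

theorem Controlled.continuousOn_nonlinearity (hγ : 1 < γ) (hu : Controlled p q a A T u) :
    ContinuousOn (fun z : ℝ × Sp N => nonlinearity γ (u z.2 z.1)) (Set.Ioo 0 T ×ˢ Set.univ) :=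
  (continuous_nonlinearity hγ).comp_continuousOn
    (hu.cont.comp continuous_swap.continuousOn fun _ hz => Set.mk_mem_prod hz.2 hz.1)

theorem Controlled.continuousOn_integrand (ζ : Cutoff) (hθ : 0 < θ) (hγ : 1 < γ)
    (hu : Controlled p q a A T u) (x : Sp N) {t : ℝ} (ht : t < T) :
    ContinuousOn (duhamelIntegrand θ γ u x t) (Set.Ioo 0 t) := by
  intro τ hτ
  have hτ0 : 0 < τ := hτ.1
  obtain ⟨C, hC⟩ := hu.bdd (τ / 2) ⟨by positivity, by linarith [hτ.2]⟩
  have hsub : Set.Ioo (τ / 2) t ⊆ Set.Ioo 0 T := Set.Ioo_subset_Ioo (by positivity) ht.le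
  have h1 : ContinuousOn (fun τ => semigroupFun θ (t - τ) (fun y => nonlinearity γ (u y τ)) x)
      (Set.Ioo (τ / 2) t) :=
    continuousOn_semigroupFun ζ hθ (C := C ^ γ) (σ := fun τ => t - τ) (ξ := fun _ => x) (by fun_prop)
      (fun τ hτ => sub_pos.2 hτ.2) continuousOn_const
      ((hu.continuousOn_nonlinearity hγ).mono (Set.prod_mono hsub le_rfl)) fun τ' hτ' y => by
        rw [norm_nonlinearity hγ]
        exact Real.rpow_le_rpow (norm_nonneg _) (hC y τ' ⟨hτ'.1, hτ'.2.trans ht⟩) (by linarith)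
  exact (h1.continuousAt (Ioo_mem_nhds (by linarith) hτ.2)).continuousWithinAt

theorem Controlled.exists_majorant (ζ : Cutoff) (E : Exponents N θ γ p q a b) (hA : 0 ≤ A) (hT : T ≤ 1)
    (hu : Controlled p q a A T u) {τ₀ : ℝ} (hτ₀ : 0 < τ₀) (hτT : τ₀ < T) :
    ∃ g : ℝ → ℝ, IntegrableOn g (Set.Ioo 0 1) ∧ (∀ τ ∈ Set.Ioo (0 : ℝ) 1, 0 ≤ g τ) ∧
      ∀ x, ∀ t ∈ Set.Ioo (2 * τ₀) T, ∀ τ ∈ Set.Ioo 0 t, ‖duhamelIntegrand θ γ u x t τ‖ ≤ g τ := by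
  obtain ⟨K, hK, H⟩ := E.exists_integrand_le ζ
  obtain ⟨B, hB⟩ := hu.bdd τ₀ ⟨hτ₀, hτT⟩
  have h0 : 0 ≤ max B 0 := le_max_right _ _
  refine ⟨_, integrableOn_majorant K (A ^ (γ - 1) * A) (max B 0 ^ γ) (τ₀ ^ (-(N * γ / (p * θ)))) E.a_mul_lt,
    fun τ hτ => ?_, H A (max B 0) T τ₀ u hA h0 hT hτ₀ hu fun x t ht => (hB x t ht).trans (le_max_left _ _)⟩
  have := hτ.1
  positivity

theorem Controlled.integrableOn_integrand (ζ : Cutoff) (E : Exponents N θ γ p q a b) (hA : 0 ≤ A) (hT : T ≤ 1)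
    (hu : Controlled p q a A T u) (x : Sp N) {t : ℝ} (ht : t ∈ Set.Ioo 0 T) :
    IntegrableOn (duhamelIntegrand θ γ u x t) (Set.Ioo 0 t) := by
  have ht0 : 0 < t := ht.1
  obtain ⟨g, hg, -, hle⟩ := hu.exists_majorant ζ E hA hT (τ₀ := t / 3) (by positivity) (by linarith [ht.2])
  refine Integrable.mono' (hg.mono_set (Set.Ioo_subset_Ioo_right (ht.2.le.trans hT)))
    ((hu.continuousOn_integrand ζ E.θ_pos E.one_lt x ht.2).aestronglyMeasurable measurableSet_Ioo) ?_
  exact (ae_restrict_mem measurableSet_Ioo).mono fun τ hτ => hle x t ⟨by linarith, ht.2⟩ τ hτ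

theorem Controlled.intervalIntegrable (ζ : Cutoff) (E : Exponents N θ γ p q a b) (hA : 0 ≤ A) (hT : T ≤ 1)
    (hu : Controlled p q a A T u) (x : Sp N) {t : ℝ} (ht : t ∈ Set.Ioo 0 T) :
    IntervalIntegrable (duhamelIntegrand θ γ u x t) volume 0 t :=
  (intervalIntegrable_iff_integrableOn_Ioo_of_le ht.1.le).2 (hu.integrableOn_integrand ζ E hA hT x ht)

theorem Controlled.continuousOn_duhamel (ζ : Cutoff) (E : Exponents N θ γ p q a b) (hA : 0 ≤ A) (hT : T ≤ 1)
    (hu : Controlled p q a A T u) :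
    ContinuousOn (fun z : Sp N × ℝ => duhamel θ γ u z.1 z.2) (Set.univ ×ˢ Set.Ioo 0 T) := by
  rintro ⟨x₀, t₀⟩ ⟨-, ht₀⟩
  have ht₀ : t₀ ∈ Set.Ioo 0 T := ht₀
  have h0 : 0 < t₀ := ht₀.1
  refine ContinuousAt.continuousWithinAt ?_
  obtain ⟨g, hg, hg0, hle⟩ := hu.exists_majorant ζ E hA hT (τ₀ := t₀ / 3) (by positivity) (by linarith [ht₀.2])
  have hnear : ∀ᶠ z : Sp N × ℝ in nhds (x₀, t₀), z.2 ∈ Set.Ioo (2 * (t₀ / 3)) T :=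
    continuousAt_snd.eventually (Ioo_mem_nhds (by linarith) ht₀.2)
  have heq : (fun z : Sp N × ℝ => duhamel θ γ u z.1 z.2) =ᶠ[nhds (x₀, t₀)] fun z =>
      ∫ τ, Set.indicator (Set.Ioo 0 z.2) (duhamelIntegrand θ γ u z.1 z.2) τ := by
    filter_upwards [hnear] with z hz
    rw [duhamel_eq _ _ _ _ (by linarith [hz.1]), integral_indicator measurableSet_Ioo]
  refine ContinuousAt.congr ?_ heq.symm
  refine continuousAt_of_dominated (bound := Set.indicator (Set.Ioo 0 1) g) ?_ ?_
    ((integrable_indicator_iff measurableSet_Ioo).2 hg) ?_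
  · filter_upwards [hnear] with z hz
    exact (aestronglyMeasurable_indicator_iff measurableSet_Ioo).2
      ((hu.continuousOn_integrand ζ E.θ_pos E.one_lt z.1 hz.2).aestronglyMeasurable measurableSet_Ioo)
  · filter_upwards [hnear] with z hz
    refine Filter.Eventually.of_forall fun τ => ?_
    by_cases hτ : τ ∈ Set.Ioo 0 z.2
    · have hτ1 : τ ∈ Set.Ioo (0 : ℝ) 1 := ⟨hτ.1, hτ.2.trans (hz.2.trans_le hT)⟩
      rw [Set.indicator_of_mem hτ, Set.indicator_of_mem hτ1]
      exact hle z.1 z.2 hz τ hτ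
    · rw [Set.indicator_of_notMem hτ, norm_zero]
      exact Set.indicator_nonneg hg0 τ
  -- With the domain of integration moved into an indicator, the integrand is continuous at `(x₀,
  -- t₀)` for every `τ` except the endpoint `τ = t₀`.
  · have hne : ∀ᵐ τ : ℝ, τ ≠ t₀ := by simp [ae_iff, measure_singleton]
    filter_upwards [hne] with τ hτ
    rcases le_or_gt τ 0 with h | h
    · have : ∀ z : Sp N × ℝ, Set.indicator (Set.Ioo 0 z.2) (duhamelIntegrand θ γ u z.1 z.2) τ = 0 :=
        fun z => Set.indicator_of_notMem (fun h' => absurd h'.1 (not_lt.2 h)) _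
      simp only [this]
      exact continuousAt_const
    rcases lt_or_gt_of_ne hτ with h' | h'
    · have hτT : τ ∈ Set.Ioo 0 T := ⟨h, h'.trans ht₀.2⟩
      obtain ⟨C, hC0, hC⟩ := hu.bdd_slice hτT
      have h2 : ContinuousOn (fun z : Sp N × ℝ => semigroupFun θ (z.2 - τ) (fun y => nonlinearity γ (u y τ)) z.1)
          (Set.univ ×ˢ Set.Ioi τ) :=
        continuousOn_semigroupFun ζ E.θ_pos (C := C ^ γ) (σ := fun z : Sp N × ℝ => z.2 - τ) (by fun_prop)
          (fun z hz => sub_pos.2 hz.2) continuousOn_fst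
          (((continuous_nonlinearity E.one_lt).comp (continuous_slice hu.cont hτT)).comp
            continuous_snd).continuousOn fun _ _ y => by
              rw [norm_nonlinearity E.one_lt]
              exact Real.rpow_le_rpow (norm_nonneg _) (hC y) (by linarith [E.one_lt])
      have h3 := h2.continuousAt ((isOpen_univ.prod isOpen_Ioi).mem_nhds
        (Set.mk_mem_prod (Set.mem_univ x₀) (Set.mem_Ioi.2 h')))
      refine h3.congr ?_
      filter_upwards [continuousAt_snd.eventually (Ioi_mem_nhds h')] with z hz
      exact (Set.indicator_of_mem (s := Set.Ioo 0 z.2) (Set.mem_Ioo.2 ⟨h, hz⟩)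
        (duhamelIntegrand θ γ u z.1 z.2)).symm
    · refine (continuousAt_const (y := (0 : ℂ))).congr ?_
      filter_upwards [continuousAt_snd.eventually (Iio_mem_nhds h')] with z hz
      have hz : z.2 < τ := hz
      exact (Set.indicator_of_notMem (s := Set.Ioo 0 z.2) (fun h'' => absurd h''.2 (not_lt.2 hz.le))
        (duhamelIntegrand θ γ u z.1 z.2)).symm

theorem tendsto_duhamel (ζ : Cutoff) (E : Exponents N θ γ p q a b) (hA : 0 ≤ A) (hT : T ≤ 1)
    {v : ℕ → Sp N → ℝ → ℂ} (hv : ∀ n, Controlled p q a A T (v n))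
    (hbd : ∀ τ ∈ Set.Ioo 0 T, ∃ B : ℝ, ∀ n x, ∀ t ∈ Set.Ioo τ T, ‖v n x t‖ ≤ B)
    (hlim : ∀ x, ∀ t ∈ Set.Ioo 0 T, Filter.Tendsto (fun n => v n x t) Filter.atTop (nhds (u x t)))
    (x : Sp N) {t : ℝ} (ht : t ∈ Set.Ioo 0 T) :
    Filter.Tendsto (fun n => duhamel θ γ (v n) x t) Filter.atTop (nhds (duhamel θ γ u x t)) := by
  have ht0 : 0 < t := ht.1
  have hγ := E.one_lt
  obtain ⟨K, hK, H⟩ := E.exists_integrand_le ζ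
  obtain ⟨B, hB⟩ := hbd (t / 3) ⟨by positivity, by linarith [ht.2]⟩
  have h0 : 0 ≤ max B 0 := le_max_right _ _
  simp only [duhamel_eq _ _ _ _ ht0]
  refine tendsto_integral_of_dominated_convergence _
    (fun n => ((hv n).integrableOn_integrand ζ E hA hT x ht).aestronglyMeasurable)
    ((integrableOn_majorant K (A ^ (γ - 1) * A) (max B 0 ^ γ) ((t / 3) ^ (-(N * γ / (p * θ)))) E.a_mul_lt).mono_set
      (Set.Ioo_subset_Ioo_right (ht.2.le.trans hT)))
    (fun n => (ae_restrict_mem measurableSet_Ioo).mono fun τ hτ =>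
      H A (max B 0) T (t / 3) (v n) hA h0 hT (by positivity) (hv n)
        (fun x t ht => (hB n x t ht).trans (le_max_left _ _)) x t ⟨by linarith, ht.2⟩ τ hτ)
    ((ae_restrict_mem measurableSet_Ioo).mono fun τ hτ => ?_)
  have hτ0 : 0 < τ := hτ.1
  have hτT : τ ∈ Set.Ioo 0 T := ⟨hτ.1, hτ.2.trans ht.2⟩
  obtain ⟨B', hB'⟩ := hbd (τ / 2) ⟨by positivity, by linarith [hτT.2]⟩
  refine tendsto_semigroupFun ζ E.θ_pos (sub_pos.2 hτ.2) (C := B' ^ γ)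
    (f := fun n y => nonlinearity γ (v n y τ)) (g := fun y => nonlinearity γ (u y τ))
    (fun n => (continuous_nonlinearity hγ).comp (continuous_slice (hv n).cont hτT)) (fun n y => ?_)
    (fun y => ((continuous_nonlinearity hγ).tendsto _).comp (hlim y τ hτT)) x
  rw [norm_nonlinearity hγ]
  exact Real.rpow_le_rpow (norm_nonneg _) (hB' n y τ ⟨by linarith, hτT.2⟩) (by linarith)

/-- The Duhamel term is Lipschitz continuous, in terms of the positive majorant. -/
theorem exists_enorm_duhamel_sub_le (ζ : Cutoff) (hθ : 0 < θ) (hγ : 1 < γ) :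
    ∃ C : ℝ, 0 ≤ C ∧ ∀ (A T : ℝ) (u v : Sp N → ℝ → ℂ), Controlled p q a A T u → Controlled p q a A T v →
      ∀ (x : Sp N) (t : ℝ), t ∈ Set.Ioo 0 T →
      IntervalIntegrable (duhamelIntegrand θ γ u x t) volume 0 t →
      IntervalIntegrable (duhamelIntegrand θ γ v x t) volume 0 t →
      ‖duhamel θ γ u x t - duhamel θ γ v x t‖ₑ ≤ ENNReal.ofReal C *
        posDuhamel (N + θ / 2) θ γ (fun τ y => ‖cut T u y τ‖ₑ + ‖cut T v y τ‖ₑ)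
          (fun τ y => ‖cut T u y τ - cut T v y τ‖ₑ) t x := by
  obtain ⟨C₁, h₁, H₁⟩ := exists_semigroupFun_le N ζ hθ
  refine ⟨C₁ * (1 + γ), by positivity, fun A T u v hu hv x t ht hui hvi => ?_⟩
  rw [duhamel, duhamel, ← intervalIntegral.integral_sub hui hvi, intervalIntegral.integral_of_le ht.1.le,
    integral_Ioc_eq_integral_Ioo, posDuhamel, ← lintegral_const_mul' _ _ ENNReal.ofReal_ne_top]
  refine (enorm_integral_le_lintegral_enorm _).trans (setLIntegral_mono' measurableSet_Ioo fun τ hτ => ?_)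
  have hτT : τ ∈ Set.Ioo 0 T := ⟨hτ.1, hτ.2.trans ht.2⟩
  obtain ⟨B₁, hB₁0, hB₁⟩ := hu.bdd_slice hτT
  obtain ⟨B₂, hB₂0, hB₂⟩ := hv.bdd_slice hτT
  have hB : ∀ w : Sp N → ℝ → ℂ, (∀ y, ‖w y τ‖ ≤ B₁ + B₂) → ∀ y, ‖nonlinearity γ (w y τ)‖ ≤ (B₁ + B₂) ^ γ :=
    fun w hw y => by
      rw [norm_nonlinearity hγ]
      exact Real.rpow_le_rpow (norm_nonneg _) (hw y) (by linarith)
  rw [duhamelIntegrand, duhamelIntegrand, semigroupFun_sub ζ hθ (sub_pos.2 hτ.2)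
    (f := fun y => nonlinearity γ (u y τ)) (g := fun y => nonlinearity γ (v y τ))
    ((continuous_nonlinearity hγ).comp (continuous_slice hu.cont hτT))
    ((continuous_nonlinearity hγ).comp (continuous_slice hv.cont hτT))
    (hB u fun y => (hB₁ y).trans (by linarith)) (hB v fun y => (hB₂ y).trans (by linarith))]
  refine (H₁ (t - τ) (sub_pos.2 hτ.2) _ x).trans ?_
  rw [ENNReal.ofReal_mul h₁, mul_assoc]
  refine mul_le_mul' le_rfl ?_
  rw [posOp, posOp, ← lintegral_const_mul' _ _ ENNReal.ofReal_ne_top]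
  refine lintegral_mono fun y => ?_
  simp only [cut_of_mem hτT]
  rw [mul_left_comm]
  exact mul_le_mul' le_rfl (enorm_nonlinearity_sub_le hγ _ _)

end Duhamel

end BesovMorrey
end

noncomputable section

namespace BesovMorrey

open MeasureTheory

variable {N : ℕ}

/-! ### Contraction and Picard iteration -/

/-- Fatou's lemma on each ball. -/
theorem Mor.of_tendsto {p q : ℝ} {F : ℕ → Sp N → ℝ≥0∞} {G : Sp N → ℝ≥0∞} {A : ℝ≥0∞}
    (hF : ∀ n, Measurable (F n)) (h : ∀ n, Mor p q (F n) A)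
    (hlim : ∀ x, Filter.Tendsto (fun n => F n x) Filter.atTop (nhds (G x))) : Mor p q G A := by
  intro x ρ h0 h1
  have e : ∀ y, G y ^ q = Filter.liminf (fun n => F n y ^ q) Filter.atTop := fun y =>
    ((ENNReal.continuous_rpow_const.tendsto _).comp (hlim y)).liminf_eq.symm
  simp only [e]
  refine (lintegral_liminf_le fun n => (hF n).pow_const q).trans ?_
  exact Filter.liminf_le_of_le (by isBoundedDefault) fun b hb =>
    let ⟨n, hn⟩ := hb.exists
    hn.trans (h n x ρ h0 h1)

theorem mor_zero {p q : ℝ} (hq : 0 < q) (A : ℝ≥0∞) : Mor p q (fun _ : Sp N => 0) A := by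
  intro x ρ h0 h1
  simp [ENNReal.zero_rpow_of_pos hq]

section Contraction

variable {θ γ p q a b A M T : ℝ} {u v : Sp N → ℝ → ℂ}

/-- The positive majorant is applied with `U = |u| + |v|`, whence `2A` and the factor `2^{γ-1}`. The
Morrey conclusion is kept apart from the sup conclusion because it alone is available in the
uniqueness proof. -/
theorem Exponents.exists_contraction (ζ : Cutoff) (E : Exponents N θ γ p q a b) :
    ∃ Λ : ℝ, 0 < Λ ∧ ∀ (A D T : ℝ) (u v : Sp N → ℝ → ℂ), 0 < A → 0 < D → T ≤ 1 →
      Controlled p q a A T u → Controlled p q a A T v → ∀ t ∈ Set.Ioo 0 T,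
      (∀ x, IntervalIntegrable (duhamelIntegrand θ γ u x t) volume 0 t) →
      (∀ x, IntervalIntegrable (duhamelIntegrand θ γ v x t) volume 0 t) →
      (∀ τ ∈ Set.Ioo 0 t, Mor p q (fun x => ‖u x τ - v x τ‖ₑ) (ENNReal.ofReal (D * τ ^ (-a)))) →
      Mor p q (fun x => ‖duhamel θ γ u x t - duhamel θ γ v x t‖ₑ)
        (ENNReal.ofReal (Λ * A ^ (γ - 1) * D * t ^ (-a))) ∧
      ((∀ τ ∈ Set.Ioo 0 t, ∀ x, ‖u x τ - v x τ‖ₑ ≤ ENNReal.ofReal (D * τ ^ (-b))) →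
        ∀ x, ‖duhamel θ γ u x t - duhamel θ γ v x t‖ₑ ≤ ENNReal.ofReal (Λ * A ^ (γ - 1) * D * t ^ (-b))) := by
  have hq : 0 < q := by linarith [E.one_lt_q]
  obtain ⟨C₀, h₀, H₀⟩ := E.exists_posDuhamel_le
  obtain ⟨C₁, h₁, H₁⟩ := exists_enorm_duhamel_sub_le (N := N) (p := p) (q := q) (a := a) ζ E.θ_pos E.one_lt
  refine ⟨(C₁ + 1) * C₀ * 2 ^ (γ - 1), by positivity,
    fun A D T u v hA hD hT hu hv t ht hui hvi huv => ?_⟩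
  have ht0 : 0 < t := ht.1
  have hT' : ∀ τ ∈ Set.Ioo 0 t, τ ∈ Set.Ioo 0 T := fun τ hτ => ⟨hτ.1, hτ.2.trans ht.2⟩
  have hmu := measurable_cut hu.cont
  have hmv := measurable_cut hv.cont
  have hslice : ∀ w : Sp N → ℝ → ℂ, Controlled p q a A T w → ∀ τ ∈ Set.Ioo 0 T, Measurable fun x => ‖w x τ‖ₑ :=
    fun w hw τ hτ => (continuous_slice hw.cont hτ).enorm.measurable
  have key := H₀ t ht0 (ht.2.le.trans hT) (fun τ y => ‖cut T u y τ‖ₑ + ‖cut T v y τ‖ₑ)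
    (fun τ y => ‖cut T u y τ - cut T v y τ‖ₑ) (hmu.enorm.add hmv.enorm) (hmu.sub hmv).enorm (2 * A) D
    (by positivity) hD (fun τ hτ => by
      simp only [cut_of_mem (hT' τ hτ)]
      refine (Mor.add E.one_lt_q (hslice u hu τ (hT' τ hτ)) (hslice v hv τ (hT' τ hτ)) (hu.mor τ (hT' τ hτ))
        (hv.mor τ (hT' τ hτ))).mono hq (fun _ => le_rfl) (le_of_eq ?_)
      have : 0 < τ := hτ.1
      rw [← ENNReal.ofReal_add (by positivity) (by positivity)]
      congr 1
      ring) (fun τ hτ => by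
      simp only [cut_of_mem (hT' τ hτ)]
      exact huv τ hτ)
  have hpt := fun x => H₁ A T u v hu hv x t ht (hui x) (hvi x)
  have hconst : ∀ c : ℝ, ENNReal.ofReal C₁ * ENNReal.ofReal (C₀ * (2 * A) ^ (γ - 1) * D * t ^ (-c)) ≤
      ENNReal.ofReal ((C₁ + 1) * C₀ * 2 ^ (γ - 1) * A ^ (γ - 1) * D * t ^ (-c)) := by
    intro c
    rw [← ENNReal.ofReal_mul h₁, Real.mul_rpow (by norm_num) hA.le]
    refine ENNReal.ofReal_le_ofReal ?_
    calc _ = C₁ * C₀ * 2 ^ (γ - 1) * A ^ (γ - 1) * D * t ^ (-c) := by ring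
      _ ≤ _ := by gcongr; linarith
  refine ⟨(key.1.const_mul hq ENNReal.ofReal_ne_top).mono hq hpt (hconst a), fun hsup x => ?_⟩
  refine (hpt x).trans ((mul_le_mul' le_rfl (key.2 (fun τ hτ y => ?_) x)).trans (hconst b))
  simp only [cut_of_mem (hT' τ hτ)]
  exact hsup τ hτ y

/-- The ball of radius `M` in the space where the solution is constructed. -/
structure InBall (p q a b M T : ℝ) (u : Sp N → ℝ → ℂ) : Prop where
  cont : ContinuousOn (fun z : Sp N × ℝ => u z.1 z.2) (Set.univ ×ˢ Set.Ioo 0 T)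
  mor : ∀ t ∈ Set.Ioo 0 T, Mor p q (fun x => ‖u x t‖ₑ) (ENNReal.ofReal (M * t ^ (-a)))
  sup : ∀ t ∈ Set.Ioo 0 T, ∀ x, ‖u x t‖ₑ ≤ ENNReal.ofReal (M * t ^ (-b))

theorem norm_le_of_enorm_le {z : ℂ} {c : ℝ} (hc : 0 ≤ c) (h : ‖z‖ₑ ≤ ENNReal.ofReal c) : ‖z‖ ≤ c := by
  rwa [← ofReal_norm, ENNReal.ofReal_le_ofReal_iff hc] at h

theorem InBall.norm_le (hb : 0 ≤ b) (hM : 0 ≤ M) (hu : InBall p q a b M T u) {τ : ℝ} (hτ : 0 < τ) (x : Sp N) {t : ℝ}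
    (ht : t ∈ Set.Ioo τ T) : ‖u x t‖ ≤ M * τ ^ (-b) := by
  have ht0 : 0 < t := hτ.trans ht.1
  refine (norm_le_of_enorm_le (by positivity) (hu.sup t ⟨ht0, ht.2⟩ x)).trans ?_
  have := Real.rpow_le_rpow_of_nonpos hτ ht.1.le (by linarith : -b ≤ 0)
  gcongr

theorem InBall.controlled (hb : 0 ≤ b) (hM : 0 ≤ M) (hu : InBall p q a b M T u) : Controlled p q a M T u :=
  ⟨hu.cont, fun _ hτ => ⟨_, fun x _ ht => hu.norm_le hb hM hτ.1 x ht⟩, hu.mor⟩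

theorem inBall_zero (hq : 0 < q) : InBall p q a b M T (fun (_ : Sp N) _ => (0 : ℂ)) :=
  ⟨continuousOn_const, fun _ _ => by simpa using mor_zero hq _, fun _ _ _ => by simp⟩

theorem duhamel_zero (θ γ : ℝ) (x : Sp N) (t : ℝ) : duhamel θ γ (fun _ _ => 0) x t = 0 := by
  simp [duhamel, duhamelIntegrand, semigroupFun, nonlinearity_zero]

/-- The Picard iterates for `u = L + D(u)`, where `D` is the Duhamel term. -/
def picard (θ γ : ℝ) (L : Sp N → ℝ → ℂ) : ℕ → Sp N → ℝ → ℂ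
  | 0 => fun _ _ => 0
  | n + 1 => fun x t => L x t + duhamel θ γ (picard θ γ L n) x t

/-- The radius and time are such that the Duhamel term is a contraction with factor `1/2`. -/
def Contracts (θ γ p q a b M T : ℝ) (N : ℕ) : Prop :=
  ∀ (D : ℝ) (u v : Sp N → ℝ → ℂ), 0 < D → Controlled p q a M T u → Controlled p q a M T v →
    ∀ t ∈ Set.Ioo 0 T,
    (∀ x, IntervalIntegrable (duhamelIntegrand θ γ u x t) volume 0 t) →
    (∀ x, IntervalIntegrable (duhamelIntegrand θ γ v x t) volume 0 t) →
    (∀ τ ∈ Set.Ioo 0 t, Mor p q (fun x => ‖u x τ - v x τ‖ₑ) (ENNReal.ofReal (D * τ ^ (-a)))) →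
    Mor p q (fun x => ‖duhamel θ γ u x t - duhamel θ γ v x t‖ₑ) (ENNReal.ofReal (D / 2 * t ^ (-a))) ∧
    ((∀ τ ∈ Set.Ioo 0 t, ∀ x, ‖u x τ - v x τ‖ₑ ≤ ENNReal.ofReal (D * τ ^ (-b))) →
      ∀ x, ‖duhamel θ γ u x t - duhamel θ γ v x t‖ₑ ≤ ENNReal.ofReal (D / 2 * t ^ (-b)))

/-- `M` is the solution of `Λ M^{γ-1} = 1/2`. The contraction comes from the size of `M`, not from
short time: when equality holds in `critical`, the time integral contributes no positive power of
`T`. -/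
theorem Exponents.exists_contracts (ζ : Cutoff) (E : Exponents N θ γ p q a b) :
    ∃ M : ℝ, 0 < M ∧ ∀ T ≤ 1, Contracts θ γ p q a b M T N := by
  obtain ⟨Λ, hΛ, H⟩ := E.exists_contraction ζ
  have hγ : 0 < γ - 1 := sub_pos.2 E.one_lt
  have hM : 0 < (1 / (2 * Λ)) ^ (1 / (γ - 1)) := by positivity
  refine ⟨_, hM, fun T hT D u v hD hu hv t ht hui hvi huv => ?_⟩
  have h := H _ D T u v hM hD hT hu hv t ht hui hvi huv
  have e : Λ * ((1 / (2 * Λ)) ^ (1 / (γ - 1))) ^ (γ - 1) * D = D / 2 := by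
    rw [← Real.rpow_mul (by positivity), one_div_mul_cancel hγ.ne', Real.rpow_one]
    field_simp
  rwa [e] at h

theorem InBall.step (ζ : Cutoff) (E : Exponents N θ γ p q a b) (hM : 0 < M) (hT : T ≤ 1)
    (hc : Contracts θ γ p q a b M T N) {L : Sp N → ℝ → ℂ} (hL : InBall p q a b (M / 2) T L)
    (hu : InBall p q a b M T u) : InBall p q a b M T (fun x t => L x t + duhamel θ γ u x t) := by
  have hq : 0 < q := by linarith [E.one_lt_q]
  have hb := E.b_pos.le
  have hu' := hu.controlled hb hM.le
  have h0 := (inBall_zero (N := N) (p := p) (a := a) (b := b) (M := M) (T := T) hq).controlled hb hM.le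
  have hcont := hu'.continuousOn_duhamel ζ E hM.le hT
  -- Contraction against the zero function, whose Duhamel term vanishes, bounds the Duhamel term of
  -- `u` by half of the radius; the linear part takes the other half.
  have key := fun t (ht : t ∈ Set.Ioo 0 T) => hc M u (fun _ _ => 0) hM hu' h0 t ht
    (fun x => hu'.intervalIntegrable ζ E hM.le hT x ht) (fun x => h0.intervalIntegrable ζ E hM.le hT x ht)
    (fun τ hτ => by simpa using hu.mor τ ⟨hτ.1, hτ.2.trans ht.2⟩)
  simp only [duhamel_zero, sub_zero] at key
  have hhalf : ∀ c t : ℝ, 0 < t → ENNReal.ofReal (M / 2 * t ^ (-c)) + ENNReal.ofReal (M / 2 * t ^ (-c)) =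
      ENNReal.ofReal (M * t ^ (-c)) := by
    intro c t ht
    rw [← ENNReal.ofReal_add (by positivity) (by positivity)]
    congr 1
    ring
  refine ⟨hL.cont.add hcont, fun t ht => ?_, fun t ht x => ?_⟩
  · refine (Mor.add E.one_lt_q (continuous_slice hL.cont ht).enorm.measurable
      (continuous_slice hcont ht).enorm.measurable (hL.mor t ht) (key t ht).1).mono hq
      (fun x => enorm_add_le _ _) (hhalf a t ht.1).le
  · refine (enorm_add_le _ _).trans ((add_le_add (hL.sup t ht x) ((key t ht).2 (fun τ hτ y => ?_) x)).trans
      (hhalf b t ht.1).le)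
    exact hu.sup τ ⟨hτ.1, hτ.2.trans ht.2⟩ y

theorem inBall_picard (ζ : Cutoff) (E : Exponents N θ γ p q a b) (hM : 0 < M) (hT : T ≤ 1)
    (hc : Contracts θ γ p q a b M T N) {L : Sp N → ℝ → ℂ} (hL : InBall p q a b (M / 2) T L) (n : ℕ) :
    InBall p q a b M T (picard θ γ L n) := by
  induction n with
  | zero => exact inBall_zero (by linarith [E.one_lt_q])
  | succ n ih => exact InBall.step ζ E hM hT hc hL ih

theorem picard_sub_le (ζ : Cutoff) (E : Exponents N θ γ p q a b) (hM : 0 < M) (hT : T ≤ 1)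
    (hc : Contracts θ γ p q a b M T N) {L : Sp N → ℝ → ℂ} (hL : InBall p q a b (M / 2) T L) (n : ℕ) :
    ∀ t ∈ Set.Ioo 0 T,
      Mor p q (fun x => ‖picard θ γ L (n + 1) x t - picard θ γ L n x t‖ₑ)
        (ENNReal.ofReal (M * (1 / 2) ^ n * t ^ (-a))) ∧
      ∀ x, ‖picard θ γ L (n + 1) x t - picard θ γ L n x t‖ₑ ≤ ENNReal.ofReal (M * (1 / 2) ^ n * t ^ (-b)) := by
  induction n with
  | zero =>
    intro t ht
    have h := inBall_picard ζ E hM hT hc hL 1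
    have h0 : ∀ x, picard θ γ L 0 x t = 0 := fun x => rfl
    simp only [zero_add, h0, sub_zero, pow_zero, mul_one]
    exact ⟨h.mor t ht, h.sup t ht⟩
  | succ n ih =>
    intro t ht
    have h1 := (inBall_picard ζ E hM hT hc hL (n + 1)).controlled E.b_pos.le hM.le
    have h2 := (inBall_picard ζ E hM hT hc hL n).controlled E.b_pos.le hM.le
    have hsub : ∀ τ ∈ Set.Ioo 0 t, τ ∈ Set.Ioo 0 T := fun τ hτ => ⟨hτ.1, hτ.2.trans ht.2⟩
    have key := hc (M * (1 / 2) ^ n) _ _ (by positivity) h1 h2 t ht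
      (fun x => h1.intervalIntegrable ζ E hM.le hT x ht) (fun x => h2.intervalIntegrable ζ E hM.le hT x ht)
      (fun τ hτ => (ih τ (hsub τ hτ)).1)
    have e : M * (1 / 2) ^ n / 2 = M * (1 / 2) ^ (n + 1) := by rw [pow_succ]; ring
    have e2 : ∀ x, picard θ γ L (n + 1 + 1) x t - picard θ γ L (n + 1) x t =
        duhamel θ γ (picard θ γ L (n + 1)) x t - duhamel θ γ (picard θ γ L n) x t :=
      fun x => add_sub_add_left_eq_sub _ _ _
    simp only [e2]
    rw [e] at key
    exact ⟨key.1, key.2 fun τ hτ => (ih τ (hsub τ hτ)).2⟩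

/-- The sup estimates make the iterates converge uniformly on `(τ,T)` for every `τ > 0`, hence to a
continuous limit; Fatou's lemma keeps the Morrey bound and dominated convergence passes to the limit
in the Duhamel term. -/
theorem exists_fixedPoint (ζ : Cutoff) (E : Exponents N θ γ p q a b) (hM : 0 < M) (hT : T ≤ 1)
    (hc : Contracts θ γ p q a b M T N) {L : Sp N → ℝ → ℂ} (hL : InBall p q a b (M / 2) T L) :
    ∃ u : Sp N → ℝ → ℂ, InBall p q a b M T u ∧ (∀ x, ∀ t ∈ Set.Ioo 0 T, u x t = L x t + duhamel θ γ u x t) ∧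
      ∀ x, ∀ t ∉ Set.Ioo 0 T, u x t = 0 := by
  have hb := E.b_pos.le
  have hball := inBall_picard ζ E hM hT hc hL
  have hdist : ∀ x, ∀ t ∈ Set.Ioo 0 T, ∀ n, dist (picard θ γ L n x t) (picard θ γ L (n + 1) x t) ≤
      M * t ^ (-b) * (1 / 2) ^ n := by
    intro x t ht n
    have ht0 : 0 < t := ht.1
    rw [dist_comm, dist_eq_norm]
    refine (norm_le_of_enorm_le (by positivity) ((picard_sub_le ζ E hM hT hc hL n t ht).2 x)).trans (le_of_eq ?_)
    ring
  have hex : ∀ x t, ∃ l : ℂ, (t ∈ Set.Ioo 0 T → Filter.Tendsto (fun n => picard θ γ L n x t) Filter.atTop (nhds l)) ∧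
      (t ∉ Set.Ioo 0 T → l = 0) := by
    intro x t
    by_cases ht : t ∈ Set.Ioo 0 T
    · obtain ⟨l, hl⟩ := cauchySeq_tendsto_of_complete
        (cauchySeq_of_le_geometric (1 / 2) _ (by norm_num) (hdist x t ht))
      exact ⟨l, fun _ => hl, fun h => absurd ht h⟩
    · exact ⟨0, fun h => absurd h ht, fun _ => rfl⟩
  choose u hlim hzero using hex
  have hconv : ∀ τ ∈ Set.Ioo 0 T, TendstoUniformlyOn (fun n (z : Sp N × ℝ) => picard θ γ L n z.1 z.2)
      (fun z => u z.1 z.2) Filter.atTop (Set.univ ×ˢ Set.Ioo τ T) := by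
    intro τ hτ
    have hτ0 : 0 < τ := hτ.1
    rw [Metric.tendstoUniformlyOn_iff]
    intro ε hε
    have h0 : Filter.Tendsto (fun n : ℕ => M * τ ^ (-b) * (1 / 2 : ℝ) ^ n / (1 - 1 / 2)) Filter.atTop (nhds 0) := by
      have := ((tendsto_pow_atTop_nhds_zero_of_lt_one (by norm_num : (0 : ℝ) ≤ 1 / 2) (by norm_num)).const_mul
        (M * τ ^ (-b))).div_const (1 - 1 / 2)
      simpa using this
    filter_upwards [h0.eventually (gt_mem_nhds hε)] with n hn
    rintro ⟨x, t⟩ ⟨-, ht⟩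
    have ht : t ∈ Set.Ioo τ T := ht
    have htT : t ∈ Set.Ioo 0 T := ⟨hτ0.trans ht.1, ht.2⟩
    rw [dist_comm]
    refine (dist_le_of_le_geometric_of_tendsto (1 / 2) _ (by norm_num) (hdist x t htT) (hlim x t htT) n).trans_lt
      (lt_of_le_of_lt ?_ hn)
    have := Real.rpow_le_rpow_of_nonpos hτ0 ht.1.le (by linarith : -b ≤ 0)
    gcongr
  refine ⟨u, ⟨?_, fun t ht => ?_, fun t ht x => ?_⟩, fun x t ht => ?_, fun x t ht => hzero x t ht⟩
  · rintro ⟨x, t⟩ ⟨-, ht⟩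
    have ht : t ∈ Set.Ioo 0 T := ht
    have ht0 : 0 < t := ht.1
    have h1 := (hconv (t / 2) ⟨by positivity, by linarith [ht.2]⟩).continuousOn
      (Filter.Eventually.of_forall fun n => (hball n).cont.mono
        (Set.prod_mono le_rfl (Set.Ioo_subset_Ioo_left (by positivity)))).frequently
    exact (h1.continuousAt ((isOpen_univ.prod isOpen_Ioo).mem_nhds
      (Set.mk_mem_prod (Set.mem_univ x) ⟨by linarith, ht.2⟩))).continuousWithinAt
  · exact Mor.of_tendsto (fun n => (continuous_slice (hball n).cont ht).enorm.measurable)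
      (fun n => (hball n).mor t ht) fun x => (continuous_enorm.tendsto _).comp (hlim x t ht)
  · exact le_of_tendsto ((continuous_enorm.tendsto _).comp (hlim x t ht))
      (Filter.Eventually.of_forall fun n => (hball n).sup t ht x)
  · have h1 := (Filter.tendsto_add_atTop_iff_nat 1).2 (hlim x t ht)
    have h2 := (tendsto_duhamel ζ E hM.le hT (fun n => (hball n).controlled hb hM.le)
      (fun τ hτ => ⟨_, fun n x t ht => (hball n).norm_le hb hM.le hτ.1 x ht⟩) hlim x ht).const_add (L x t)
    exact tendsto_nhds_unique h1 h2

theorem eq_zero_of_mor {f : Sp N → ℂ} (hq : 0 < q) (hf : Continuous f) {C : ℝ}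
    (h : ∀ n : ℕ, Mor p q (fun x => ‖f x‖ₑ) (ENNReal.ofReal (C * (1 / 2) ^ n))) (x : Sp N) : f x = 0 := by
  have h1 : ∫⁻ y in Metric.ball x 1, ‖f y‖ₑ ^ q = 0 := by
    have hlim : Filter.Tendsto (fun n : ℕ => ENNReal.ofReal ((1 : ℝ) ^ (N - N * q / p)) *
        ENNReal.ofReal (C * (1 / 2) ^ n) ^ q) Filter.atTop
        (nhds (ENNReal.ofReal ((1 : ℝ) ^ (N - N * q / p)) * ENNReal.ofReal (C * 0) ^ q)) := by
      refine ENNReal.Tendsto.const_mul ?_ (Or.inr ENNReal.ofReal_ne_top)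
      refine ((ENNReal.continuous_rpow_const.comp ENNReal.continuous_ofReal).tendsto _).comp ?_
      exact (tendsto_pow_atTop_nhds_zero_of_lt_one (by norm_num) (by norm_num)).const_mul C
    rw [mul_zero, ENNReal.ofReal_zero, ENNReal.zero_rpow_of_pos hq, mul_zero] at hlim
    exact le_antisymm (ge_of_tendsto' hlim fun n => h n x 1 one_pos le_rfl) zero_le
  rw [lintegral_eq_zero_iff (hf.enorm.measurable.pow_const q)] at h1
  have h2 : f =ᵐ[volume.restrict (Metric.ball x 1)] fun _ => 0 := by
    filter_upwards [h1] with y hy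
    simpa [ENNReal.rpow_eq_zero_iff, hq, not_lt.2 hq.le] using hy
  exact Measure.eqOn_open_of_ae_eq h2 Metric.isOpen_ball hf.continuousOn continuousOn_const
    (Metric.mem_ball_self one_pos)

/-- A general solution carries no rate for its sup norm, so only the Morrey half of the contraction
is used. The difference starts from the bound `2M t^{-a}`, which each application halves, and a
continuous function with arbitrarily small Morrey norm is zero. -/
theorem fixedPoint_unique (E : Exponents N θ γ p q a b) (hM : 0 < M)
    (hc : Contracts θ γ p q a b M T N) {L : Sp N → ℝ → ℂ} (hu : Controlled p q a M T u) (hv : Controlled p q a M T v)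
    (hui : ∀ x, ∀ t ∈ Set.Ioo 0 T, IntervalIntegrable (duhamelIntegrand θ γ u x t) volume 0 t)
    (hvi : ∀ x, ∀ t ∈ Set.Ioo 0 T, IntervalIntegrable (duhamelIntegrand θ γ v x t) volume 0 t)
    (hue : ∀ x, ∀ t ∈ Set.Ioo 0 T, u x t = L x t + duhamel θ γ u x t)
    (hve : ∀ x, ∀ t ∈ Set.Ioo 0 T, v x t = L x t + duhamel θ γ v x t) (x : Sp N) {t : ℝ}
    (ht : t ∈ Set.Ioo 0 T) : u x t = v x t := by
  have hq : 0 < q := by linarith [E.one_lt_q]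
  have key : ∀ n : ℕ, ∀ t ∈ Set.Ioo 0 T, Mor p q (fun x => ‖u x t - v x t‖ₑ)
      (ENNReal.ofReal (2 * M * (1 / 2) ^ n * t ^ (-a))) := by
    intro n
    induction n with
    | zero =>
      intro t ht
      have ht0 : 0 < t := ht.1
      refine (Mor.add E.one_lt_q (continuous_slice hu.cont ht).enorm.measurable
        (continuous_slice hv.cont ht).enorm.measurable (hu.mor t ht) (hv.mor t ht)).mono hq
        (fun x => enorm_sub_le) (le_of_eq ?_)
      rw [← ENNReal.ofReal_add (by positivity) (by positivity)]
      congr 1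
      ring
    | succ n ih =>
      intro t ht
      have h := (hc (2 * M * (1 / 2) ^ n) u v (by positivity) hu hv t ht (fun x => hui x t ht)
        (fun x => hvi x t ht) (fun τ hτ => ih τ ⟨hτ.1, hτ.2.trans ht.2⟩)).1
      have e : 2 * M * (1 / 2) ^ n / 2 = 2 * M * (1 / 2) ^ (n + 1) := by rw [pow_succ]; ring
      have e2 : ∀ x, u x t - v x t = duhamel θ γ u x t - duhamel θ γ v x t := fun x => by
        rw [hue x t ht, hve x t ht, add_sub_add_left_eq_sub]
      simp only [e2]
      rwa [e] at h
  have h := eq_zero_of_mor (p := p) (C := 2 * M * t ^ (-a)) hq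
    ((continuous_slice hu.cont ht).sub (continuous_slice hv.cont ht)) (fun n => by
      have := key n t ht
      rwa [mul_right_comm] at this) x
  exact sub_eq_zero.1 h

end Contraction

/-! ### From the hypotheses on the exponents to the theorem -/

/-- The lower bound `s > -θ/γ` becomes integrability of `τ^{-aγ}` at zero, and `s ≥ N/p - θ/(γ-1)`
becomes the scaling inequality `critical`. -/
theorem exponents_of_hypotheses {θ γ p q s : ℝ} (hθ : 0 < θ) (hγ : 1 < γ) (hγq : γ ≤ q) (hqp : q ≤ p)
    (hs₁ : -θ / γ < s) (hs₂ : s < 0) (hs₃ : (N : ℝ) / p - θ / (γ - 1) ≤ s) :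
    Exponents N θ γ p q (-s / θ) (N / (p * θ) + -s / θ) := by
  have hp : 0 < p := by linarith
  have hγ1 : 0 < γ - 1 := sub_pos.2 hγ
  refine ⟨hθ, hγ, hγq, hqp, div_pos (by linarith) hθ, ?_, rfl, ?_⟩
  · rw [div_lt_iff₀ (by linarith)] at hs₁
    rw [div_mul_eq_mul_div, div_lt_one hθ]
    linarith
  · have h1 : (N : ℝ) / p - s ≤ θ / (γ - 1) := by linarith
    rw [le_div_iff₀ hγ1] at h1
    have e : (N : ℝ) * (γ - 1) / (p * θ) + -s / θ * (γ - 1) = (N / p - s) * (γ - 1) / θ := by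
      field_simp
      ring
    rw [e, div_le_one hθ]
    exact h1

theorem mor_of_timeWeightedNorm_le {θ s p q M T : ℝ} (hq : 0 < q) {u : Sp N → ℝ → ℂ}
    (h : timeWeightedNorm θ s p q T u ≤ ENNReal.ofReal M) {t : ℝ} (ht : t ∈ Set.Ioo 0 T) :
    Mor p q (fun x => ‖u x t‖ₑ) (ENNReal.ofReal (M * t ^ (-(-s / θ)))) := by
  refine (morreyNorm_le_iff hq).1 (ofReal_mul_le_iff ht.1 ?_)
  exact (le_iSup₂_of_le (f := fun (t : ℝ) (_ : 0 < t ∧ t ≤ T) =>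
    ENNReal.ofReal (t ^ (-s / θ)) * morreyNorm p q fun x => u x t) t ⟨ht.1, ht.2.le⟩ le_rfl).trans h

end BesovMorrey

end

theorem theorem1p1 (N : ℕ) (hN : 1 ≤ N) (ζ : BesovMorrey.Cutoff)
    (θ γ p q s : ℝ) (hθ : 0 < θ) (hγ : 1 < γ) (hγq : γ ≤ q) (hqp : q ≤ p)
    (hs₁ : -θ / γ < s) (hs₂ : s < 0) (hs₃ : (N : ℝ) / p - θ / (γ - 1) ≤ s) :
    ∃ δ M : ℝ, 0 < δ ∧ 0 < M ∧
      ∀ φ : TemperedDistribution (BesovMorrey.Sp N) ℂ,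
        BesovMorrey.MemBesovMorrey ζ s p q φ →
        Filter.limsup (BesovMorrey.dyadicSize ζ s p q φ) Filter.atTop < ENNReal.ofReal δ →
        ∃ T : ℝ, 0 < T ∧ ∃ u : BesovMorrey.Sp N → ℝ → ℂ,
          (BesovMorrey.IsSolution ζ hθ γ φ T u ∧
            BesovMorrey.timeWeightedNorm θ s p q T u ≤ ENNReal.ofReal M) ∧
          ∀ v : BesovMorrey.Sp N → ℝ → ℂ,
            BesovMorrey.IsSolution ζ hθ γ φ T v →
            BesovMorrey.timeWeightedNorm θ s p q T v ≤ ENNReal.ofReal M →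
            ∀ x, ∀ t ∈ Set.Ioo 0 T, v x t = u x t := by
  have E := BesovMorrey.exponents_of_hypotheses hθ hγ hγq hqp hs₁ hs₂ hs₃
  have hp := E.p_pos
  have hq : 0 < q := by linarith
  have ha : -s / θ * θ = -s := by field_simp
  have hb : ((N : ℝ) / (p * θ) + -s / θ) * θ = N / p - s := by field_simp; ring
  obtain ⟨M, hM, hcon⟩ := E.exists_contracts ζ
  obtain ⟨K, hK, hlin⟩ := BesovMorrey.exists_linearFlow_le N ζ (p := p) hθ E.one_lt_q E.a_pos E.b_pos ha hb
  -- This `δ` gives `K δ = M/2`, so that the linear evolution fills half of the ball of radius `M`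
  -- for small times.
  refine ⟨M / (2 * K), M, by positivity, hM, fun φ hφ hlim => ?_⟩
  have hev := hlin φ hφ (M / (2 * K)) (by positivity) hlim
  have e : K * (M / (2 * K)) = M / 2 := by field_simp
  rw [e] at hev
  obtain ⟨ε, hε, hsub⟩ := mem_nhdsGT_iff_exists_Ioo_subset.1 hev
  have hε : 0 < ε := hε
  have hT0 : 0 < min ε 1 := by positivity
  have hT1 : min ε 1 ≤ 1 := min_le_right _ _
  set T := min ε 1
  have hTε : Set.Ioo 0 T ⊆ Set.Ioo 0 ε := Set.Ioo_subset_Ioo_right (min_le_left _ _)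
  have hL : BesovMorrey.InBall p q (-s / θ) (N / (p * θ) + -s / θ) (M / 2) T (BesovMorrey.linearFlow ζ hθ φ) :=
    ⟨(BesovMorrey.continuousOn_linearFlow ζ hθ E.one_lt_q hs₂.le E.b_pos hb hφ).mono
      (Set.prod_mono le_rfl Set.Ioo_subset_Ioi_self), fun t ht => (hsub (hTε ht)).1, fun t ht => (hsub (hTε ht)).2⟩
  obtain ⟨u, hu, hue, hu0⟩ := BesovMorrey.exists_fixedPoint ζ E hM hT1 (hcon T hT1) hL
  have huc := hu.controlled E.b_pos.le hM.le
  have hui := fun x t (ht : t ∈ Set.Ioo 0 T) => huc.intervalIntegrable ζ E hM.le hT1 x ht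
  refine ⟨T, hT0, u, ⟨⟨fun τ hτ => hu.cont.mono (Set.prod_mono le_rfl (Set.Ioo_subset_Ioo_left hτ.1.le)),
    huc.bdd, hui, fun x t ht htT => ?_⟩, ?_⟩, fun v hv hvM x t ht => ?_⟩
  · rw [hue x t ⟨ht, htT⟩, BesovMorrey.linearFlow_of_pos ζ hθ ht]
    rfl
  · refine iSup₂_le fun t ht => ?_
    -- The weighted norm includes the time `t = T`, where the integral equation says nothing; the
    -- fixed point was set to zero there.
    rcases ht.2.lt_or_eq with h | h
    · have h1 := (BesovMorrey.morreyNorm_le_iff hq).2 (hu.mor t ⟨ht.1, h⟩)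
      refine (mul_le_mul' le_rfl h1).trans (le_of_eq ?_)
      have ht0 := ht.1
      rw [← ENNReal.ofReal_mul (by positivity), mul_left_comm, ← Real.rpow_add ht0, add_neg_cancel,
        Real.rpow_zero, mul_one]
    · have h1 : BesovMorrey.morreyNorm p q (fun x => u x t) ≤ 0 := by
        refine (BesovMorrey.morreyNorm_le_iff hq).2 ?_
        have : ∀ x, u x t = 0 := fun x => hu0 x t fun h' => absurd h'.2 (not_lt.2 h.ge)
        simpa [this] using BesovMorrey.mor_zero hq 0
      rw [le_antisymm h1 zero_le, mul_zero]
      exact zero_le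
  · have hvcont : ContinuousOn (fun z : BesovMorrey.Sp N × ℝ => v z.1 z.2) (Set.univ ×ˢ Set.Ioo 0 T) := by
      rintro ⟨y, r⟩ ⟨-, hr⟩
      have hr : r ∈ Set.Ioo 0 T := hr
      have hr0 : 0 < r := hr.1
      exact ((hv.continuousOn (r / 2) ⟨by positivity, by linarith [hr.2]⟩).continuousAt
        ((isOpen_univ.prod isOpen_Ioo).mem_nhds
          (Set.mk_mem_prod (Set.mem_univ y) ⟨by linarith, hr.2⟩))).continuousWithinAt
    have hvc : BesovMorrey.Controlled p q (-s / θ) M T v :=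
      ⟨hvcont, hv.bounded, fun t ht => BesovMorrey.mor_of_timeWeightedNorm_le hq hvM ht⟩
    refine BesovMorrey.fixedPoint_unique E hM (hcon T hT1) hvc huc hv.integrable hui (fun x t ht => ?_) hue x ht
    rw [hv.eq x t ht.1 ht.2, BesovMorrey.linearFlow_of_pos ζ hθ ht.1]
    rfl
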